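/- **Theorem.** All trees are rooted, ordered and labeled. Write $n_S$ and $l_S$ for the number of nodes and of leaves of a tree $S$, and $S(v)$ for the subtree of $S$ rooted at the node $v$. Deleting a node $v$ means inserting the children of $v$, in their order, in the place of $v$ among its siblings and removing $v$ (deleting the root leaves the ordered forest of its subtrees). A tree $P$ is included in $T$, written $P\sqsubseteq T$, if $P$ can be obtained from $T$ by deleting nodes. The tree inclusion problem is, given $P$ and $T$, to determine whether $P\sqsubseteq T$ and, if so, to report all subtrees $T(v)$ of $T$ with $P\sqsubseteq T(v)$. There is an algorithm for the unit-cost RAM with word size $\Theta(\log n_T)$ (with the usual instructions: addition, subtraction, multiplication, bitwise boolean operations, shifts, comparisons, and indirect memory access; every label is one word) that solves the tree inclusion problem for all trees $P$ and $T$ with $1\le n_P\le n_T$ in $O(l_P\, n_T)$ time and $O(n_T)$ space, where space is the number of words used. In detail: there are one fixed program and constants $c_1,c_2$ such that, for every word size $w$ with $2^w\ge c_2 n_T$ and all such $P$, $T$ with labels in $\{0,\dots,2^w-1\}$, the program halts after at most $c_1 l_P n_T$ steps on a machine with $c_2 n_T$ words of memory of $w$ bits each (besides the constantly many registers named in the program)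 with the correct answer. The input consists of $n_P$, $n_T$ and, for the nodes of $P$ and then those of $T$ in preorder, the label and the preorder number of the parent; the subtrees $T(v)$ are reported by the preorder numbers of their roots $v$ in increasing order. -/

import Mathlib

namespace TreeInclusion

/-! ### Rooted, ordered, labelled trees

Labels are natural numbers; the alphabet is not bounded by a constant. -/

inductive OTree : Type
  | node (label : ℕ) (children : List OTree) : OTree

namespace OTree

def label : OTree → ℕ
  | node a _ => a

def children : OTree → List OTree
  | node _ ts => ts

mutual
/-- The subtrees `T(v)`, for all nodes `v` of `T`, in the preorder of `v`. The entry at position `i`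
is the subtree rooted at the node `v` with `pre(v) = i`. -/
def preorder : OTree → List OTree
  | node a ts => node a ts :: preorderForest ts
def preorderForest : List OTree → List OTree
  | [] => []
  | t :: ts => preorder t ++ preorderForest ts
end

/-- The number of nodes. -/
def size (T : OTree) : ℕ := T.preorder.length

/-- The number of leaves, i.e. of nodes without children. -/
def numLeaves (T : OTree) : ℕ := T.preorder.countP (fun t => t.children.isEmpty)

mutual
/-- Two words for each node `v`, in preorder: the label of `v` and the preorder number of the parent
of `v`. Here `i` is the preorder number of the root of the tree at hand and `p` that of its
parent. -/
def encodeFrom (i p : ℕ) : OTree → List ℕ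
  | node a ts => a :: p :: encodeForestFrom (i + 1) i ts
def encodeForestFrom (i p : ℕ) : List OTree → List ℕ
  | [] => []
  | t :: ts => encodeFrom i p t ++ encodeForestFrom (i + t.size) p ts
end

/-- The representation of a tree in memory. The root is node `0`; it has no parent, and its parent
word is `0`. -/
def encode (T : OTree) : List ℕ := encodeFrom 0 0 T

end OTree

/-- `Delete F G`: the ordered forest `G` arises from the ordered forest `F` by deleting one node,
whose children take its place among its siblings. (Deleting the root of a tree leaves the forest of
its children.) -/
inductive Delete : List OTree → List OTree → Prop
  | here (a : ℕ) (ts rest : List OTree) : Delete (.node a ts :: rest) (ts ++ rest)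
  | inside (a : ℕ) {ts ts' : List OTree} (rest : List OTree) (h : Delete ts ts') :
      Delete (.node a ts :: rest) (.node a ts' :: rest)
  | right (t : OTree) {rest rest' : List OTree} (h : Delete rest rest') :
      Delete (t :: rest) (t :: rest')

/-- `P ⊑ T`: the tree `P` can be obtained from `T` by deleting nodes. -/
def Included (P T : OTree) : Prop := Relation.ReflTransGen Delete [T] [P]

/-! ### The unit-cost word RAM -/

inductive BinOp : Type
  | add | sub | mul | and | or | xor | shl | shr

/-- Operations on `w`-bit words; arithmetic is modulo `2 ^ w`. -/
def BinOp.eval (w : ℕ) : BinOp → ℕ → ℕ → ℕ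
  | add, x, y => (x + y) % 2 ^ w
  | sub, x, y => (x + (2 ^ w - y)) % 2 ^ w
  | mul, x, y => (x * y) % 2 ^ w
  | and, x, y => x &&& y
  | or, x, y => x ||| y
  | xor, x, y => x ^^^ y
  | shl, x, y => (x <<< y) % 2 ^ w
  | shr, x, y => x >>> y

/-- Instructions. `d`, `a`, `b` are names of registers, `l` is a position in the program. -/
inductive Instr : Type
  /-- `r_d := k` -/
  | const (d k : ℕ)
  /-- `r_d := r_a` -/
  | move (d a : ℕ)
  /-- `r_d := r_a op r_b` -/
  | binop (op : BinOp) (d a b : ℕ)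
  /-- `r_d := M[r_a]` -/
  | load (d a : ℕ)
  /-- `M[r_a] := r_b` -/
  | store (a b : ℕ)
  /-- `goto l` -/
  | jump (l : ℕ)
  /-- `if r_a = r_b then goto l` -/
  | jumpEq (a b l : ℕ)
  /-- `if r_a < r_b then goto l` -/
  | jumpLt (a b l : ℕ)
  | halt

/-- A program is a finite list of instructions, so that it names only finitely many registers. -/
abbrev Program : Type := List Instr

structure Config : Type where
  pc : ℕ
  reg : ℕ → ℕ
  mem : ℕ → ℕ

/-- One step of the machine with word size `w` and `s` words of memory, at the addresses
`0, …, s - 1`. There is no next configuration after `halt`, and none if the program addresses a cell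
outside the memory or leaves the list of its instructions. -/
def step (prog : Program) (w s : ℕ) (c : Config) : Option Config :=
  match prog[c.pc]? with
  | none => none
  | some (.const d k) =>
      some { c with pc := c.pc + 1, reg := Function.update c.reg d (k % 2 ^ w) }
  | some (.move d a) =>
      some { c with pc := c.pc + 1, reg := Function.update c.reg d (c.reg a) }
  | some (.binop op d a b) =>
      some { c with
        pc := c.pc + 1
        reg := Function.update c.reg d (op.eval w (c.reg a) (c.reg b)) }
  | some (.load d a) =>
      if c.reg a < s then
        some { c with pc := c.pc + 1, reg := Function.update c.reg d (c.mem (c.reg a)) }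
      else none
  | some (.store a b) =>
      if c.reg a < s then
        some { c with pc := c.pc + 1, mem := Function.update c.mem (c.reg a) (c.reg b) }
      else none
  | some (.jump l) => some { c with pc := l }
  | some (.jumpEq a b l) => some { c with pc := if c.reg a = c.reg b then l else c.pc + 1 }
  | some (.jumpLt a b l) => some { c with pc := if c.reg a < c.reg b then l else c.pc + 1 }
  | some .halt => none

/-- The configuration after exactly `t` steps, if there is one. -/
def run (prog : Program) (w s : ℕ) : ℕ → Config → Option Config
  | 0, c => some c
  | t + 1, c => (step prog w s c).bind (run prog w s t)

/-- Started in `c`, the machine with word size `w` and `s` words of memory stops at a `halt`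
instruction after `t` steps, in the configuration `c'`. -/
def HaltsIn (prog : Program) (w s : ℕ) (c : Config) (t : ℕ) (c' : Config) : Prop :=
  run prog w s t c = some c' ∧ prog[c'.pc]? = some .halt

/-! ### The tree inclusion problem on the word RAM -/

/-- The memory holds `n_P`, `n_T`, the representation of `P` and that of `T`, from address `0` on,
and zeros behind; all registers are zero. -/
def initialConfig (P T : OTree) : Config where
  pc := 0
  reg := fun _ => 0
  mem := fun i => (P.size :: T.size :: (P.encode ++ T.encode)).getD i 0

/-- The machine has solved the tree inclusion problem for `P` and `T`: register `0` tells whether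
`P ⊑ T`, register `1` holds the number of subtrees of `T` that include `P`, and the memory lists,
from address `0` on, the preorder numbers of their roots in increasing order. -/
def SolvesInclusion (P T : OTree) (c : Config) : Prop :=
  (Included P T → c.reg 0 = 1) ∧ (¬ Included P T → c.reg 0 = 0) ∧
  ∃ L : List ℕ,
    L.Pairwise (· < ·) ∧
    (∀ i, i ∈ L ↔ ∃ S, T.preorder[i]? = some S ∧ Included P S) ∧
    c.reg 1 = L.length ∧
    ∀ (j : ℕ) (hj : j < L.length), c.mem j = L[j]

end TreeInclusion

/-!
A forest is included in the forest of the nodes with preorder numbers in `[a, b)` (`Fits`) exactly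
if its trees are matched, one behind the other, with disjoint intervals of descendants
(`included_iff_fits`). For a single tree only the deepest nodes whose subtrees include it matter
(`MinAt`, `fits_iff_minAt`). Their subtrees are disjoint and at least as large as the tree, so that
for a pattern tree `t` and a text with `n` nodes there are at most `n / size t` of them
(`IsTree.card_minAt_mul_size_le`).

The pattern is cut into maximal chains of nodes with one child each (`IsChain`). Below the bottom of
a chain there is a forest `F` that is empty or has at least two trees, so that the number of chains
is less than twice the number of leaves. It therefore suffices to spend time `O(n)` on each chain.

* Given for each text node whether `F` is included below it, one pass over the text in reverse
  preorder finds the nodes whose subtrees include the tree `t` that begins with the chain. The pass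
  keeps for each node one number, its level: how much of the chain, from its bottom upwards, is
  included with `F` below the node or in its subtree (`levels_spec`).
* Inclusion of a forest of siblings is represented by a list of windows (`Windows`), one for each of
  the deepest nodes that include the tree from which the list was made. A window is extended by a
  tree on its right or on its left by the choice of the nearest deepest node on that side; tables
  for this are made in one pass (`extendRight_spec`, `extendLeft_spec`). From the windows of `F` one
  more pass finds the nodes below which `F` is included (`windowEnds_spec`).

For space `O(n)` the lists of windows of all open branching nodes have to fit on one stack. The list
of a node is made from its heavy child, which has a largest subtree; the siblings on its right
extend it in ascending order, and those on its left in descending order. While the heavy child is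
under work its parent has no list yet. A list made from a heavy child of size `k` has at most
`n / k` windows, and a light child of a node of size `m` has size at most `k` and at most `m / 2`;
hence the height of the stack when the work on a pattern subtree of size `m` begins is always at
most `2 * n / m` (`height_mul_le`).

The algorithm is written in a small structured language with variables and arrays. `Exec.run_code`
translates its programs to the word RAM with a constant loss of time. `works` is the induction over
the pattern subtrees, with the bounds for time and space, and `main_spec` states the correctness of
the whole program.
-/

namespace TreeInclusion

/-! ### A structured language -/

/-- The variables of the structured program; each one is kept in a register. -/
inductive Var : Type
  | rAns | rCnt | rNP | rNT | rOff | rI | rX | rY | rV | rB | rP | rH | rSP | rMode | rT | rS | rC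
  deriving DecidableEq

/-- The arrays of the structured program. All of them have the same capacity, and they lie in memory
one behind the other, so that `aInp` is where the input is found. -/
inductive Arr : Type
  | aInp | aLabP | aParP | aEndP | aHvy | aPrv | aFrm | aTop | aLabT | aParT | aEndT | aAcc | aInc
  | aMk | aBuf | aSL | aSE
  deriving DecidableEq

open Var Arr OTree

/-- The register that holds a variable. -/
def Var.idx : Var → ℕ
  | rAns => 0 | rCnt => 1 | rNP => 2 | rNT => 3 | rOff => 4 | rI => 5 | rX => 6 | rY => 7 | rV => 8
  | rB => 9 | rP => 10 | rH => 11 | rSP => 12 | rMode => 13 | rT => 14 | rS => 15 | rC => 16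

/-- The position of an array among the arrays in memory. -/
def Arr.idx : Arr → ℕ
  | aInp => 0 | aLabP => 1 | aParP => 2 | aEndP => 3 | aHvy => 4 | aPrv => 5 | aFrm => 6 | aTop => 7
  | aLabT => 8 | aParT => 9 | aEndT => 10 | aAcc => 11 | aInc => 12 | aMk => 13 | aBuf => 14
  | aSL => 15 | aSE => 16

theorem Var.idx_injective : Function.Injective Var.idx := by
  intro x y h
  cases x <;> cases y <;> first | rfl | (simp [Var.idx] at h)

theorem Arr.idx_injective : Function.Injective Arr.idx := by
  intro x y h
  cases x <;> cases y <;> first | rfl | (simp [Arr.idx] at h)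

theorem Var.idx_lt (x : Var) : x.idx < 17 := by cases x <;> simp [Var.idx]

theorem Arr.idx_lt (k : Arr) : k.idx < 17 := by cases k <;> simp [Arr.idx]

/-- A state of the structured program: the values of the variables and of the array cells. -/
structure State : Type where
  v : Var → ℕ
  a : Arr → ℕ → ℕ

/-- The state after the assignment of `e` to the variable `x`. -/
def State.setV (σ : State) (x : Var) (e : ℕ) : State := { σ with v := Function.update σ.v x e }

/-- The state after the assignment of `e` to the cell `i` of the array `k`. -/
def State.setA (σ : State) (k : Arr) (i e : ℕ) : State :=
  { σ with a := Function.update σ.a k (Function.update (σ.a k) i e) }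

@[simp] theorem State.setV_v (σ : State) (x : Var) (e : ℕ) (y : Var) :
    (σ.setV x e).v y = if y = x then e else σ.v y := by
  simp [State.setV, Function.update_apply]

@[simp] theorem State.setV_a (σ : State) (x : Var) (e : ℕ) : (σ.setV x e).a = σ.a := rfl

@[simp] theorem State.setA_v (σ : State) (k : Arr) (i e : ℕ) : (σ.setA k i e).v = σ.v := rfl

@[simp] theorem State.setA_a (σ : State) (k : Arr) (i e : ℕ) (l : Arr) (j : ℕ) :
    (σ.setA k i e).a l j = if l = k ∧ j = i then e else σ.a l j := by
  by_cases h : l = k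
  · subst h; simp [State.setA, Function.update_apply]
  · simp [State.setA, h]

@[simp] theorem State.setA_a_of_ne (σ : State) {k l : Arr} (h : l ≠ k) (i e : ℕ) :
    (σ.setA k i e).a l = σ.a l := by simp [State.setA, h]

/-- Expressions. The coercions and numerals below let programs be written with `rI + 1` for the sum
of a variable and a literal, and `aBuf rI` for an array cell. -/
inductive Expr : Type
  | lit (k : ℕ)
  | var (x : Var)
  | add (a b : Expr)
  | sub (a b : Expr)
  /-- the cell of the array `k` with index `e` -/
  | get (k : Arr) (e : Expr)

instance : Coe Var Expr := ⟨Expr.var⟩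
instance (k : ℕ) : OfNat Expr k := ⟨Expr.lit k⟩
instance : Add Expr := ⟨Expr.add⟩
instance : Sub Expr := ⟨Expr.sub⟩
instance : CoeFun Arr (fun _ => Expr → Expr) := ⟨Expr.get⟩

/-- The value of an expression in a state. Subtraction is that of `ℕ`; `Expr.Ok` excludes the case
in which it would be truncated. -/
def Expr.eval (σ : State) : Expr → ℕ
  | lit k => k
  | var x => σ.v x
  | add a b => a.eval σ + b.eval σ
  | sub a b => a.eval σ - b.eval σ
  | get k e => σ.a k (e.eval σ)

/-- The evaluation of an expression meets no overflow, no negative number and no index beyond the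
capacity `cap` of the arrays, for words that hold the numbers below `W`. -/
def Expr.Ok (W cap : ℕ) (σ : State) : Expr → Prop
  | lit k => k < W
  | var _ => True
  | add a b => a.Ok W cap σ ∧ b.Ok W cap σ ∧ a.eval σ + b.eval σ < W
  | sub a b => a.Ok W cap σ ∧ b.Ok W cap σ ∧ b.eval σ ≤ a.eval σ
  | get _ e => e.Ok W cap σ ∧ e.eval σ < cap

section
variable (W cap : ℕ) (σ : State) (a b : Expr)

@[simp] theorem Expr.eval_lit (k : ℕ) : (Expr.lit k).eval σ = k := rfl
@[simp] theorem Expr.eval_ofNat (k : ℕ) : (ofNat(k) : Expr).eval σ = k := rfl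
@[simp] theorem Expr.eval_var (x : Var) : (Expr.var x).eval σ = σ.v x := rfl
@[simp] theorem Expr.eval_add : (a + b).eval σ = a.eval σ + b.eval σ := rfl
@[simp] theorem Expr.eval_sub : (a - b).eval σ = a.eval σ - b.eval σ := rfl
@[simp] theorem Expr.eval_get (k : Arr) : (Expr.get k a).eval σ = σ.a k (a.eval σ) := rfl
@[simp] theorem Expr.ok_lit (k : ℕ) : (Expr.lit k).Ok W cap σ ↔ k < W := Iff.rfl
@[simp] theorem Expr.ok_ofNat (k : ℕ) : (ofNat(k) : Expr).Ok W cap σ ↔ k < W := Iff.rfl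
@[simp] theorem Expr.ok_var (x : Var) : (Expr.var x).Ok W cap σ := trivial
@[simp] theorem Expr.ok_add : (a + b).Ok W cap σ ↔
    a.Ok W cap σ ∧ b.Ok W cap σ ∧ a.eval σ + b.eval σ < W := Iff.rfl
@[simp] theorem Expr.ok_sub : (a - b).Ok W cap σ ↔
    a.Ok W cap σ ∧ b.Ok W cap σ ∧ b.eval σ ≤ a.eval σ := Iff.rfl
@[simp] theorem Expr.ok_get (k : Arr) : (Expr.get k a).Ok W cap σ ↔
    a.Ok W cap σ ∧ a.eval σ < cap := Iff.rfl

end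

/-- The tests of conditional commands and loops. -/
inductive Cond : Type
  | eq (a b : Expr)
  | lt (a b : Expr)

@[simp] def Cond.Holds (σ : State) : Cond → Prop
  | eq a b => a.eval σ = b.eval σ
  | lt a b => a.eval σ < b.eval σ

@[simp] def Cond.Ok (W cap : ℕ) (σ : State) : Cond → Prop
  | eq a b => a.Ok W cap σ ∧ b.Ok W cap σ
  | lt a b => a.Ok W cap σ ∧ b.Ok W cap σ

/-- The commands of the structured language. -/
inductive Cmd : Type
  | skip
  /-- `x := e` -/
  | set (x : Var) (e : Expr)
  /-- `k[i] := e` -/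
  | put (k : Arr) (i e : Expr)
  | seq (c d : Cmd)
  | ite (q : Cond) (c d : Cmd)
  | loop (q : Cond) (c : Cmd)

infixr:60 " ;; " => Cmd.seq

/-- `Exec W cap c σ t σ'`: the command `c` leads from `σ` to `σ'`, where `t` assignments and tests
are executed, and nothing goes wrong on a machine with words for the numbers below `W` and arrays
of capacity `cap`. -/
inductive Exec (W cap : ℕ) : Cmd → State → ℕ → State → Prop
  | skip (σ : State) : Exec W cap .skip σ 0 σ
  | set {σ : State} {x : Var} {e : Expr} (h : e.Ok W cap σ) :
      Exec W cap (.set x e) σ 1 (σ.setV x (e.eval σ))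
  | put {σ : State} {k : Arr} {i e : Expr} (hi : i.Ok W cap σ) (he : e.Ok W cap σ)
      (hc : i.eval σ < cap) : Exec W cap (.put k i e) σ 1 (σ.setA k (i.eval σ) (e.eval σ))
  | seq {c d : Cmd} {σ σ₁ σ₂ : State} {s t : ℕ} (hc : Exec W cap c σ s σ₁)
      (hd : Exec W cap d σ₁ t σ₂) : Exec W cap (.seq c d) σ (s + t) σ₂
  | iteTrue {q : Cond} {c d : Cmd} {σ σ₁ : State} {t : ℕ} (hq : q.Ok W cap σ) (h : q.Holds σ)
      (hc : Exec W cap c σ t σ₁) : Exec W cap (.ite q c d) σ (t + 1) σ₁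
  | iteFalse {q : Cond} {c d : Cmd} {σ σ₁ : State} {t : ℕ} (hq : q.Ok W cap σ) (h : ¬ q.Holds σ)
      (hd : Exec W cap d σ t σ₁) : Exec W cap (.ite q c d) σ (t + 1) σ₁
  | loopTrue {q : Cond} {c : Cmd} {σ σ₁ σ₂ : State} {s t : ℕ} (hq : q.Ok W cap σ) (h : q.Holds σ)
      (hc : Exec W cap c σ s σ₁) (hl : Exec W cap (.loop q c) σ₁ t σ₂) :
      Exec W cap (.loop q c) σ (s + 1 + t) σ₂
  | loopFalse {q : Cond} {c : Cmd} {σ : State} (hq : q.Ok W cap σ) (h : ¬ q.Holds σ) :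
      Exec W cap (.loop q c) σ 1 σ

/-! ### Translation of the structured language to the word RAM -/

/-- The register that holds the common capacity of the arrays. The registers behind it are used for
intermediate results. -/
def capReg : ℕ := 32

/-- Code that puts the value of an expression into register `d`; it uses only the registers from
`d` on. -/
def Expr.code : ℕ → Expr → List Instr
  | d, lit k => [.const d k]
  | d, var x => [.move d x.idx]
  | d, add a b => a.code d ++ (b.code (d + 1) ++ [.binop .add d d (d + 1)])
  | d, sub a b => a.code d ++ (b.code (d + 1) ++ [.binop .sub d d (d + 1)])
  | d, get k e => e.code d ++ [.const (d + 1) k.idx, .binop .mul (d + 1) (d + 1) capReg,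
      .binop .add d d (d + 1), .load d d]

/-- Code that jumps to `l` if the condition holds. -/
def Cond.code (l : ℕ) : Cond → List Instr
  | eq a b => a.code 33 ++ (b.code 34 ++ [.jumpEq 33 34 l])
  | lt a b => a.code 33 ++ (b.code 34 ++ [.jumpLt 33 34 l])

/-- The length of the code of a command. -/
def Cmd.len : Cmd → ℕ
  | skip => 0
  | set _ e => (e.code 33).length + 1
  | put k i e => (e.code 33).length + ((Expr.get k i).code 34).length
  | seq c d => c.len + d.len
  | ite q c d => (q.code 0).length + (d.len + (1 + c.len))
  | loop q c => (q.code 0).length + (1 + (c.len + 1))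

/-- The code of a command, when it is placed at position `l` of the program. -/
def Cmd.code : ℕ → Cmd → List Instr
  | _, skip => []
  | _, set x e => e.code 33 ++ [.move x.idx 33]
  | _, put k i e => e.code 33 ++ (i.code 34 ++ [.const 35 k.idx, .binop .mul 35 35 capReg,
      .binop .add 34 34 35, .store 34 33])
  | l, seq c d => c.code l ++ d.code (l + c.len)
  | l, ite q c d =>
      let m := l + (q.code 0).length
      q.code (m + d.len + 1) ++ (d.code m ++ (.jump (m + d.len + 1 + c.len) ::
        c.code (m + d.len + 1)))
  | l, loop q c =>
      let m := l + (q.code 0).length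
      q.code (m + 1) ++ (.jump (m + 1 + c.len + 1) :: (c.code (m + 1) ++ [.jump l]))

theorem Cond.length_code (q : Cond) (l : ℕ) : (q.code l).length = (q.code 0).length := by
  cases q <;> simp [Cond.code]

theorem Cmd.length_code (c : Cmd) (l : ℕ) : (c.code l).length = c.len := by
  induction c generalizing l with
  | skip => rfl
  | set x e => simp [Cmd.code, Cmd.len]
  | put k i e => simp [Cmd.code, Cmd.len, Expr.code]
  | seq c d hc hd => simp [Cmd.code, Cmd.len, hc, hd]
  | ite q c d hc hd => simp [Cmd.code, Cmd.len, hc, hd, q.length_code (_ + _)]; omega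
  | loop q c hc => simp [Cmd.code, Cmd.len, hc, q.length_code (_ + _)]; omega

/-- The instructions of `code` stand in the program from position `l` on. -/
def CodeAt (prog : Program) (l : ℕ) (code : List Instr) : Prop :=
  ∀ i, i < code.length → prog[l + i]? = code[i]?

theorem CodeAt.left {prog : Program} {l : ℕ} {c d : List Instr} (h : CodeAt prog l (c ++ d)) :
    CodeAt prog l c := by
  intro i hi
  rw [h i (by simp; omega), List.getElem?_append_left hi]

theorem CodeAt.right {prog : Program} {l : ℕ} {c d : List Instr} (h : CodeAt prog l (c ++ d)) :
    CodeAt prog (l + c.length) d := by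
  intro i hi
  have := h (c.length + i) (by simp; omega)
  rw [← Nat.add_assoc, List.getElem?_append_right (by omega)] at this
  simpa using this

theorem CodeAt.head {prog : Program} {l : ℕ} {c : Instr} {d : List Instr}
    (h : CodeAt prog l (c :: d)) : prog[l]? = some c := by
  simpa using h 0 (by simp)

theorem CodeAt.tail {prog : Program} {l : ℕ} {c : Instr} {d : List Instr}
    (h : CodeAt prog l (c :: d)) : CodeAt prog (l + 1) d := by
  intro i hi
  have := h (i + 1) (by simp; omega)
  rw [show l + 1 + i = l + (i + 1) by omega, this]
  simp

theorem run_add {prog : Program} {w s : ℕ} {c c' : Config} {t t' : ℕ}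
    (h : run prog w s t c = some c') : run prog w s (t + t') c = run prog w s t' c' := by
  induction t generalizing c with
  | zero => simp [run] at h; simp [h]
  | succ t ih =>
    rw [show t + 1 + t' = (t + t') + 1 by omega, run]
    rw [run] at h
    cases hs : step prog w s c with
    | none => simp [hs] at h
    | some c₁ => simp only [hs, Option.bind_some] at h ⊢; exact ih h

theorem run_trans {prog : Program} {w s : ℕ} {c c₁ c₂ : Config} {t t' : ℕ}
    (h : run prog w s t c = some c₁) (h' : run prog w s t' c₁ = some c₂) :
    run prog w s (t + t') c = some c₂ := by rw [run_add h, h']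

/-- The registers and the memory `reg`, `mem` represent the state `σ`, all of whose values fit into
words. -/
structure Represents (W cap : ℕ) (σ : State) (reg mem : ℕ → ℕ) : Prop where
  var : ∀ x : Var, reg x.idx = σ.v x
  arr : ∀ (k : Arr) (i : ℕ), i < cap → mem (k.idx * cap + i) = σ.a k i
  cap_eq : reg capReg = cap
  var_lt : ∀ x : Var, σ.v x < W
  arr_lt : ∀ (k : Arr) (i : ℕ), i < cap → σ.a k i < W

theorem Represents.congr {W cap : ℕ} {σ : State} {reg reg' mem : ℕ → ℕ}
    (h : Represents W cap σ reg mem)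
    (hr : ∀ r, r < 33 → reg' r = reg r) : Represents W cap σ reg' mem where
  var x := by rw [hr _ (by have := x.idx_lt; omega), h.var]
  arr := h.arr
  cap_eq := by rw [hr _ (by simp [capReg]), h.cap_eq]
  var_lt := h.var_lt
  arr_lt := h.arr_lt

theorem addr_lt {cap s : ℕ} (hs : 17 * cap ≤ s) (k : Arr) {i : ℕ} (hi : i < cap) :
    k.idx * cap + i < s := by
  have := k.idx_lt
  have : (k.idx + 1) * cap ≤ 17 * cap := Nat.mul_le_mul_right _ (by omega)
  rw [Nat.succ_mul] at this
  omega

theorem Expr.eval_lt {W cap : ℕ} {σ : State} {reg mem : ℕ → ℕ} (h : Represents W cap σ reg mem) :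
    ∀ e : Expr, e.Ok W cap σ → e.eval σ < W
  | lit _, hk => hk
  | var x, _ => h.var_lt x
  | add _ _, hk => hk.2.2
  | sub a _, hk => lt_of_le_of_lt (Nat.sub_le _ _) (a.eval_lt h hk.1)
  | get k _, hk => h.arr_lt k _ hk.2

/-- The code of an expression puts its value into register `d` and spares the registers before `d`.
-/
theorem Expr.run_code {prog : Program} {w s cap : ℕ} (hs : 17 * cap ≤ s) (hw : s ≤ 2 ^ w)
    {σ : State} (e : Expr) : ∀ (d : ℕ) (c : Config), 33 ≤ d → Represents (2 ^ w) cap σ c.reg c.mem →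
      CodeAt prog c.pc (e.code d) → e.Ok (2 ^ w) cap σ →
      ∃ reg, run prog w s (e.code d).length c = some ⟨c.pc + (e.code d).length, reg, c.mem⟩ ∧
        reg d = e.eval σ ∧ ∀ r, r < d → reg r = c.reg r := by
  induction e with
  | lit k =>
    intro d c hd hR hC hk
    refine ⟨Function.update c.reg d (k % 2 ^ w), ?_, ?_, ?_⟩
    · simp [Expr.code, run, step, hC.head]
    · simpa using Nat.mod_eq_of_lt hk
    · intro r hr; simp [hr.ne]
  | var x =>
    intro d c hd hR hC _
    refine ⟨Function.update c.reg d (c.reg x.idx), ?_, ?_, ?_⟩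
    · simp [Expr.code, run, step, hC.head]
    · simpa using hR.var x
    · intro r hr; simp [hr.ne]
  | add a b iha ihb =>
    intro d c hd hR hC hk
    obtain ⟨r₁, h₁, e₁, f₁⟩ := iha d c hd hR hC.left hk.1
    obtain ⟨r₂, h₂, e₂, f₂⟩ := ihb (d + 1) ⟨_, r₁, c.mem⟩ (by omega)
      (hR.congr fun r hr => f₁ r (by omega)) hC.right.left hk.2.1
    refine ⟨Function.update r₂ d (a.eval σ + b.eval σ), ?_, by simp [Expr.eval], ?_⟩
    · have h₃ := hC.right.right.head
      simp only [Expr.code, List.length_append, ← Nat.add_assoc] at *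
      refine run_trans (run_trans h₁ h₂) ?_
      simp [run, step, h₃, BinOp.eval, e₂, f₂ d (by omega), e₁, Nat.mod_eq_of_lt hk.2.2]
    · intro r hr; simp [hr.ne, f₂ r (by omega), f₁ r hr]
  | sub a b iha ihb =>
    intro d c hd hR hC hk
    obtain ⟨r₁, h₁, e₁, f₁⟩ := iha d c hd hR hC.left hk.1
    obtain ⟨r₂, h₂, e₂, f₂⟩ := ihb (d + 1) ⟨_, r₁, c.mem⟩ (by omega)
      (hR.congr fun r hr => f₁ r (by omega)) hC.right.left hk.2.1
    have hlt := a.eval_lt hR hk.1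
    have hle := hk.2.2
    refine ⟨Function.update r₂ d (a.eval σ - b.eval σ), ?_, by simp [Expr.eval], ?_⟩
    · have h₃ := hC.right.right.head
      have h₄ : (a.eval σ + (2 ^ w - b.eval σ)) % 2 ^ w = a.eval σ - b.eval σ := by
        rw [show a.eval σ + (2 ^ w - b.eval σ) = (a.eval σ - b.eval σ) + 2 ^ w by omega,
          Nat.add_mod_right, Nat.mod_eq_of_lt (by omega)]
      simp only [Expr.code, List.length_append, ← Nat.add_assoc] at *
      refine run_trans (run_trans h₁ h₂) ?_
      simp [run, step, h₃, BinOp.eval, e₂, f₂ d (by omega), e₁, h₄]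
    · intro r hr; simp [hr.ne, f₂ r (by omega), f₁ r hr]
  | get k e ih =>
    intro d c hd hR hC hk
    obtain ⟨r₁, h₁, e₁, f₁⟩ := ih d c hd hR hC.left hk.1
    have hlt := addr_lt hs k hk.2
    refine ⟨Function.update (Function.update r₁ (d + 1) (k.idx * cap)) d (σ.a k (e.eval σ)), ?_, ?_,
      ?_⟩
    · have hc := hC.right
      have i₁ := hc.head
      have i₂ := hc.tail.head
      have i₃ := hc.tail.tail.head
      have i₄ := hc.tail.tail.tail.head
      have hcap : r₁ capReg = cap := by rw [f₁ _ (by simp [capReg]; omega), hR.cap_eq]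
      have hne : capReg ≠ d + 1 := by simp [capReg]; omega
      have hk1 : k.idx % 2 ^ w = k.idx := by
        rcases Nat.eq_zero_or_pos cap with h0 | h0
        · have := hk.2; omega
        · have := k.idx_lt; exact Nat.mod_eq_of_lt (by nlinarith)
      have hk2 : k.idx * cap % 2 ^ w = k.idx * cap := Nat.mod_eq_of_lt (by omega)
      have hk3 : (e.eval σ + k.idx * cap) % 2 ^ w = e.eval σ + k.idx * cap :=
        Nat.mod_eq_of_lt (by omega)
      rw [show (Expr.code d (get k e)).length = (e.code d).length + 4 by simp [Expr.code]]
      refine run_trans h₁ ?_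
      simp [run, step, i₁, i₂, i₃, i₄, BinOp.eval, hcap, hk1, hk2, hk3, e₁, hne]
      refine ⟨by omega, by omega, ?_⟩
      rw [Nat.add_comm (e.eval σ), hR.arr k _ hk.2]
    · simp [Expr.eval]
    · intro r hr
      simp [hr.ne, show r ≠ d + 1 by omega, f₁ r hr]

/-- The code of a test jumps to `l` if the test holds, and falls through otherwise. -/
theorem Cond.run_code {prog : Program} {w s cap : ℕ} (hs : 17 * cap ≤ s) (hw : s ≤ 2 ^ w)
    {σ : State} (q : Cond) (l : ℕ) (c : Config) (hR : Represents (2 ^ w) cap σ c.reg c.mem)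
    (hC : CodeAt prog c.pc (q.code l)) (hk : q.Ok (2 ^ w) cap σ) :
      ∃ c', run prog w s (q.code 0).length c = some c' ∧
        Represents (2 ^ w) cap σ c'.reg c'.mem ∧ (q.Holds σ → c'.pc = l) ∧
        (¬ q.Holds σ → c'.pc = c.pc + (q.code 0).length) := by
  rw [← q.length_code l]
  cases q with
  | eq a b =>
    obtain ⟨r₁, h₁, e₁, f₁⟩ := a.run_code hs hw 33 c le_rfl hR hC.left hk.1
    obtain ⟨r₂, h₂, e₂, f₂⟩ := b.run_code hs hw 34 ⟨_, r₁, c.mem⟩ (by omega)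
      (hR.congr fun r hr => f₁ r hr) hC.right.left hk.2
    have h₃ := hC.right.right.head
    refine ⟨⟨if a.eval σ = b.eval σ then l else _, r₂, c.mem⟩, ?_,
      hR.congr fun r hr => (f₂ r (by omega)).trans (f₁ r hr), fun h => if_pos h, fun h => if_neg h⟩
    simp only [Cond.code, List.length_append, ← Nat.add_assoc] at *
    refine run_trans (run_trans h₁ h₂) ?_
    simp [run, step, h₃, e₂, f₂ 33 (by omega), e₁]
  | lt a b =>
    obtain ⟨r₁, h₁, e₁, f₁⟩ := a.run_code hs hw 33 c le_rfl hR hC.left hk.1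
    obtain ⟨r₂, h₂, e₂, f₂⟩ := b.run_code hs hw 34 ⟨_, r₁, c.mem⟩ (by omega)
      (hR.congr fun r hr => f₁ r hr) hC.right.left hk.2
    have h₃ := hC.right.right.head
    refine ⟨⟨if a.eval σ < b.eval σ then l else _, r₂, c.mem⟩, ?_,
      hR.congr fun r hr => (f₂ r (by omega)).trans (f₁ r hr), fun h => if_pos h, fun h => if_neg h⟩
    simp only [Cond.code, List.length_append, ← Nat.add_assoc] at *
    refine run_trans (run_trans h₁ h₂) ?_
    simp [run, step, h₃, e₂, f₂ 33 (by omega), e₁]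

theorem Represents.setV {W cap : ℕ} {σ : State} {reg reg' mem : ℕ → ℕ}
    (h : Represents W cap σ reg mem)
    (hr : ∀ r, r < 33 → reg' r = reg r) (x : Var) {e : ℕ} (he : e < W) :
    Represents W cap (σ.setV x e) (Function.update reg' x.idx e) mem where
  var y := by
    by_cases hxy : y = x
    · simp [hxy]
    · have : y.idx ≠ x.idx := fun h => hxy (Var.idx_injective h)
      simp [hxy, this, (h.congr hr).var]
  arr := h.arr
  cap_eq := by
    have := x.idx_lt
    rw [Function.update_of_ne (by simp [capReg]; omega), (h.congr hr).cap_eq]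
  var_lt y := by
    by_cases hxy : y = x
    · simpa [hxy] using he
    · simpa [hxy] using h.var_lt y
  arr_lt := h.arr_lt

theorem Represents.setA {W cap : ℕ} {σ : State} {reg reg' mem : ℕ → ℕ}
    (h : Represents W cap σ reg mem)
    (hr : ∀ r, r < 33 → reg' r = reg r) (k : Arr) {i e : ℕ} (hi : i < cap) (he : e < W) :
    Represents W cap (σ.setA k i e) reg' (Function.update mem (k.idx * cap + i) e) where
  var := (h.congr hr).var
  arr l j hj := by
    have : l.idx * cap + j = k.idx * cap + i ↔ l = k ∧ j = i := by
      constructor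
      · intro h
        have h1 : l.idx = k.idx := by
          have h2 : (l.idx * cap + j) / cap = (k.idx * cap + i) / cap := by rw [h]
          rwa [Nat.mul_comm, Nat.mul_add_div (by omega), Nat.div_eq_of_lt hj, Nat.mul_comm,
            Nat.mul_add_div (by omega), Nat.div_eq_of_lt hi] at h2
        rw [h1] at h
        exact ⟨Arr.idx_injective h1, by omega⟩
      · rintro ⟨rfl, rfl⟩; rfl
    simp only [Function.update_apply, this, State.setA_a, h.arr l j hj]
  cap_eq := (h.congr hr).cap_eq
  var_lt := h.var_lt
  arr_lt l j hj := by
    rw [State.setA_a]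
    split_ifs
    · exact he
    · exact h.arr_lt l j hj

/-- The code of a command does what the command does, and the number of machine steps is at most
the number of executed assignments and tests times the length of the code. -/
theorem Exec.run_code {prog : Program} {w s cap : ℕ} (hs : 17 * cap ≤ s) (hw : s ≤ 2 ^ w)
    {cmd : Cmd} {σ σ' : State} {t : ℕ} (h : Exec (2 ^ w) cap cmd σ t σ') :
    ∀ c : Config, Represents (2 ^ w) cap σ c.reg c.mem → CodeAt prog c.pc (cmd.code c.pc) →
      ∃ t' c', t' ≤ cmd.len * t ∧ run prog w s t' c = some c' ∧ c'.pc = c.pc + cmd.len ∧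
        Represents (2 ^ w) cap σ' c'.reg c'.mem := by
  induction h with
  | skip σ => exact fun c hR _ => ⟨0, c, by simp, rfl, rfl, hR⟩
  | @set σ x e he =>
    intro c hR hC
    obtain ⟨r₁, h₁, e₁, f₁⟩ := e.run_code hs hw 33 c le_rfl hR hC.left he
    have h₂ := hC.right.head
    refine ⟨_, ⟨_, Function.update r₁ x.idx (e.eval σ), c.mem⟩, ?_, run_trans h₁ (t' := 1) ?_, rfl,
      hR.setV f₁ x (e.eval_lt hR he)⟩
    · simp [Cmd.len]
    · simp [run, step, h₂, e₁, Cmd.len, Nat.add_assoc]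
  | @put σ k i e hi he hc =>
    intro c hR hC
    obtain ⟨r₁, h₁, e₁, f₁⟩ := e.run_code hs hw 33 c le_rfl hR hC.left he
    obtain ⟨r₂, h₂, e₂, f₂⟩ := i.run_code hs hw 34 ⟨_, r₁, c.mem⟩ (by omega)
      (hR.congr fun r hr => f₁ r hr) hC.right.left hi
    have hlt := addr_lt hs k hc
    refine ⟨_, ⟨_, ?_, Function.update c.mem (k.idx * cap + i.eval σ) (e.eval σ)⟩, ?_,
      run_trans (run_trans h₁ h₂) (t' := 4) ?_, rfl, hR.setA ?_ k hc (e.eval_lt hR he)⟩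
    · exact Function.update (Function.update r₂ 35 (k.idx * cap)) 34 (i.eval σ + k.idx * cap)
    · simp [Cmd.len, Expr.code, Nat.add_assoc]
    · have hc' := hC.right.right
      have i₁ := hc'.head
      have i₂ := hc'.tail.head
      have i₃ := hc'.tail.tail.head
      have i₄ := hc'.tail.tail.tail.head
      have hcap : r₂ 32 = cap := by
        rw [f₂ 32 (by omega)]; exact (f₁ 32 (by omega)).trans hR.cap_eq
      have he₁ : r₂ 33 = e.eval σ := by rw [f₂ 33 (by omega)]; exact e₁
      have hk1 : k.idx % 2 ^ w = k.idx := by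
        have := k.idx_lt; exact Nat.mod_eq_of_lt (by nlinarith)
      have hk2 : k.idx * cap % 2 ^ w = k.idx * cap := Nat.mod_eq_of_lt (by omega)
      have hk3 : (i.eval σ + k.idx * cap) % 2 ^ w = i.eval σ + k.idx * cap :=
        Nat.mod_eq_of_lt (by omega)
      simp [run, step, i₁, i₂, i₃, i₄, BinOp.eval, hcap, hk1, hk2, hk3, e₂, he₁,
        capReg]
      exact ⟨by omega, by simp [Cmd.len, Expr.code]; omega, by rw [Nat.add_comm]⟩
    · intro r hr
      simp [show r ≠ 34 by omega, show r ≠ 35 by omega,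
        f₂ r (by omega), f₁ r hr]
  | @seq c d σ σ₁ σ₂ s t _ _ ihc ihd =>
    intro c₀ hR hC
    obtain ⟨t₁, c₁, ht₁, r₁, p₁, R₁⟩ := ihc c₀ hR hC.left
    have hC' := hC.right
    rw [Cmd.length_code, ← p₁] at hC'
    obtain ⟨t₂, c₂, ht₂, r₂, p₂, R₂⟩ := ihd c₁ R₁ hC'
    refine ⟨_, c₂, ?_, run_trans r₁ r₂, by rw [p₂, p₁, Cmd.len, Nat.add_assoc], R₂⟩
    simp only [Cmd.len]
    nlinarith [Nat.zero_le (c.len * t), Nat.zero_le (d.len * s)]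
  | @iteTrue q c d σ σ₁ t hq h _ ih =>
    intro c₀ hR hC
    obtain ⟨c₁, r₁, R₁, p₁, -⟩ := q.run_code hs hw _ c₀ hR hC.left hq
    have hC' := hC.right.right.tail
    rw [Cmd.length_code, Cond.length_code, ← p₁ h] at hC'
    obtain ⟨t₂, c₂, ht₂, r₂, p₂, R₂⟩ := ih c₁ R₁ hC'
    refine ⟨_, c₂, ?_, run_trans r₁ r₂, by rw [p₂, p₁ h, Cmd.len]; omega, R₂⟩
    simp only [Cmd.len]
    nlinarith [Nat.zero_le ((q.code 0).length * t), Nat.zero_le (d.len * t)]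
  | @iteFalse q c d σ σ₁ t hq h _ ih =>
    intro c₀ hR hC
    obtain ⟨c₁, r₁, R₁, -, p₁⟩ := q.run_code hs hw _ c₀ hR hC.left hq
    have hC' := hC.right
    rw [Cond.length_code, ← p₁ h] at hC'
    obtain ⟨t₂, c₂, ht₂, r₂, p₂, R₂⟩ := ih c₁ R₁ hC'.left
    have hj := hC'.right.head
    rw [Cmd.length_code, ← p₂] at hj
    refine ⟨_, ⟨_, c₂.reg, c₂.mem⟩, ?_, run_trans (run_trans r₁ r₂) (t' := 1) ?_, rfl, R₂⟩
    · simp only [Cmd.len]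
      nlinarith [Nat.zero_le ((q.code 0).length * t), Nat.zero_le (c.len * t)]
    · simp [run, step, hj, Cmd.len]; have := p₁ h; omega
  | @loopTrue q c σ σ₁ σ₂ s' t hq h _ _ ihc ihl =>
    intro c₀ hR hC
    obtain ⟨c₁, r₁, R₁, p₁, -⟩ := q.run_code hs hw _ c₀ hR hC.left hq
    have hC' := hC.right.tail
    rw [Cond.length_code, ← p₁ h] at hC'
    obtain ⟨t₂, c₂, ht₂, r₂, p₂, R₂⟩ := ihc c₁ R₁ hC'.left
    have hj := hC'.right.head
    rw [Cmd.length_code, ← p₂] at hj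
    obtain ⟨t₃, c₃, ht₃, r₃, p₃, R₃⟩ := ihl ⟨c₀.pc, c₂.reg, c₂.mem⟩ R₂ hC
    refine ⟨_, c₃, ?_, run_trans (run_trans (run_trans r₁ r₂) (t' := 1)
      (c₂ := ⟨c₀.pc, c₂.reg, c₂.mem⟩) ?_) r₃, p₃, R₃⟩
    · simp only [Cmd.len] at ht₃ ⊢
      nlinarith [Nat.zero_le ((q.code 0).length * s')]
    · simp [run, step, hj]
  | @loopFalse q c σ hq h =>
    intro c₀ hR hC
    obtain ⟨c₁, r₁, R₁, -, p₁⟩ := q.run_code hs hw _ c₀ hR hC.left hq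
    have hj := hC.right.head
    rw [Cond.length_code, ← p₁ h] at hj
    refine ⟨_, ⟨_, c₁.reg, c₁.mem⟩, ?_, run_trans r₁ (t' := 1) ?_, rfl, R₁⟩
    · simp only [Cmd.len]; omega
    · simp [run, step, hj, Cmd.len]; have := p₁ h; omega

/-! ### Reasoning about structured programs -/

/-- From `σ` the command `c` reaches, within `T` assignments and tests, a state with property
`Q`. -/
def Within (W cap : ℕ) (c : Cmd) (T : ℕ) (Q : State → Prop) (σ : State) : Prop :=
  ∃ t σ', t ≤ T ∧ Exec W cap c σ t σ' ∧ Q σ'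

/-- The variables that a command assigns to. -/
def Cmd.vars : Cmd → List Var
  | skip => []
  | set x _ => [x]
  | put _ _ _ => []
  | seq c d => c.vars ++ d.vars
  | ite _ c d => c.vars ++ d.vars
  | loop _ c => c.vars

/-- The arrays that a command writes to. -/
def Cmd.arrs : Cmd → List Arr
  | skip => []
  | set _ _ => []
  | put k _ _ => [k]
  | seq c d => c.arrs ++ d.arrs
  | ite _ c d => c.arrs ++ d.arrs
  | loop _ c => c.arrs

/-- The states agree but for what `c` may change. -/
def Agree (c : Cmd) (σ σ' : State) : Prop :=
  (∀ x, x ∉ c.vars → σ'.v x = σ.v x) ∧ ∀ k, k ∉ c.arrs → σ'.a k = σ.a k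

theorem Agree.refl (c : Cmd) (σ : State) : Agree c σ σ := ⟨fun _ _ => rfl, fun _ _ => rfl⟩

theorem Agree.trans {c : Cmd} {σ σ₁ σ₂ : State} (h : Agree c σ σ₁) (h' : Agree c σ₁ σ₂) :
    Agree c σ σ₂ :=
  ⟨fun x hx => (h'.1 x hx).trans (h.1 x hx), fun k hk => (h'.2 k hk).trans (h.2 k hk)⟩

theorem Agree.mono {c d : Cmd} {σ σ' : State} (h : Agree c σ σ') (hv : c.vars ⊆ d.vars)
    (ha : c.arrs ⊆ d.arrs) : Agree d σ σ' :=
  ⟨fun x hx => h.1 x fun h' => hx (hv h'), fun k hk => h.2 k fun h' => hk (ha h')⟩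

theorem Exec.agree {W cap : ℕ} {c : Cmd} {σ σ' : State} {t : ℕ} (h : Exec W cap c σ t σ') :
    Agree c σ σ' := by
  induction h with
  | skip σ => exact .refl _ _
  | set h => exact ⟨fun y hy => by simp_all [Cmd.vars], fun _ _ => rfl⟩
  | @put σ k i e hi he hc =>
    refine ⟨fun _ _ => rfl, fun l hl => ?_⟩
    have : l ≠ k := by simpa [Cmd.arrs] using hl
    simp [State.setA, this]
  | seq _ _ ih₁ ih₂ =>
    exact (ih₁.mono (by simp [Cmd.vars]) (by simp [Cmd.arrs])).trans
      (ih₂.mono (by simp [Cmd.vars]) (by simp [Cmd.arrs]))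
  | iteTrue _ _ _ ih => exact ih.mono (by simp [Cmd.vars]) (by simp [Cmd.arrs])
  | iteFalse _ _ _ ih => exact ih.mono (by simp [Cmd.vars]) (by simp [Cmd.arrs])
  | loopTrue _ _ _ _ ih₁ ih₂ => exact (ih₁.mono (by simp [Cmd.vars]) (by simp [Cmd.arrs])).trans ih₂
  | loopFalse _ _ => exact .refl _ _

section
variable {W cap : ℕ}

theorem Within.frame {c : Cmd} {T : ℕ} {Q : State → Prop} {σ : State} (h : Within W cap c T Q σ) :
    Within W cap c T (fun σ' => Q σ' ∧ Agree c σ σ') σ := by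
  obtain ⟨t, σ', ht, he, hQ⟩ := h
  exact ⟨t, σ', ht, he, hQ, he.agree⟩

/-- Consequence rule; the new postcondition may use that `c` has left alone what it does not write
to. -/
theorem Within.mono {c : Cmd} {T T' : ℕ} {Q Q' : State → Prop} {σ : State}
    (h : Within W cap c T Q σ) (hT : T ≤ T') (hQ : ∀ σ', Agree c σ σ' → Q σ' → Q' σ') :
    Within W cap c T' Q' σ := by
  obtain ⟨t, σ', ht, he, h⟩ := h
  exact ⟨t, σ', ht.trans hT, he, hQ _ he.agree h⟩

theorem Within.le_time {c : Cmd} {T T' : ℕ} {Q : State → Prop} {σ : State}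
    (h : Within W cap c T Q σ) (hT : T ≤ T') : Within W cap c T' Q σ := h.mono hT fun _ _ h => h

theorem Within.seq {c d : Cmd} {T T' : ℕ} {Q Q' : State → Prop} {σ : State}
    (h : Within W cap c T Q σ) (h' : ∀ σ', Agree c σ σ' → Q σ' → Within W cap d T' Q' σ') :
    Within W cap (c ;; d) (T + T') Q' σ := by
  obtain ⟨t, σ', ht, he, hQ⟩ := h
  obtain ⟨t', σ'', ht', he', hQ'⟩ := h' σ' he.agree hQ
  exact ⟨t + t', σ'', by omega, he.seq he', hQ'⟩

theorem Within.iteTrue {q : Cond} {c d : Cmd} {T : ℕ} {Q : State → Prop} {σ : State}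
    (hq : q.Ok W cap σ) (h : q.Holds σ) (h' : Within W cap c T Q σ) :
    Within W cap (.ite q c d) (T + 1) Q σ := by
  obtain ⟨t, σ', ht, he, hQ⟩ := h'
  exact ⟨t + 1, σ', by omega, he.iteTrue hq h, hQ⟩

theorem Within.iteFalse {q : Cond} {c d : Cmd} {T : ℕ} {Q : State → Prop} {σ : State}
    (hq : q.Ok W cap σ) (h : ¬ q.Holds σ) (h' : Within W cap d T Q σ) :
    Within W cap (.ite q c d) (T + 1) Q σ := by
  obtain ⟨t, σ', ht, he, hQ⟩ := h'
  exact ⟨t + 1, σ', by omega, he.iteFalse hq h, hQ⟩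

/-- The weakest precondition of a loop-free command. -/
def Cmd.wp (W cap : ℕ) : Cmd → (State → Prop) → State → Prop
  | skip, Q, σ => Q σ
  | set x e, Q, σ => e.Ok W cap σ ∧ Q (σ.setV x (e.eval σ))
  | put k i e, Q, σ => (i.Ok W cap σ ∧ e.Ok W cap σ ∧ i.eval σ < cap) ∧
      Q (σ.setA k (i.eval σ) (e.eval σ))
  | seq c d, Q, σ => c.wp W cap (d.wp W cap Q) σ
  | ite q c d, Q, σ => q.Ok W cap σ ∧ (q.Holds σ → c.wp W cap Q σ) ∧ (¬ q.Holds σ → d.wp W cap Q σ)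
  | loop _ _, _, _ => False

/-- The number of assignments and tests in a command, which bounds the time of a loop-free one. -/
def Cmd.cost : Cmd → ℕ
  | skip => 0
  | set _ _ => 1
  | put _ _ _ => 1
  | seq c d => c.cost + d.cost
  | ite _ c d => c.cost + d.cost + 1
  | loop _ c => c.cost

/-- For a loop-free command, the weakest precondition is sufficient. -/
theorem Cmd.within_of_wp {c : Cmd} {Q : State → Prop} {σ : State} (h : c.wp W cap Q σ) :
    Within W cap c c.cost Q σ := by
  induction c generalizing Q σ with
  | skip => exact ⟨0, σ, le_rfl, .skip σ, h⟩
  | set x e => exact ⟨1, _, le_rfl, .set h.1, h.2⟩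
  | put k i e => exact ⟨1, _, le_rfl, .put h.1.1 h.1.2.1 h.1.2.2, h.2⟩
  | seq c d ihc ihd => exact (ihc h).seq fun _ _ h' => ihd h'
  | ite q c d ihc ihd =>
    by_cases hq : q.Holds σ
    · exact ((ihc (h.2.1 hq)).iteTrue h.1 hq).mono (by simp [Cmd.cost]) fun _ _ h => h
    · exact ((ihd (h.2.2 hq)).iteFalse h.1 hq).mono (by simp [Cmd.cost]) fun _ _ h => h
  | loop q c _ => exact h.elim

theorem Within.set_seq {x : Var} {e : Expr} {d : Cmd} {T : ℕ} {Q : State → Prop} {σ : State}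
    (he : e.Ok W cap σ) (h : Within W cap d T Q (σ.setV x (e.eval σ))) :
    Within W cap (.set x e ;; d) (T + 1) Q σ := by
  obtain ⟨t, σ', ht, hx, hQ⟩ := h
  exact ⟨1 + t, σ', by omega, (Exec.set he).seq hx, hQ⟩

theorem Within.put_seq {k : Arr} {i e : Expr} {d : Cmd} {T : ℕ} {Q : State → Prop} {σ : State}
    (hi : i.Ok W cap σ) (he : e.Ok W cap σ) (hc : i.eval σ < cap)
    (h : Within W cap d T Q (σ.setA k (i.eval σ) (e.eval σ))) :
    Within W cap (.put k i e ;; d) (T + 1) Q σ := by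
  obtain ⟨t, σ', ht, hx, hQ⟩ := h
  exact ⟨1 + t, σ', by omega, (Exec.put hi he hc).seq hx, hQ⟩

/-- A loop with an invariant that counts the remaining rounds. -/
theorem Within.loop {q : Cond} {c : Cmd} {K : ℕ} (Inv : ℕ → State → Prop) {σ : State} {m : ℕ}
    (h0 : ∀ σ', Agree c σ σ' → Inv 0 σ' → q.Ok W cap σ' ∧ ¬ q.Holds σ')
    (hs : ∀ m σ', Agree c σ σ' → Inv (m + 1) σ' →
      q.Ok W cap σ' ∧ q.Holds σ' ∧ Within W cap c K (Inv m) σ')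
    (h : Inv m σ) : Within W cap (.loop q c) (m * (K + 1) + 1) (Inv 0) σ := by
  suffices H : ∀ m σ', Agree c σ σ' → Inv m σ' →
      Within W cap (.loop q c) (m * (K + 1) + 1) (Inv 0) σ' from H m σ (.refl _ _) h
  intro m
  induction m with
  | zero =>
    intro σ' ha hi
    exact ⟨1, σ', by omega, .loopFalse (h0 σ' ha hi).1 (h0 σ' ha hi).2, hi⟩
  | succ m ih =>
    intro σ' ha hi
    obtain ⟨hok, hq, t, σ₁, ht, he, hi'⟩ := hs m σ' ha hi
    obtain ⟨t', σ₂, ht', he', hQ⟩ := ih σ₁ (ha.trans he.agree) hi'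
    refine ⟨_, σ₂, ?_, .loopTrue hok hq he he', hQ⟩
    rw [Nat.succ_mul]; omega

/-- A loop with a loop-free body. -/
theorem Within.loop_wp {q : Cond} {c : Cmd} (Inv : ℕ → State → Prop) {σ : State} {m : ℕ}
    (h0 : ∀ σ', Agree c σ σ' → Inv 0 σ' → q.Ok W cap σ' ∧ ¬ q.Holds σ')
    (hs : ∀ m σ', Agree c σ σ' → Inv (m + 1) σ' →
      q.Ok W cap σ' ∧ q.Holds σ' ∧ c.wp W cap (Inv m) σ')
    (h : Inv m σ) : Within W cap (.loop q c) (m * (c.cost + 1) + 1) (Inv 0) σ :=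
  Within.loop Inv h0 (fun m σ' ha hi =>
    ⟨(hs m σ' ha hi).1, (hs m σ' ha hi).2.1, Cmd.within_of_wp (hs m σ' ha hi).2.2⟩) h

/-- `Rounds q c σ T σ'`: some rounds of the loop with test `q` and body `c` lead from `σ` to `σ'`,
within `T` assignments and tests. -/
inductive Rounds (W cap : ℕ) (q : Cond) (c : Cmd) : State → ℕ → State → Prop
  | refl (σ : State) : Rounds W cap q c σ 0 σ
  | head {σ σ₁ σ₂ : State} {s t : ℕ} (hq : q.Ok W cap σ) (h : q.Holds σ)
      (hc : Exec W cap c σ s σ₁) (hr : Rounds W cap q c σ₁ t σ₂) :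
      Rounds W cap q c σ (s + 1 + t) σ₂

theorem Rounds.trans {q : Cond} {c : Cmd} {σ σ₁ σ₂ : State} {s t : ℕ}
    (h : Rounds W cap q c σ s σ₁) (h' : Rounds W cap q c σ₁ t σ₂) :
    Rounds W cap q c σ (s + t) σ₂ := by
  induction h with
  | refl σ => simpa using h'
  | head hq hh hc _ ih => rw [Nat.add_assoc]; exact .head hq hh hc (ih h')

theorem Rounds.agree {q : Cond} {c : Cmd} {σ σ' : State} {t : ℕ}
    (h : Rounds W cap q c σ t σ') : Agree c σ σ' := by
  induction h with
  | refl σ => exact .refl _ _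
  | head _ _ hc _ ih => exact hc.agree.trans ih

theorem Rounds.exec {q : Cond} {c : Cmd} {σ σ' : State} {t : ℕ}
    (h : Rounds W cap q c σ t σ') (hok : q.Ok W cap σ') (hq : ¬ q.Holds σ') :
    Exec W cap (.loop q c) σ (t + 1) σ' := by
  induction h with
  | refl σ => simpa using Exec.loopFalse hok hq
  | head hq' hh hc _ ih =>
    rw [Nat.add_assoc]; exact .loopTrue hq' hh hc (ih hok hq)

/-- `Reach q c T Q σ`: some rounds of the loop lead, within time `T`, to a state with property
`Q`. -/
def Reach (W cap : ℕ) (q : Cond) (c : Cmd) (T : ℕ) (Q : State → Prop) (σ : State) : Prop :=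
  ∃ t σ', t ≤ T ∧ Rounds W cap q c σ t σ' ∧ Q σ'

theorem Reach.trans {q : Cond} {c : Cmd} {T T' : ℕ} {Q Q' : State → Prop} {σ : State}
    (h : Reach W cap q c T Q σ) (h' : ∀ σ', Agree c σ σ' → Q σ' → Reach W cap q c T' Q' σ') :
    Reach W cap q c (T + T') Q' σ := by
  obtain ⟨t, σ', ht, he, hQ⟩ := h
  obtain ⟨t', σ'', ht', he', hQ'⟩ := h' σ' he.agree hQ
  exact ⟨t + t', σ'', by omega, he.trans he', hQ'⟩

theorem Reach.one {q : Cond} {c : Cmd} {T : ℕ} {Q : State → Prop} {σ : State}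
    (hok : q.Ok W cap σ) (hq : q.Holds σ) (h : Within W cap c T Q σ) :
    Reach W cap q c (T + 1) Q σ := by
  obtain ⟨t, σ', ht, he, hQ⟩ := h
  exact ⟨t + 1, σ', by omega, by simpa using Rounds.head hok hq he (.refl _), hQ⟩

theorem Reach.mono {q : Cond} {c : Cmd} {T T' : ℕ} {Q Q' : State → Prop} {σ : State}
    (h : Reach W cap q c T Q σ) (hT : T ≤ T') (hQ : ∀ σ', Agree c σ σ' → Q σ' → Q' σ') :
    Reach W cap q c T' Q' σ := by
  obtain ⟨t, σ', ht, he, h⟩ := h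
  exact ⟨t, σ', ht.trans hT, he, hQ _ he.agree h⟩

theorem Reach.within {q : Cond} {c : Cmd} {T : ℕ} {Q : State → Prop} {σ : State}
    (h : Reach W cap q c T Q σ) (hQ : ∀ σ', Agree c σ σ' → Q σ' → q.Ok W cap σ' ∧ ¬ q.Holds σ') :
    Within W cap (.loop q c) (T + 1) Q σ := by
  obtain ⟨t, σ', ht, he, h⟩ := h
  exact ⟨t + 1, σ', by omega, he.exec (hQ _ he.agree h).1 (hQ _ he.agree h).2, h⟩

end

/-! ### Inclusion of ordered forests -/

/-- The number of nodes of a forest. -/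
def fsize (F : List OTree) : ℕ := (preorderForest F).length

@[simp] theorem fsize_nil : fsize [] = 0 := by simp [fsize, preorderForest]

@[simp] theorem fsize_cons (t : OTree) (F : List OTree) : fsize (t :: F) = t.size + fsize F := by
  simp [fsize, preorderForest, OTree.size]

@[simp] theorem size_node (a : ℕ) (ts : List OTree) : (OTree.node a ts).size = fsize ts + 1 := by
  simp [fsize, preorder, OTree.size]

theorem preorderForest_append (F G : List OTree) :
    preorderForest (F ++ G) = preorderForest F ++ preorderForest G := by
  induction F with
  | nil => simp [preorderForest]
  | cons t F ih => simp [preorderForest, ih]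

@[simp] theorem fsize_append (F G : List OTree) : fsize (F ++ G) = fsize F + fsize G := by
  simp [fsize, preorderForest_append]

theorem size_pos (t : OTree) : 0 < t.size := by cases t; simp

/-- `Emb F G`: the forest `F` is included in the forest `G`. The first root of `G` is either deleted
or matched with the first root of `F`. -/
inductive Emb : List OTree → List OTree → Prop
  | nil : Emb [] []
  | skip (a : ℕ) {F ts G : List OTree} (h : Emb F (ts ++ G)) : Emb F (.node a ts :: G)
  | keep (a : ℕ) {fs F ts G : List OTree} (h : Emb fs ts) (h' : Emb F G) :
      Emb (.node a fs :: F) (.node a ts :: G)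

mutual
theorem Emb.refl_tree : ∀ t : OTree, Emb t.children t.children
  | .node _ ts => Emb.refl ts
theorem Emb.refl : ∀ F : List OTree, Emb F F
  | [] => .nil
  | .node a ts :: F => .keep a (Emb.refl_tree (.node a ts)) (Emb.refl F)
end

theorem Delete.append {F G : List OTree} (h : Delete F G) (R : List OTree) :
    Delete (F ++ R) (G ++ R) := by
  induction h with
  | here a ts rest => rw [List.append_assoc]; exact .here a ts _
  | inside a rest h _ => exact .inside a _ h
  | right t _ ih => exact .right t ih

theorem Delete.append_left {F G : List OTree} (h : Delete F G) (L : List OTree) :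
    Delete (L ++ F) (L ++ G) := by
  induction L with
  | nil => exact h
  | cons t L ih => exact .right t ih

/-- Inclusion in a forest that arises by one deletion is inclusion in the original forest. This is
the induction step that turns a sequence of deletions into a derivation of `Emb`. -/
theorem Emb.of_delete {F G' : List OTree} (h : Emb F G') : ∀ {G}, Delete G G' → Emb F G := by
  induction h with
  | nil =>
    intro G hG
    generalize hR : ([] : List OTree) = R at hG
    cases hG with
    | here a ts rest => exact .skip a (hR ▸ .nil)
    | inside => simp at hR
    | right => simp at hR
  | @skip a F ts R h ih =>
    intro G hG
    generalize hR : OTree.node a ts :: R = R' at hG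
    cases hG with
    | here b us rest => exact .skip b (hR ▸ .skip a h)
    | inside b rest hd =>
      simp only [List.cons.injEq, OTree.node.injEq] at hR
      obtain ⟨⟨rfl, rfl⟩, rfl⟩ := hR
      exact .skip _ (ih (hd.append _))
    | right t hd =>
      simp only [List.cons.injEq] at hR
      obtain ⟨rfl, rfl⟩ := hR
      exact .skip _ (ih (hd.append_left _))
  | @keep a fs F ts R h h' ih ih' =>
    intro G hG
    generalize hR : OTree.node a ts :: R = R' at hG
    cases hG with
    | here b us rest => exact .skip b (hR ▸ .keep a h h')
    | inside b rest hd =>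
      simp only [List.cons.injEq, OTree.node.injEq] at hR
      obtain ⟨⟨rfl, rfl⟩, rfl⟩ := hR
      exact .keep _ (ih hd) h'
    | right t hd =>
      simp only [List.cons.injEq] at hR
      obtain ⟨rfl, rfl⟩ := hR
      exact .keep _ h (ih' hd)

theorem Emb.of_deletes {F G : List OTree} (h : Relation.ReflTransGen Delete G F) : Emb F G := by
  induction h using Relation.ReflTransGen.head_induction_on with
  | refl => exact .refl F
  | head h _ ih => exact ih.of_delete h

theorem Emb.deletes {F G : List OTree} (h : Emb F G) : Relation.ReflTransGen Delete G F := by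
  induction h with
  | nil => exact .refl
  | skip a h ih => exact .head (.here a _ _) ih
  | @keep a fs F ts G _ _ ih ih' =>
    refine .trans (b := .node a ts :: F) ?_ ?_
    · exact ih'.lift (fun R => OTree.node a ts :: R) fun _ _ h => .right _ h
    · exact ih.lift (fun us => OTree.node a us :: F) fun _ _ h => .inside a F h

theorem included_iff_emb {P T : OTree} : Included P T ↔ Emb [P] [T] :=
  ⟨Emb.of_deletes, Emb.deletes⟩

/-! ### Inclusion in terms of preorder numbers -/

section
variable (lab E : ℕ → ℕ)

mutual
/-- The tree `t` is included in the subtree of `w`, with the root of `t` matched with `w`. -/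
def RootAt : OTree → ℕ → Prop
  | .node x fs, w => lab w = x ∧ Fits fs (w + 1) (E w)
/-- The forest is included in the forest that consists of the nodes with preorder numbers in
`[a, b)`. Nodes have the labels `lab`, and the descendants of `w` are the nodes in `[w, E w)`. -/
def Fits : List OTree → ℕ → ℕ → Prop
  | [], a, b => a ≤ b
  | t :: F, a, b => ∃ w, a ≤ w ∧ E w ≤ b ∧ RootAt t w ∧ Fits F (E w) b
end

variable {lab E}

theorem fits_mono {F : List OTree} : ∀ {a b a' b' : ℕ}, Fits lab E F a b → a' ≤ a → b ≤ b' →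
    Fits lab E F a' b' := by
  induction F with
  | nil => intro a b a' b' h ha hb; simp only [Fits] at *; omega
  | cons t F ih =>
    rintro a b a' b' ⟨w, h₁, h₂, h₃, h₄⟩ ha hb
    exact ⟨w, by omega, by omega, h₃, ih h₄ le_rfl hb⟩

mutual
theorem RootAt.size_le (hE : ∀ w, w < E w) : ∀ (t : OTree) {w : ℕ}, RootAt lab E t w →
    w + t.size ≤ E w
  | .node x fs, w, h => by
    have := Fits.size_le hE fs h.2
    rw [size_node]; omega
theorem Fits.size_le (hE : ∀ w, w < E w) : ∀ (F : List OTree) {a b : ℕ}, Fits lab E F a b →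
    a + fsize F ≤ b
  | [], a, b, h => h
  | t :: F, a, b, ⟨w, h₁, h₂, h₃, h₄⟩ => by
    have := RootAt.size_le hE t h₃
    have := Fits.size_le hE F h₄
    rw [fsize_cons]; omega
end

theorem fits_append (hE : ∀ w, w < E w) {F G : List OTree} : ∀ {a b : ℕ},
    Fits lab E (F ++ G) a b ↔ ∃ c, Fits lab E F a c ∧ Fits lab E G c b := by
  induction F with
  | nil =>
    intro a b
    simp only [List.nil_append, Fits]
    exact ⟨fun h => ⟨a, le_rfl, h⟩, fun ⟨c, hc, h⟩ => fits_mono h hc le_rfl⟩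
  | cons t F ih =>
    intro a b
    simp only [List.cons_append, Fits]
    constructor
    · rintro ⟨w, h₁, h₂, h₃, h₄⟩
      obtain ⟨c, hc, hG⟩ := ih.1 h₄
      have := hc.size_le hE
      exact ⟨c, ⟨w, h₁, by omega, h₃, hc⟩, hG⟩
    · rintro ⟨c, ⟨w, h₁, h₂, h₃, h₄⟩, hG⟩
      have := hG.size_le hE
      exact ⟨w, h₁, by omega, h₃, ih.2 ⟨c, h₄, hG⟩⟩

theorem fits_singleton {t : OTree} {a b : ℕ} :
    Fits lab E [t] a b ↔ ∃ w, a ≤ w ∧ E w ≤ b ∧ RootAt lab E t w := by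
  simp only [Fits]
  exact ⟨fun ⟨w, h₁, h₂, h₃, _⟩ => ⟨w, h₁, h₂, h₃⟩, fun ⟨w, h₁, h₂, h₃⟩ => ⟨w, h₁, h₂, h₃, h₂⟩⟩

theorem fits_node {x : ℕ} {fs : List OTree} {w : ℕ} :
    Fits lab E [.node x fs] w (E w) ↔
      Fits lab E [.node x fs] (w + 1) (E w) ∨ (lab w = x ∧ Fits lab E fs (w + 1) (E w)) := by
  constructor
  · rw [fits_singleton]
    rintro ⟨z, h₁, h₂, h₃⟩
    rcases h₁.eq_or_lt with rfl | h
    · exact .inr h₃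
    · exact .inl (fits_singleton.2 ⟨z, h, h₂, h₃⟩)
  · rintro (h | h)
    · exact fits_mono h (by omega) le_rfl
    · exact fits_singleton.2 ⟨w, le_rfl, le_rfl, h⟩

/-- `w` is a deepest node whose subtree includes `t`: the tree is included in the subtree of `w`,
but not below `w`. -/
def MinAt (lab E : ℕ → ℕ) (t : OTree) (w : ℕ) : Prop :=
  Fits lab E [t] w (E w) ∧ ¬ Fits lab E [t] (w + 1) (E w)

/-- Only the deepest nodes matter for the inclusion of a single tree. -/
theorem fits_iff_minAt (hE : ∀ w, w < E w) {t : OTree} {a b : ℕ} :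
    Fits lab E [t] a b ↔ ∃ w, a ≤ w ∧ E w ≤ b ∧ MinAt lab E t w := by
  constructor
  · intro h
    induction hd : b - a using Nat.strong_induction_on generalizing a b with
    | _ d ih =>
      obtain ⟨w, h₁, h₂, h₃⟩ := fits_singleton.1 h
      have hw : Fits lab E [t] w (E w) := fits_singleton.2 ⟨w, le_rfl, le_rfl, h₃⟩
      by_cases hm : Fits lab E [t] (w + 1) (E w)
      · have := hE w
        obtain ⟨z, k₁, k₂, k₃⟩ := ih (E w - (w + 1)) (by omega) hm rfl
        exact ⟨z, by omega, by omega, k₃⟩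
      · exact ⟨w, h₁, h₂, hw, hm⟩
  · rintro ⟨w, h₁, h₂, h₃, -⟩
    exact fits_mono h₃ h₁ h₂

end

/-- Functions on preorder numbers that describe a tree with `n` nodes: the parent `par w` of a node,
and the end `E w` of the interval `[w, E w)` of its descendants. -/
structure IsTree (n : ℕ) (par E : ℕ → ℕ) : Prop where
  lt_end : ∀ w, w < E w
  end_le : ∀ w, w < n → E w ≤ n
  par_lt : ∀ w, 0 < w → w < n → par w < w
  end_par : ∀ w, 0 < w → w < n → E w ≤ E (par w)
  le_par : ∀ z y, y < n → z < y → y < E z → z ≤ par y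
  par_zero : par 0 = 0
  end_zero : E 0 = n

namespace IsTree
variable {n : ℕ} {par E : ℕ → ℕ} (h : IsTree n par E)
include h

theorem pos : 0 < n := h.end_zero ▸ h.lt_end 0

/-- Intervals of descendants are nested: if `y` lies in that of `x`, then so does its interval. -/
theorem laminar {x y : ℕ} (hx : x < n) (hxy : x ≤ y) (hy : y < E x) : E y ≤ E x := by
  induction y using Nat.strong_induction_on with
  | _ y ih =>
    rcases hxy.eq_or_lt with rfl | hlt
    · exact le_rfl
    · have hyn : y < n := hy.trans_le (h.end_le x hx)
      have h₁ := h.par_lt y (by omega) hyn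
      have h₂ := h.le_par x y hyn hlt hy
      exact (h.end_par y (by omega) hyn).trans (ih _ h₁ h₂ (by omega))

/-- A proper descendant `z` of `x` is a descendant of some child `y` of `x`. -/
theorem exists_child {x z : ℕ} (hx : x < n) (hxz : x < z) (hz : z < E x) :
    ∃ y, par y = x ∧ x < y ∧ y ≤ z ∧ z < E y ∧ y < n := by
  induction z using Nat.strong_induction_on with
  | _ z ih =>
    have hzn : z < n := hz.trans_le (h.end_le x hx)
    have h₁ := h.par_lt z (by omega) hzn
    have h₂ := h.le_par x z hzn hxz hz
    rcases h₂.eq_or_lt with he | hlt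
    · exact ⟨z, he.symm, hxz, le_rfl, h.lt_end z, hzn⟩
    · obtain ⟨y, k₁, k₂, k₃, k₄, k₅⟩ := ih _ h₁ hlt (by omega)
      have hl := h.laminar k₅ k₃ k₄
      have he := h.end_par z (by omega) hzn
      have := h.lt_end z
      exact ⟨y, k₁, k₂, by omega, by omega, k₅⟩

theorem fits_child {lab : ℕ → ℕ} {t : OTree} {x : ℕ} (hx : x < n) :
    Fits lab E [t] (x + 1) (E x) ↔
      ∃ y, par y = x ∧ x < y ∧ y < n ∧ Fits lab E [t] y (E y) := by
  constructor
  · intro hf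
    obtain ⟨z, h₁, h₂, h₃⟩ := fits_singleton.1 hf
    have := h.lt_end z
    obtain ⟨y, k₁, k₂, k₃, k₄, k₅⟩ := h.exists_child hx (z := z) (by omega) (by omega)
    exact ⟨y, k₁, k₂, k₅, fits_singleton.2 ⟨z, k₃, h.laminar k₅ k₃ k₄, h₃⟩⟩
  · rintro ⟨y, rfl, h₂, h₃, h₄⟩
    exact fits_mono h₄ (by omega) (h.end_par y (by omega) h₃)

open Finset in
/-- The deepest nodes whose subtrees include `t` have disjoint subtrees with at least as many nodes
as `t` each. -/
theorem card_minAt_mul_size_le {lab : ℕ → ℕ} {t : OTree} [DecidablePred (MinAt lab E t)] :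
    #{w ∈ range n | MinAt lab E t w} * t.size ≤ n := by
  classical
  set M := {w ∈ range n | MinAt lab E t w} with hM
  have hdisj : (M : Set ℕ).PairwiseDisjoint fun w => Ico w (E w) := by
    have key : ∀ x ∈ M, ∀ y ∈ M, x < y → Disjoint (Ico x (E x)) (Ico y (E y)) := by
      intro x hx y hy hxy
      simp only [hM, mem_filter, mem_range] at hx hy
      rw [Finset.disjoint_left]
      intro z hz hz'
      simp only [mem_Ico] at hz hz'
      exact hx.2.2 (fits_mono hy.2.1 hxy (h.laminar hx.1 hxy.le (by omega)))
    intro x hx y hy hne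
    rcases hne.lt_or_gt with hlt | hlt
    · exact key x hx y hy hlt
    · exact (key y hy x hx hlt).symm
  calc #M * t.size = ∑ w ∈ M, t.size := by simp
    _ ≤ ∑ w ∈ M, #(Ico w (E w)) := by
      refine sum_le_sum fun w hw => ?_
      simp only [hM, mem_filter, mem_range] at hw
      have := hw.2.1.size_le h.lt_end
      simp at this
      rw [Nat.card_Ico]; omega
    _ = #(M.biUnion fun w => Ico w (E w)) := (card_biUnion hdisj).symm
    _ ≤ #(range n) := by
      refine card_le_card fun z hz => ?_
      simp only [mem_biUnion, hM, mem_filter, mem_range, mem_Ico] at hz ⊢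
      obtain ⟨w, hw, hz⟩ := hz
      have := h.end_le w hw.1
      omega
    _ = n := card_range n

end IsTree

/-! ### The preorder numbers of a tree -/

/-- The label of node `w`. -/
def labOf (T : OTree) (w : ℕ) : ℕ := (T.preorder[w]?.map OTree.label).getD 0

/-- The end of the interval of the descendants of node `w`. (Behind the nodes of the tree the value
`w + 1` is of no importance.) -/
def endOf (T : OTree) (w : ℕ) : ℕ := w + (T.preorder[w]?.map OTree.size).getD 1

/-- The parent word of node `w` in the representation of the tree. -/
def parOf (T : OTree) (w : ℕ) : ℕ := T.encode.getD (2 * w + 1) 0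

theorem lt_endOf (T : OTree) (w : ℕ) : w < endOf T w := by
  unfold endOf
  cases T.preorder[w]? with
  | none => simp
  | some t => simpa using size_pos t

/-- The forest `F` stands in `T` from preorder number `v` on. -/
def Stands (T : OTree) (F : List OTree) (v : ℕ) : Prop :=
  ∀ i, i < fsize F → T.preorder[v + i]? = (preorderForest F)[i]?

section
variable {T : OTree}

theorem preorderForest_node (a : ℕ) (ts G : List OTree) :
    preorderForest (.node a ts :: G) = .node a ts :: preorderForest (ts ++ G) := by
  rw [preorderForest_append]; simp [preorderForest, preorder]

theorem Stands.head {t : OTree} {G : List OTree} {v : ℕ} (h : Stands T (t :: G) v) :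
    T.preorder[v]? = some t := by
  have := h 0 (by have := size_pos t; simp; omega)
  cases t
  simpa [preorderForest, preorder] using this

theorem Stands.tail {a : ℕ} {ts G : List OTree} {v : ℕ} (h : Stands T (.node a ts :: G) v) :
    Stands T (ts ++ G) (v + 1) := by
  intro i hi
  have := h (i + 1) (by simp at hi ⊢; omega)
  rw [preorderForest_node] at this
  rw [show v + 1 + i = v + (i + 1) by omega, this]
  simp

theorem Stands.left {F G : List OTree} {v : ℕ} (h : Stands T (F ++ G) v) : Stands T F v := by
  intro i hi
  rw [h i (by simp; omega), preorderForest_append, List.getElem?_append_left hi]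

theorem Stands.right {F G : List OTree} {v : ℕ} (h : Stands T (F ++ G) v) :
    Stands T G (v + fsize F) := by
  intro i hi
  have := h (fsize F + i) (by simp; omega)
  rw [preorderForest_append, fsize, List.getElem?_append_right (by omega)] at this
  rw [Nat.add_assoc, fsize, this]
  simp

theorem stands_self (T : OTree) : Stands T [T] 0 := by
  intro i _; simp [preorderForest]

theorem Stands.labOf_eq {a : ℕ} {ts G : List OTree} {v : ℕ} (h : Stands T (.node a ts :: G) v) :
    labOf T v = a := by simp [labOf, h.head, OTree.label]

theorem Stands.endOf_eq {t : OTree} {G : List OTree} {v : ℕ} (h : Stands T (t :: G) v) :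
    endOf T v = v + t.size := by simp [endOf, h.head]

theorem Emb.fits {F G : List OTree} (h : Emb F G) : ∀ {v : ℕ}, Stands T G v →
    Fits (labOf T) (endOf T) F v (v + fsize G) := by
  induction h with
  | nil => intro v _; simp [Fits]
  | skip a h ih =>
    intro v hG
    refine fits_mono (ih hG.tail) (by omega) ?_
    simp; omega
  | @keep a fs F ts G h h' ih ih' =>
    intro v hG
    have he : endOf T v = v + 1 + fsize ts := by rw [hG.endOf_eq, size_node]; omega
    refine ⟨v, le_rfl, ?_, ⟨hG.labOf_eq, ?_⟩, ?_⟩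
    · rw [he]; simp; omega
    · rw [he]; exact ih hG.tail.left
    · have := ih' hG.tail.right
      rw [he]
      refine fits_mono this le_rfl (by simp; omega)

/-- Converse of `Emb.fits`, by induction on a bound `m` for the size of `G`: if the first tree of
`F` is not matched with the first root of `G`, then this root may be deleted. -/
theorem emb_of_fits : ∀ (m : ℕ) {F G : List OTree} {v : ℕ}, fsize G ≤ m → Stands T G v →
    Fits (labOf T) (endOf T) F v (v + fsize G) → Emb F G := by
  intro m
  induction m with
  | zero =>
    intro F G v hm hG hF
    have h₁ := hF.size_le (lt_endOf T)
    cases G with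
    | cons t G => have := size_pos t; simp at hm; omega
    | nil =>
      cases F with
      | nil => exact .nil
      | cons t F => have := size_pos t; simp at h₁; omega
  | succ m ih =>
    intro F G v hm hG hF
    cases G with
    | nil => exact ih (by simp) hG hF
    | cons t G =>
      obtain ⟨a, ts⟩ := t
      simp only [fsize_cons, size_node] at hm hF
      have he : endOf T v = v + 1 + fsize ts := by rw [hG.endOf_eq, size_node]; omega
      have hskip : Fits (labOf T) (endOf T) F (v + 1)
          (v + (fsize ts + 1 + fsize G)) → Emb F (.node a ts :: G) := by
        intro hF
        refine .skip a (ih (by simp; omega) hG.tail (fits_mono hF le_rfl ?_))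
        simp; omega
      cases F with
      | nil => exact hskip (by simp [Fits]; omega)
      | cons s F =>
        obtain ⟨w, h₁, h₂, h₃, h₄⟩ := hF
        rcases h₁.eq_or_lt with rfl | hlt
        · obtain ⟨b, fs⟩ := s
          obtain ⟨hb, hfs⟩ := h₃
          rw [hG.labOf_eq] at hb
          subst hb
          rw [he] at hfs h₄
          refine .keep a (ih (by omega) hG.tail.left hfs) (ih (by omega) hG.tail.right ?_)
          exact fits_mono h₄ le_rfl (by omega)
        · exact hskip ⟨w, hlt, h₂, h₃, h₄⟩

theorem included_iff_fits {P S : OTree} {w : ℕ} (hS : Stands T [S] w) :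
    Included P S ↔ Fits (labOf T) (endOf T) [P] w (endOf T w) := by
  rw [included_iff_emb, hS.endOf_eq]
  exact ⟨fun h => by simpa using h.fits hS, fun h => emb_of_fits _ le_rfl hS (by simpa using h)⟩

end

/-! ### The representation of a tree in memory -/

/-- The words of the forest `F`, with parent `p`, stand in the representation of `T` from node `v`
on. -/
def Encoded (T : OTree) (F : List OTree) (v p : ℕ) : Prop :=
  ∀ i, i < 2 * fsize F → T.encode[2 * v + i]? = (encodeForestFrom v p F)[i]?

theorem length_encodeForestFrom : ∀ (m : ℕ) (F : List OTree) (v p : ℕ), fsize F ≤ m →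
    (encodeForestFrom v p F).length = 2 * fsize F := by
  intro m
  induction m with
  | zero =>
    intro F v p hm
    cases F with
    | nil => simp [encodeForestFrom]
    | cons t F => have := size_pos t; simp at hm; omega
  | succ m ih =>
    intro F v p hm
    cases F with
    | nil => simp [encodeForestFrom]
    | cons t F =>
      obtain ⟨a, ts⟩ := t
      simp only [fsize_cons, size_node] at hm
      simp [encodeForestFrom, encodeFrom, ih ts _ _ (by omega), ih F _ _ (by omega)]
      omega

theorem length_encode (T : OTree) : T.encode.length = 2 * T.size := by
  have := length_encodeForestFrom _ [T] 0 0 le_rfl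
  simpa [encodeForestFrom, encode] using this

section
variable {T : OTree}

theorem encoded_self (T : OTree) : Encoded T [T] 0 0 := by
  intro i _; simp [encodeForestFrom, encode]

theorem encodeForestFrom_node (a v p : ℕ) (ts G : List OTree) :
    encodeForestFrom v p (.node a ts :: G) = a :: p :: (encodeForestFrom (v + 1) v ts ++
      encodeForestFrom (v + (fsize ts + 1)) p G) := by
  simp [encodeForestFrom, encodeFrom]

theorem Encoded.label {a v p : ℕ} {ts G : List OTree} (h : Encoded T (.node a ts :: G) v p) :
    T.encode.getD (2 * v) 0 = a := by
  have := h 0 (by simp)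
  rw [encodeForestFrom_node] at this
  simp only [Nat.add_zero] at this
  simp [List.getD_eq_getElem?_getD, this]

theorem Encoded.par {p v : ℕ} {t : OTree} {G : List OTree} (h : Encoded T (t :: G) v p) :
    parOf T v = p := by
  obtain ⟨a, ts⟩ := t
  have := h 1 (by simp; omega)
  rw [encodeForestFrom_node] at this
  simp [parOf, List.getD_eq_getElem?_getD, this]

theorem Encoded.children {a v p : ℕ} {ts G : List OTree} (h : Encoded T (.node a ts :: G) v p) :
    Encoded T ts (v + 1) v := by
  intro i hi
  have := h (i + 2) (by simp; omega)
  rw [encodeForestFrom_node] at this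
  rw [show 2 * (v + 1) + i = 2 * v + (i + 2) by omega, this]
  simp only [List.getElem?_cons_succ]
  rw [List.getElem?_append_left (by rw [length_encodeForestFrom _ ts _ _ le_rfl]; exact hi)]

theorem Encoded.tail {v p : ℕ} {t : OTree} {G : List OTree} (h : Encoded T (t :: G) v p) :
    Encoded T G (v + t.size) p := by
  obtain ⟨a, ts⟩ := t
  intro i hi
  have := h (2 * (fsize ts + 1) + i) (by simp; omega)
  rw [encodeForestFrom_node] at this
  rw [size_node, show 2 * (v + (fsize ts + 1)) + i = 2 * v + (2 * (fsize ts + 1) + i) by omega,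
    this]
  rw [show 2 * (fsize ts + 1) + i = 2 * fsize ts + i + 1 + 1 by omega]
  simp only [List.getElem?_cons_succ]
  rw [List.getElem?_append_right (by rw [length_encodeForestFrom _ ts _ _ le_rfl]; omega),
    length_encodeForestFrom _ ts _ _ le_rfl]
  congr 1; omega

theorem Encoded.right {v p : ℕ} {F G : List OTree} (h : Encoded T (F ++ G) v p) :
    Encoded T G (v + fsize F) p := by
  induction F generalizing v with
  | nil => exact h
  | cons t F ih =>
    have := ih h.tail
    rwa [fsize_cons, ← Nat.add_assoc]

theorem Encoded.single {v p : ℕ} {t : OTree} {G : List OTree} (h : Encoded T (t :: G) v p) :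
    Encoded T [t] v p := by
  intro i hi
  rw [h i (by simp at hi ⊢; omega)]
  obtain ⟨a, ts⟩ := t
  simp only [encodeForestFrom]
  rw [List.append_nil, List.getElem?_append_left]
  have := length_encodeForestFrom _ [.node a ts] v p le_rfl
  simp only [encodeForestFrom, List.append_nil] at this
  omega

theorem Stands.exists_stands : ∀ (m : ℕ) {F : List OTree} {v : ℕ}, fsize F ≤ m → Stands T F v →
    ∀ i, i < fsize F → ∃ S, Stands T [S] (v + i) := by
  intro m
  induction m with
  | zero => intro F v hm _ i hi; omega
  | succ m ih =>
    intro F v hm hF i hi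
    cases F with
    | nil => simp at hi
    | cons t G =>
      obtain ⟨a, ts⟩ := t
      simp only [fsize_cons, size_node] at hm hi
      rcases i with _ | i
      · exact ⟨_, Stands.left (G := G) hF⟩
      · have := ih (by simp; omega) hF.tail i (by simp; omega)
        rwa [show v + 1 + i = v + (i + 1) by omega] at this

/-- Each entry of the preorder list stands in the tree together with its descendants. -/
theorem stands_of_getElem? {S : OTree} {w : ℕ} (h : T.preorder[w]? = some S) : Stands T [S] w := by
  have hw : w < T.size := (List.getElem?_eq_some_iff.1 h).1
  obtain ⟨S', hS'⟩ := (stands_self T).exists_stands _ le_rfl w (by simpa using hw)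
  rw [Nat.zero_add] at hS'
  have := hS'.head
  rw [h] at this
  cases this
  exact hS'

/-- The parent words of a forest in terms of the intervals of descendants. -/
theorem Stands.parOf_spec : ∀ (m : ℕ) {F : List OTree} {v p : ℕ}, fsize F ≤ m → Stands T F v →
    Encoded T F v p → ∀ y, v ≤ y → y < v + fsize F →
      (parOf T y = p ∨ v ≤ parOf T y ∧ parOf T y < y ∧ endOf T y ≤ endOf T (parOf T y)) ∧
      endOf T y ≤ v + fsize F ∧ T.encode.getD (2 * y) 0 = labOf T y ∧
      ∀ z, v ≤ z → z < y → y < endOf T z → z ≤ parOf T y := by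
  intro m
  induction m with
  | zero => intro F v p hm _ _ y h₁ h₂; omega
  | succ m ih =>
    intro F v p hm hF hE y h₁ h₂
    cases F with
    | nil => simp at h₂; omega
    | cons t G =>
      obtain ⟨a, ts⟩ := t
      simp only [fsize_cons, size_node] at hm h₂ ⊢
      have he : endOf T v = v + 1 + fsize ts := by rw [hF.endOf_eq, size_node]; omega
      have ihts := ih (by omega) hF.tail.left hE.children
      rcases h₁.eq_or_lt with rfl | hlt
      · refine ⟨.inl hE.par, by omega, by rw [hE.label, hF.labOf_eq], fun z _ _ _ => by omega⟩
      · by_cases hy : y < v + 1 + fsize ts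
        · obtain ⟨k₁, k₂, k₃, k₄⟩ := ihts y hlt hy
          refine ⟨.inr ?_, by omega, k₃, fun z hz hzy hyz => ?_⟩
          · rcases k₁ with k₁ | k₁
            · rw [k₁]; omega
            · omega
          · rcases hz.eq_or_lt with rfl | hz
            · omega
            · exact k₄ z hz hzy hyz
        · have hE' := hE.tail
          rw [size_node, show v + (fsize ts + 1) = v + 1 + fsize ts by omega] at hE'
          obtain ⟨k₁, k₂, k₃, k₄⟩ := ih (by omega) hF.tail.right hE' y (by omega) (by omega)
          refine ⟨by omega, by omega, k₃, fun z hz hzy hyz => ?_⟩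
          rcases hz.eq_or_lt with rfl | hz
          · omega
          · by_cases hze : z < v + 1 + fsize ts
            · have := (ihts z hz hze).2.1
              omega
            · exact k₄ z (by omega) hzy hyz

end

theorem endOf_zero (T : OTree) : endOf T 0 = T.size := by
  rw [(stands_self T).endOf_eq]; simp

/-- The parent words and the intervals of descendants of a tree satisfy the axioms `IsTree`. -/
theorem isTree (T : OTree) : IsTree T.size (parOf T) (endOf T) := by
  have key := (stands_self T).parOf_spec _ le_rfl (encoded_self T)
  simp only [fsize_cons, fsize_nil, Nat.add_zero, Nat.zero_add] at key
  refine ⟨lt_endOf T, fun w hw => (key w (by omega) hw).2.1, fun w h₀ hw => ?_, fun w h₀ hw => ?_,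
    fun z y hy => (key y (by omega) hy).2.2.2 z (by omega), (encoded_self T).par, endOf_zero T⟩
  · rcases (key w (by omega) hw).1 with h | h <;> omega
  · rcases (key w (by omega) hw).1 with h | h
    · rw [h, endOf_zero]; exact (key w (by omega) hw).2.1
    · exact h.2.2

theorem encode_label {T : OTree} {w : ℕ} (hw : w < T.size) :
    T.encode.getD (2 * w) 0 = labOf T w := by
  have key := (stands_self T).parOf_spec _ le_rfl (encoded_self T)
  exact (key w (by omega) (by simpa using hw)).2.2.1

theorem labOf_lt {T : OTree} {N w : ℕ} (h : ∀ S ∈ T.preorder, S.label < N) (hN : 0 < N) :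
    labOf T w < N := by
  unfold labOf
  cases hw : T.preorder[w]? with
  | none => simpa using hN
  | some S => exact h S (List.mem_of_getElem? hw)

/-! ### Maximal unary chains -/

/-- The number of leaves of a forest. -/
def fleaves (F : List OTree) : ℕ := (F.map OTree.numLeaves).sum

theorem countP_preorderForest (F : List OTree) :
    (preorderForest F).countP (fun t => t.children.isEmpty) = fleaves F := by
  induction F with
  | nil => simp [preorderForest, fleaves]
  | cons t F ih => simp [preorderForest, ih, fleaves, OTree.numLeaves]

@[simp] theorem fleaves_nil : fleaves [] = 0 := rfl

@[simp] theorem fleaves_cons (t : OTree) (F : List OTree) :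
    fleaves (t :: F) = t.numLeaves + fleaves F := by simp [fleaves]

@[simp] theorem fleaves_append (F G : List OTree) : fleaves (F ++ G) = fleaves F + fleaves G := by
  simp [fleaves]

theorem numLeaves_node (a : ℕ) (ts : List OTree) :
    (OTree.node a ts).numLeaves = if ts = [] then 1 else fleaves ts := by
  cases ts with
  | nil => simp [OTree.numLeaves, preorder, preorderForest, OTree.children]
  | cons t ts =>
    rw [OTree.numLeaves, preorder, List.countP_cons, countP_preorderForest]
    simp [OTree.children]

/-- `IsChain t c F`: from the root of `t` a path of `c` nodes leads down, each but the last of which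
has exactly one child, and the children of the last one, if any, are the roots of `F` and at least
two. -/
inductive IsChain : OTree → ℕ → List OTree → Prop
  | last (a : ℕ) {F : List OTree} (h : F.length ≠ 1) : IsChain (.node a F) 1 F
  | cons (a : ℕ) {t : OTree} {c : ℕ} {F : List OTree} (h : IsChain t c F) :
      IsChain (.node a [t]) (c + 1) F

theorem exists_isChain (t : OTree) : ∃ c F, IsChain t c F := by
  induction hm : t.size using Nat.strong_induction_on generalizing t with
  | _ m ih =>
    obtain ⟨a, ts⟩ := t
    by_cases h : ts.length = 1
    · obtain ⟨t, rfl⟩ := List.length_eq_one_iff.1 h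
      obtain ⟨c, F, hc⟩ := ih t.size (by rw [← hm]; simp) t rfl
      exact ⟨_, _, .cons a hc⟩
    · exact ⟨_, _, .last a h⟩

/-- The forest that consists of the lowest `k` nodes of a chain and the forest `F` below them; `b`
is the preorder number of the lowest node. -/
def chainForest (lab : ℕ → ℕ) (F : List OTree) (b : ℕ) : ℕ → List OTree
  | 0 => F
  | k + 1 => [.node (lab (b - k)) (chainForest lab F b k)]

namespace IsChain
variable {t : OTree} {c : ℕ} {F : List OTree}

theorem pos (h : IsChain t c F) : 0 < c := by cases h <;> omega

theorem length_ne (h : IsChain t c F) : F.length ≠ 1 := by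
  induction h with
  | last _ h => exact h
  | cons _ _ ih => exact ih

theorem size_eq (h : IsChain t c F) : t.size = c + fsize F := by
  induction h with
  | last a _ => simp; omega
  | cons a _ ih => simp [ih]; omega

theorem numLeaves_eq (h : IsChain t c F) : t.numLeaves = if F = [] then 1 else fleaves F := by
  induction h with
  | last a _ => exact numLeaves_node a _
  | cons a _ ih => rw [numLeaves_node]; simpa using ih

variable {P : OTree} {v p : ℕ}

theorem stands (h : IsChain t c F) (hs : Stands P [t] v) : Stands P F (v + c) := by
  induction h generalizing v with
  | last a _ => simpa using hs.tail
  | @cons a t c F _ ih =>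
    have := ih (v := v + 1) (by simpa using hs.tail)
    rwa [show v + (c + 1) = v + 1 + c by omega]

theorem encoded (h : IsChain t c F) (hs : Encoded P [t] v p) :
    Encoded P F (v + c) (v + c - 1) := by
  induction h generalizing v p with
  | last a _ => exact hs.children
  | @cons a t c F h ih =>
    have := h.pos
    have := ih hs.children
    rwa [show v + (c + 1) = v + 1 + c by omega]

/-- All nodes of a chain have their descendants end at the same place. -/
theorem endOf_eq (h : IsChain t c F) (hs : Stands P [t] v) : ∀ i, i < c →
    endOf P (v + i) = v + t.size := by
  induction h generalizing v with
  | last a _ =>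
    intro i hi
    obtain rfl : i = 0 := by omega
    exact hs.endOf_eq
  | @cons a t c F h ih =>
    intro i hi
    rcases i with _ | i
    · exact hs.endOf_eq
    · rw [show v + (i + 1) = v + 1 + i by omega, ih (by simpa using hs.tail) i (by omega)]
      simp; omega

theorem chainForest_eq (h : IsChain t c F) (hs : Stands P [t] v) :
    chainForest (labOf P) F (v + c - 1) c = [t] := by
  induction h generalizing v with
  | last a _ => simp [chainForest, hs.labOf_eq]
  | @cons a t c F h ih =>
    have := ih (v := v + 1) (by simpa using hs.tail)
    rw [show v + 1 + c - 1 = v + (c + 1) - 1 by omega] at this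
    rw [chainForest, this, show v + (c + 1) - 1 - c = v by omega, hs.labOf_eq]

end IsChain

attribute [simp] Cmd.wp Cmd.cost

/-! ### The program -/

/-- Copies the labels and the parent words of `N` nodes from the input, from address `rOff` on. -/
def readNodes (N : Var) (lab par : Arr) : Cmd :=
  .set rI 0 ;;
  .loop (.lt rI N) (
    .put lab rI (aInp (rOff + rI + rI)) ;;
    .put par rI (aInp (rOff + rI + rI + 1)) ;;
    .set rI (rI + 1))

/-- Computes the ends of the intervals of descendants from the parents. In reverse preorder, each
node hands its end over to its parent. -/
def computeEnds (N : Var) (par E : Arr) : Cmd :=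
  .set rI 0 ;;
  .loop (.lt rI N) (.put E rI (rI + 1) ;; .set rI (rI + 1)) ;;
  .loop (.lt 1 rI) (
    .set rI (rI - 1) ;;
    .set rX (par rI) ;;
    .ite (.lt (E rX) (E rI)) (.put E rX (E rI)) .skip)

/-- Computes for each inner node `i` of the pattern a child `aHvy i` with a largest subtree, and
enters in `aPrv` at each node that has a left sibling this sibling. The entry `0` behind the ends of
the pattern nodes is a sentinel for `descend`. -/
def computeLinks : Cmd :=
  .put aEndP rNP 0 ;;
  .set rI 0 ;;
  .loop (.lt rI rNP) (.put aHvy rI (rI + 1) ;; .set rI (rI + 1)) ;;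
  .set rI 1 ;;
  .loop (.lt rI rNP) (
    .set rP (aParP rI) ;;
    .set rH (aHvy rP) ;;
    .ite (.lt (aEndP rH + rI) (aEndP rI + rH)) (.put aHvy rP rI) .skip ;;
    .set rX (aEndP rI) ;;
    .ite (.lt rX (aEndP rP)) (.put aPrv rX rI) .skip ;;
    .set rI (rI + 1))

/-- Fills the buffer with a constant. -/
def fillBuf (e : Expr) : Cmd :=
  .set rI 0 ;;
  .loop (.lt rI (rNT + 2)) (.put aBuf rI e ;; .set rI (rI + 1))

/-- Finds the bottom `rB` of the unary chain that begins at `rV`. A node has exactly one child if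
the next node in preorder has the same end. -/
def descend : Cmd :=
  .set rB rV ;;
  .loop (.eq (aEndP (rB + 1)) (aEndP rB)) (.set rB (rB + 1))

/-- The level `rT` of the forest below node `rI`: the number of the forests, among those that
consist of the lowest `0, 1, 2, …` nodes of the chain and all below them, that are included below
`rI`. The children of `rI` give all but the information whether the forest without chain nodes,
level `1`, is included; this is read from the buffer. -/
def openLevel : Cmd :=
  .set rT (aAcc rI) ;;
  .ite (.eq rT 0) (.ite (.lt (aEndT rI) (aBuf (rI + 2))) .skip (.set rT 1)) .skip

/-- The level `rS` of the subtree of node `rI`, which exceeds that of the forest below by one if the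
label of `rI` is that of the next chain node. -/
def closedLevel : Cmd :=
  .set rS rT ;;
  .ite (.lt 0 rT)
    (.ite (.lt rC rT) .skip
      (.ite (.eq (aLabT rI) (aLabP (rB + 1 - rT))) (.set rS (rT + 1)) .skip)) .skip

/-- Marks node `rI` in `aInc` if its subtree includes the pattern subtree, and in `aMk` if it is in
addition a deepest such node. -/
def mark : Cmd :=
  .put aInc rI 0 ;;
  .put aMk rI 0 ;;
  .ite (.lt rC rS) (.put aInc rI 1 ;; .ite (.lt rC rT) .skip (.put aMk rI 1)) .skip

/-- Hands the level of node `rI` over to its parent. -/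
def toParent : Cmd :=
  .set rX (aParT rI) ;;
  .ite (.lt (aAcc rX) rS) (.put aAcc rX rS) .skip

/-- Marks the nodes of `T` whose subtrees include the pattern subtree `rV`, which begins with a
chain that ends at `rB`. The buffer tells below which nodes the forest below the chain is included:
those nodes `i` whose end is not smaller than the entry `i + 2`. -/
def levels : Cmd :=
  .set rC (rB + 1 - rV) ;;
  .set rI 0 ;;
  .loop (.lt rI rNT) (.put aAcc rI 0 ;; .set rI (rI + 1)) ;;
  .loop (.lt 0 rI) (.set rI (rI - 1) ;; openLevel ;; closedLevel ;; mark ;; toParent)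

/-- Opens a frame for the windows of `rP` with those of the child that was done. -/
def pushFrame : Cmd :=
  .put aFrm rP rSP ;;
  .set rI 0 ;;
  .loop (.lt rI rNT) (
    .ite (.eq (aMk rI) 1)
      (.put aSL rSP (rI + 1) ;; .put aSE rSP (aEndT rI) ;; .set rSP (rSP + 1)) .skip ;;
    .set rI (rI + 1))

/-- Extends the windows in the frame of `rP` by a tree on the right: the first loop computes for
each `i` the smallest end of a marked node `≥ i`, and `rNT + 1` if there is none. -/
def extendRight : Cmd :=
  .put aBuf rNT (rNT + 1) ;;
  .put aBuf (rNT + 1) (rNT + 1) ;;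
  .set rI rNT ;;
  .loop (.lt 0 rI) (
    .set rI (rI - 1) ;;
    .set rX (aBuf (rI + 1)) ;;
    .ite (.eq (aMk rI) 1) (.ite (.lt (aEndT rI) rX) (.set rX (aEndT rI)) .skip) .skip ;;
    .put aBuf rI rX) ;;
  .set rI (aFrm rP) ;;
  .loop (.lt rI rSP) (.put aSE rI (aBuf (aSE rI)) ;; .set rI (rI + 1))

/-- Extends the windows in the frame of `rP` by a tree on the left: the first two loops compute for
each `i` the successor of the last marked node that ends before `i`, and `0` if there is none. -/
def extendLeft : Cmd :=
  fillBuf 0 ;;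
  .set rI 0 ;;
  .loop (.lt rI rNT) (
    .ite (.eq (aMk rI) 1) (.put aBuf (aEndT rI + 1) (rI + 1)) .skip ;;
    .set rI (rI + 1)) ;;
  .set rI 0 ;;
  .loop (.lt rI (rNT + 1)) (
    .ite (.lt (aBuf (rI + 1)) (aBuf rI)) (.put aBuf (rI + 1) (aBuf rI)) .skip ;;
    .set rI (rI + 1)) ;;
  .set rI (aFrm rP) ;;
  .loop (.lt rI rSP) (.put aSL rI (aBuf (aSL rI)) ;; .set rI (rI + 1))

/-- Computes for each `i` the smallest end of a window in the frame of `rP` whose begin is entered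
as a number `≥ i`, and `rNT + 1` if there is none. -/
def windowEnds : Cmd :=
  fillBuf (rNT + 1) ;;
  .set rI (aFrm rP) ;;
  .loop (.lt rI rSP) (
    .ite (.lt (aSE rI) (aBuf (aSL rI))) (.put aBuf (aSL rI) (aSE rI)) .skip ;;
    .set rI (rI + 1)) ;;
  .set rI (rNT + 1) ;;
  .loop (.lt 0 rI) (
    .set rI (rI - 1) ;;
    .ite (.lt (aBuf (rI + 1)) (aBuf rI)) (.put aBuf rI (aBuf (rI + 1))) .skip)

/-- Completes the branching node `rP`, all of whose children are done. -/
def finish : Cmd :=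
  windowEnds ;;
  .set rSP (aFrm rP) ;;
  .set rB rP ;;
  .set rV (aTop rP) ;;
  levels ;;
  .set rMode 1

/-- Goes to the sibling on the left of `rY`, or to the parent if there is none. -/
def goLeft : Cmd :=
  .ite (.eq rY (rP + 1)) finish (.set rV (aPrv rY) ;; .set rMode 0)

/-- Goes from the child `rV` of `rP` to the next one: the heavy child comes first, then the siblings
on its right, and then those on its left. -/
def next : Cmd :=
  .ite (.lt rV rH) (.set rY rV ;; goLeft)
    (.set rX (aEndP rV) ;;
      .ite (.lt rX (aEndP rP)) (.set rV rX ;; .set rMode 0) (.set rY rH ;; goLeft))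

/-- Uses the marks for the child `rV` of `rP`, with the heavy child `rH`, to make or to extend the
windows of `rP`. -/
def absorb : Cmd :=
  .ite (.eq rV rH) pushFrame (.ite (.lt rH rV) extendRight extendLeft)

/-- The start of the work on the pattern subtree `rV`. -/
def start : Cmd :=
  descend ;;
  .ite (.eq (aEndP rB) (rB + 1)) (fillBuf 0 ;; levels ;; .set rMode 1)
    (.put aTop rB rV ;; .set rV (aHvy rB))

/-- What is to be done when the pattern subtree `rV` is done. -/
def done : Cmd :=
  .ite (.eq rV 0) (.set rMode 2)
    (.set rP (aParP rV) ;; .set rH (aHvy rP) ;; absorb ;; next)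

/-- One round of the main loop. The mode is `0` before and `1` after the work on a pattern subtree,
and `2` at the end. -/
def round : Cmd := .ite (.eq rMode 0) start done

/-- Copies the input to the tables and initializes the search. -/
def prepare : Cmd :=
  .set rNP (aInp 0) ;;
  .set rNT (aInp 1) ;;
  .set rOff 2 ;;
  readNodes rNP aLabP aParP ;;
  .set rOff (rNP + rNP + 2) ;;
  readNodes rNT aLabT aParT ;;
  computeEnds rNP aParP aEndP ;;
  computeEnds rNT aParT aEndT ;;
  computeLinks ;;
  .set rV 0 ;;
  .set rMode 0 ;;
  .set rSP 0

/-- Writes down the answer. -/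
def output : Cmd :=
  .set rCnt 0 ;;
  .set rI 0 ;;
  .loop (.lt rI rNT) (
    .ite (.eq (aInc rI) 1) (.put aInp rCnt rI ;; .set rCnt (rCnt + 1)) .skip ;;
    .set rI (rI + 1)) ;;
  .set rAns (aInc 0)

/-- The structured program for the tree inclusion problem. -/
def main : Cmd := prepare ;; .loop (.lt rMode 2) round ;; output

/-! ### Preparation -/

section
variable {W cap n : ℕ}

/-! The bounds `128 * n ≤ W` for the words and `cap = 6 * n` for the arrays hold throughout, where
`n` is the size of the text. -/

theorem readNodes_spec {N : Var} {lab par : Arr} {m : ℕ} (hW : 128 * n ≤ W) (hcap : cap = 6 * n)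
    (hm : m ≤ n) (hn : 0 < n) (hN : N ∉ [rI, rOff]) (hlab : lab ∉ [aInp, par]) (hpar : par ≠ aInp)
    {σ : State} (hσ : σ.v N = m) (hoff : σ.v rOff + 2 * m ≤ cap) :
    Within W cap (readNodes N lab par) (8 * n) (fun σ' => ∀ i, i < m →
      σ'.a lab i = σ.a aInp (σ.v rOff + 2 * i) ∧
      σ'.a par i = σ.a aInp (σ.v rOff + 2 * i + 1)) σ := by
  simp only [List.mem_cons, List.not_mem_nil, or_false, not_or] at hN hlab
  unfold readNodes
  refine ((Within.loop_wp (m := m) (fun k σ' => σ'.v rI + k = m ∧ ∀ i, i < σ'.v rI →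
        σ'.a lab i = σ.a aInp (σ.v rOff + 2 * i) ∧
        σ'.a par i = σ.a aInp (σ.v rOff + 2 * i + 1)) ?_ ?_ ?_).set_seq ?_).mono ?_ ?_
  · rintro σ' ha ⟨h₁, h₂⟩
    have hN' := ha.1 N (by simp [Cmd.vars, hN])
    simp [hN, hσ] at hN'
    simp [hN']; omega
  · rintro k σ' ha ⟨h₁, h₂⟩
    have hN' := ha.1 N (by simp [Cmd.vars, hN])
    have hO' := ha.1 rOff (by simp [Cmd.vars])
    have hI' := ha.2 aInp (by simp [Cmd.arrs, Ne.symm hpar, Ne.symm hlab.1])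
    simp [hN, hσ] at hN' hO' hI'
    simp [hN', hO', hI']
    and_intros <;> try omega
    intro i hi
    simp only [hlab.2, Ne.symm hlab.1, Ne.symm hlab.2, false_and, if_false]
    split_ifs with h
    · subst h; exact ⟨by congr 1; omega, by congr 1; omega⟩
    · exact h₂ i (by omega)
  · simp
  · simp; omega
  · simp; omega
  · rintro σ' - ⟨h₁, h₂⟩ i hi
    exact h₂ i (by omega)

theorem computeEnds_spec {N : Var} {aP aE : Arr} {m : ℕ} {par E : ℕ → ℕ} (hT : IsTree m par E)
    (hW : 128 * n ≤ W) (hcap : cap = 6 * n) (hm : m ≤ n) (hN : N ∉ [rI, rX]) (hne : aP ≠ aE)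
    {σ : State} (hσ : σ.v N = m) (hpar : ∀ i, i < m → σ.a aP i = par i) :
    Within W cap (computeEnds N aP aE) (16 * n) (fun σ' => ∀ i, i < m → σ'.a aE i = E i) σ := by
  simp only [List.mem_cons, List.not_mem_nil, or_false, not_or] at hN
  have hm0 := hT.pos
  -- a node whose children have all been dealt with has its final value
  have final : ∀ (k : ℕ) (f : ℕ → ℕ), (∀ x, x < m → x < f x ∧ f x ≤ E x ∧
      ∀ y, k < y → y < m → par y = x → E y ≤ f x) → ∀ x, k ≤ x → x < m → f x = E x := by
    intro k f hf x hk hx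
    obtain ⟨k₁, k₂, k₃⟩ := hf x hx
    by_contra hne'
    obtain ⟨y, e₁, e₂, e₃, e₄, e₅⟩ := hT.exists_child hx (z := f x) k₁ (by omega)
    have := k₃ y (by omega) e₅ e₁
    omega
  unfold computeEnds
  refine (((Within.loop_wp (m := m) (fun k σ' => σ'.v rI + k = m ∧ ∀ i, i < σ'.v rI →
    σ'.a aE i = i + 1) ?_ ?_ ?_).seq fun σ₁ ha₁ hq₁ => (Within.loop_wp (m := m - 1) (fun k σ' =>
      σ'.v rI = k + 1 ∧ k < m ∧ ∀ x, x < m → x < σ'.a aE x ∧ σ'.a aE x ≤ E x ∧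
        ∀ y, k < y → y < m → par y = x → E y ≤ σ'.a aE x)
      ?_ ?_ ?_)).set_seq ?_).mono ?_ ?_
  · rintro σ' ha ⟨h₁, h₂⟩
    have hN' := ha.1 N (by simp [Cmd.vars, hN])
    simp [hN, hσ] at hN'
    simp [hN']; omega
  · rintro k σ' ha ⟨h₁, h₂⟩
    have hN' := ha.1 N (by simp [Cmd.vars, hN])
    simp [hN, hσ] at hN'
    simp [hN']
    refine ⟨by omega, by omega, by omega, by omega, ?_⟩
    intro i hi
    split_ifs with h
    · simp [h]
    · exact h₂ i (by omega)
  · simp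
  · rintro σ' ha ⟨h₁, h₂, h₃⟩
    simp [h₁]; omega
  · rintro k σ' ha ⟨h₁, h₂, h₃⟩
    have hP' := ha.2 aP (by simp [Cmd.arrs, hne])
    have hP₁ := ha₁.2 aP (by simp [Cmd.arrs, hne])
    have hp : ∀ i, i < m → σ'.a aP i = par i := fun i hi => by rw [hP', hP₁]; exact hpar i hi
    have hk := final _ _ h₃ (k + 1) le_rfl h₂
    have hpl := hT.par_lt (k + 1) (by omega) h₂
    have hpe := hT.end_par (k + 1) (by omega) h₂
    have hpm : par (k + 1) < m := by omega
    have hlt := hT.lt_end (k + 1)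
    simp [h₁, hp _ h₂, hk]
    and_intros <;> try omega
    · intro hlt'
      refine ⟨by omega, by omega, fun x hx => ?_⟩
      obtain ⟨k₁, k₂, k₃⟩ := h₃ x hx
      split_ifs with hxe
      · subst hxe
        refine ⟨by omega, by omega, fun y hy hym hyx => ?_⟩
        rcases Nat.lt_or_ge (k + 1) y with hy' | hy'
        · have := k₃ y hy' hym hyx; omega
        · obtain rfl : y = k + 1 := by omega
          exact le_rfl
      · refine ⟨k₁, k₂, fun y hy hym hyx => k₃ y ?_ hym hyx⟩
        rcases (show k + 1 ≤ y by omega).eq_or_lt with rfl | hy'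
        · exact absurd hyx.symm hxe
        · exact hy'
    · intro hle
      refine ⟨by omega, fun x hx => ?_⟩
      obtain ⟨k₁, k₂, k₃⟩ := h₃ x hx
      refine ⟨k₁, k₂, fun y hy hym hyx => ?_⟩
      rcases (show k + 1 ≤ y by omega).eq_or_lt with rfl | hy'
      · subst hyx; omega
      · exact k₃ y hy' hym hyx
  · have hI : σ₁.v rI = m := by omega
    refine ⟨by omega, by omega, fun x hx => ?_⟩
    rw [hq₁.2 x (by omega)]
    have := hT.lt_end x
    exact ⟨by omega, by omega, fun y h₁ h₂ _ => by omega⟩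
  · simp; omega
  · simp; omega
  · rintro σ' - ⟨h₁, h₂, h₃⟩ i hi
    exact final _ _ h₃ i (by omega) hi

theorem computeLinks_spec {m : ℕ} {par E : ℕ → ℕ} (hT : IsTree m par E)
    (hW : 128 * n ≤ W) (hcap : cap = 6 * n) (hm : m ≤ n)
    {σ : State} (hσ : σ.v rNP = m) (hpar : ∀ i, i < m → σ.a aParP i = par i)
    (hend : ∀ i, i < m → σ.a aEndP i = E i) :
    Within W cap computeLinks (24 * n) (fun σ' => σ'.a aEndP m = 0 ∧
      (∀ i, i < m → σ'.a aEndP i = E i) ∧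
      (∀ x, 0 < x → x < m → par (σ'.a aHvy (par x)) = par x ∧ 0 < σ'.a aHvy (par x) ∧
        σ'.a aHvy (par x) < m ∧ E x + σ'.a aHvy (par x) ≤ E (σ'.a aHvy (par x)) + x) ∧
      ∀ x, 0 < x → x < m → E x < E (par x) → σ'.a aPrv (E x) = x) σ := by
  have hm0 := hT.pos
  -- the first child of the parent of `x`
  have first : ∀ x, 0 < x → x < m → par (par x + 1) = par x ∧ par x + 1 ≤ x := by
    intro x h₀ hx
    have h₁ := hT.par_lt x h₀ hx
    have h₂ := hT.end_par x h₀ hx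
    have h₃ := hT.lt_end x
    have h₄ := hT.le_par (par x) (par x + 1) (by omega) (by omega) (by omega)
    have h₅ := hT.par_lt (par x + 1) (by omega) (by omega)
    omega
  unfold computeLinks
  refine ((((Within.loop_wp (m := m) (fun k σ' => σ'.v rI + k = m ∧ ∀ i, i < σ'.v rI →
    σ'.a aHvy i = i + 1) ?_ ?_ ?_).seq fun σ₁ ha₁ hq₁ => (Within.loop_wp (m := m - 1) (fun k σ' =>
      σ'.v rI + k = m ∧ 1 ≤ σ'.v rI ∧
      (∀ p, p < m → σ'.a aHvy p = p + 1 ∨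
        par (σ'.a aHvy p) = p ∧ 0 < σ'.a aHvy p ∧ σ'.a aHvy p < m) ∧
      (∀ x, 0 < x → x < σ'.v rI → E x + σ'.a aHvy (par x) ≤ E (σ'.a aHvy (par x)) + x) ∧
      ∀ x, 0 < x → x < σ'.v rI → E x < E (par x) → σ'.a aPrv (E x) = x)
      ?_ ?_ ?_).set_seq ?_ |>.mono le_rfl ?_).set_seq ?_).put_seq ?_ ?_ ?_).mono ?_ fun _ _ h => h
  · rintro σ' ha ⟨h₁, h₂⟩
    have hN' := ha.1 rNP (by decide)
    simp [hσ] at hN'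
    simp [hN']; omega
  · rintro k σ' ha ⟨h₁, h₂⟩
    have hN' := ha.1 rNP (by decide)
    simp [hσ] at hN'
    simp [hN']
    refine ⟨by omega, by omega, by omega, by omega, ?_⟩
    intro i hi
    split_ifs with h
    · simp [h]
    · exact h₂ i (by omega)
  · simp
  · rintro σ' ha ⟨h₁, h₂, -⟩
    have hN' := (ha.1 rNP (by decide)).trans (ha₁.1 rNP (by decide))
    simp [hσ] at hN'
    simp [hN']; omega
  · rintro k σ' ha ⟨h₁, h₂, h₃, h₄, h₅⟩
    have hN' := (ha.1 rNP (by decide)).trans (ha₁.1 rNP (by decide))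
    have hP' := (ha.2 aParP (by decide)).trans (ha₁.2 aParP (by decide))
    have hE' := (ha.2 aEndP (by decide)).trans (ha₁.2 aEndP (by decide))
    simp [hσ] at hN'
    have hp : ∀ i, i < m → σ'.a aParP i = par i := fun i hi => by rw [hP']; exact hpar i hi
    have he : ∀ i, i < m → σ'.a aEndP i = E i := fun i hi => by
      rw [hE']; simp [hσ, hi.ne]; exact hend i hi
    generalize hi : σ'.v rI = i at *
    have him : i < m := by omega
    have hpl := hT.par_lt i (by omega) him
    have hpe := hT.end_par i (by omega) him
    have hpm : par i < m := by omega
    have hel := hT.lt_end i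
    have hee := hT.end_le i him
    have hep := hT.end_le _ hpm
    have hh : par (σ'.a aHvy (par i)) = par i ∧ 0 < σ'.a aHvy (par i) ∧ σ'.a aHvy (par i) < m := by
      rcases h₃ _ hpm with h | h
      · rw [h]; have := first i (by omega) him; omega
      · exact h
    have heh := hT.end_le _ hh.2.2
    simp [hi, hN', hp i him, he i him, he _ hpm, he _ hh.2.2]
    have c₁ : ∀ p < m, (if p = par i then i else σ'.a aHvy p) = p + 1 ∨
        par (if p = par i then i else σ'.a aHvy p) = p ∧
          (0 < if p = par i then i else σ'.a aHvy p) ∧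
          (if p = par i then i else σ'.a aHvy p) < m := by
      intro p hpm'
      split_ifs with h
      · exact .inr ⟨h.symm, by omega, him⟩
      · exact h₃ p hpm'
    have c₂ : E (σ'.a aHvy (par i)) + i < E i + σ'.a aHvy (par i) → ∀ x, 0 < x → x ≤ i →
        (E x + if par x = par i then i else σ'.a aHvy (par x)) ≤
          E (if par x = par i then i else σ'.a aHvy (par x)) + x := by
      intro hlt x h₀ hx
      split_ifs with h
      · rcases hx.eq_or_lt with rfl | hx
        · exact le_rfl
        · have := h₄ x h₀ hx
          rw [h] at this
          omega
      · rcases hx.eq_or_lt with rfl | hx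
        · exact absurd rfl h
        · exact h₄ x h₀ hx
    have c₃ : E i + σ'.a aHvy (par i) ≤ E (σ'.a aHvy (par i)) + i → ∀ x, 0 < x → x ≤ i →
        E x + σ'.a aHvy (par x) ≤ E (σ'.a aHvy (par x)) + x := by
      intro hle x h₀ hx
      rcases hx.eq_or_lt with rfl | hx
      · exact hle
      · exact h₄ x h₀ hx
    have c₄ : E i < E (par i) → ∀ x, 0 < x → x ≤ i → E x < E (par x) →
        (if E x = E i then i else σ'.a aPrv (E x)) = x := by
      intro hlt x h₀ hx hxe
      rcases hx.eq_or_lt with rfl | hx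
      · simp
      · rw [if_neg]
        · exact h₅ x h₀ hx hxe
        · intro heq
          have h₁ := hT.le_par x i him hx (by omega)
          have h₂ := hT.laminar (x := x) (y := par i) (by omega) h₁ (by omega)
          omega
    have c₅ : E (par i) ≤ E i → ∀ x, 0 < x → x ≤ i → E x < E (par x) →
        σ'.a aPrv (E x) = x := by
      intro hle x h₀ hx hxe
      rcases hx.eq_or_lt with rfl | hx
      · omega
      · exact h₅ x h₀ hx hxe
    refine ⟨by omega, by omega, by omega, ⟨⟨by omega, by omega⟩, by omega, by omega⟩,
      fun hlt => ⟨by omega, by omega, by omega,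
        fun hlt' => ⟨by omega, ⟨by omega, by omega⟩, by omega, c₁, c₂ hlt, c₄ hlt'⟩,
        fun hle' => ⟨⟨by omega, by omega⟩, by omega, c₁, c₂ hlt, c₅ hle'⟩⟩,
      fun hle => ⟨by omega, by omega,
        fun hlt' => ⟨by omega, ⟨by omega, by omega⟩, by omega, h₃, c₃ hle, c₄ hlt'⟩,
        fun hle' => ⟨⟨by omega, by omega⟩, by omega, h₃, c₃ hle, c₅ hle'⟩⟩⟩
  · refine ⟨by simp; omega, by simp, fun p hp => ?_, fun x h₀ hx => ?_, fun x h₀ hx => ?_⟩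
    · simp; exact .inl (hq₁.2 p (by omega))
    · simp at hx; omega
    · simp at hx; omega
  · simp; omega
  · rintro σ' ha ⟨h₁, h₂, h₃, h₄, h₅⟩
    have hE' : ∀ i, σ'.a aEndP i = if i = m then 0 else σ.a aEndP i := by
      intro i
      rw [ha.2 aEndP (by decide), ha₁.2 aEndP (by decide)]
      simp [hσ]
    refine ⟨by simp [hE'], fun i hi => by rw [hE', if_neg hi.ne, hend i hi], fun x h₀ hx => ?_,
      fun x h₀ hx => h₅ x h₀ (by omega)⟩
    · have hpm : par x < m := (hT.par_lt x h₀ hx).trans hx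
      have h := h₄ x h₀ (by omega)
      rcases h₃ _ hpm with hh | hh
      · rw [hh] at h ⊢
        have := first x h₀ hx
        omega
      · omega
  · simp; omega
  · simp
  · simp; omega
  · simp; omega
  · simp; omega
end

section
variable {W cap n : ℕ}

/-! ### One pass over the text -/

theorem fillBuf_spec (hW : 128 * n ≤ W) (hcap : cap = 6 * n) (hn : 0 < n) {σ : State}
    (hσ : σ.v rNT = n) {e : Expr} {d : ℕ}
    (he : ∀ σ' : State, σ'.v rNT = n → e.Ok W cap σ' ∧ e.eval σ' = d) :
    Within W cap (fillBuf e) (16 * n) (fun σ' => ∀ i, i < n + 2 → σ'.a aBuf i = d) σ := by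
  unfold fillBuf
  refine ((Within.loop_wp (m := n + 2) (fun k σ' => σ'.v rI + k = n + 2 ∧ ∀ i, i < σ'.v rI →
    σ'.a aBuf i = d) ?_ ?_ ?_).set_seq ?_).mono ?_ ?_
  · rintro σ' ha ⟨h₁, h₂⟩
    have hN' := ha.1 rNT (by simp [Cmd.vars])
    simp [hσ] at hN'
    simp [hN']; omega
  · rintro k σ' ha ⟨h₁, h₂⟩
    have hN' := ha.1 rNT (by simp [Cmd.vars])
    simp [hσ] at hN'
    simp [hN', he σ' hN']
    refine ⟨by omega, by omega, by omega, by omega, by omega, ?_⟩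
    intro i hi
    exact fun h => h₂ i (by omega)
  · simp
  · simp; omega
  · simp; omega
  · rintro σ' - ⟨h₁, h₂⟩ i hi
    exact h₂ i (by omega)

theorem descend_spec (hW : 128 * n ≤ W) (hcap : cap = 6 * n) {m : ℕ} (hm : m ≤ n) {E : ℕ → ℕ}
    {σ : State} (hend : ∀ i, i < m → σ.a aEndP i = E i) (hend' : σ.a aEndP m = 0)
    {v c : ℕ} (hv : σ.v rV = v) (hc : 0 < c) (hcm : v + c ≤ m)
    (heq : ∀ i, i < c → E (v + i) = E v) (hne : v + c < m → E (v + c) ≠ E v) (hE : ∀ i, i < E i) :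
    Within W cap descend (4 * n) (fun σ' => σ'.v rB + 1 = v + c) σ := by
  unfold descend
  refine ((Within.loop_wp (m := c - 1) (fun k σ' => σ'.v rB + 1 + k = v + c ∧ v ≤ σ'.v rB)
    ?_ ?_ ?_).set_seq ?_).mono ?_ ?_
  · rintro σ' ha ⟨h₁, h₂⟩
    have hE' := ha.2 aEndP (by decide)
    have h₀ := heq (c - 1) (by omega)
    have h₃ := hE (v + (c - 1))
    rw [show v + (c - 1) = σ'.v rB by omega] at h₀ h₃
    have h₄ := hend (σ'.v rB) (by omega)
    simp at hE'
    simp [hE', h₄, h₀]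
    refine ⟨by omega, ?_⟩
    rw [show σ'.v rB + 1 = v + c by omega]
    rcases Nat.lt_or_ge (v + c) m with h | h
    · rw [hend _ h]; exact hne h
    · rw [show v + c = m by omega, hend']; omega
  · rintro k σ' ha ⟨h₁, h₂⟩
    have hE' := ha.2 aEndP (by decide)
    have h₀ := heq (σ'.v rB - v) (by omega)
    have h₃ := heq (σ'.v rB - v + 1) (by omega)
    rw [show v + (σ'.v rB - v) = σ'.v rB by omega] at h₀
    rw [show v + (σ'.v rB - v + 1) = σ'.v rB + 1 by omega] at h₃
    simp at hE'
    simp [hE', hend _ (show σ'.v rB < m by omega), hend _ (show σ'.v rB + 1 < m by omega), h₀, h₃]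
    omega
  · simp [hv]; omega
  · simp
  · simp; omega
  · rintro σ' - ⟨h₁, h₂⟩; omega

/-- The chain forest of `k` nodes is included in the subtree of `w`; for `k = 0`, below `w`. -/
def Reaches (lab E lb : ℕ → ℕ) (F : List OTree) (b k w : ℕ) : Prop :=
  if k = 0 then Fits lab E F (w + 1) (E w) else Fits lab E (chainForest lb F b k) w (E w)

section
variable {lab par E lb : ℕ → ℕ} {F : List OTree} {b c : ℕ}

theorem reaches_succ {k w : ℕ} : Reaches lab E lb F b (k + 1) w ↔
    Fits lab E (chainForest lb F b (k + 1)) (w + 1) (E w) ∨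
      lab w = lb (b - k) ∧ Fits lab E (chainForest lb F b k) (w + 1) (E w) := by
  rw [Reaches, if_neg (by omega)]
  exact fits_node

/-- What is included in the subtree of a child is included below its parent. -/
theorem IsTree.fits_of_child (hT : IsTree n par E) {k y w : ℕ} (hyw : w < y) (hyn : y < n)
    (hp : par y = w) (h : Reaches lab E lb F b k y) :
    Fits lab E (chainForest lb F b k) (w + 1) (E w) := by
  have := hT.end_par y (by omega) hyn
  rw [hp] at this
  unfold Reaches at h
  split_ifs at h with hk
  · subst hk; exact fits_mono h (by omega) this
  · exact fits_mono h (by omega) this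

/-- A forest with a root from the chain is included below a node exactly if it is included in the
subtree of a child. -/
theorem IsTree.fits_iff_child (hT : IsTree n par E) {k w : ℕ} (hw : w < n) :
    Fits lab E (chainForest lb F b (k + 1)) (w + 1) (E w) ↔
      ∃ y, par y = w ∧ w < y ∧ y < n ∧ Reaches lab E lb F b (k + 1) y := by
  simp only [Reaches, if_neg (Nat.succ_ne_zero k)]
  exact hT.fits_child hw

/-- What the pass over the text knows when the nodes from `i` on are done: `aAcc` holds for each
earlier node the largest level of the children that are done, where a level is greater than `k`
exactly if the forest with `k` chain nodes is included; and the marks of the nodes that are done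
are set. -/
def PassInv (n : ℕ) (lab par E lb : ℕ → ℕ) (F : List OTree) (b c i : ℕ) (σ : State) : Prop :=
  (∀ w, w < i → σ.a aAcc w ≤ c + 1 ∧ ∀ k, k ≤ c →
    (k < σ.a aAcc w ↔ ∃ y, par y = w ∧ i ≤ y ∧ w < y ∧ y < n ∧ Reaches lab E lb F b k y)) ∧
  ∀ w, i ≤ w → w < n →
    (Reaches lab E lb F b c w → σ.a aInc w = 1) ∧ (¬ Reaches lab E lb F b c w → σ.a aInc w = 0) ∧
    (Reaches lab E lb F b c w ∧ ¬ Fits lab E (chainForest lb F b c) (w + 1) (E w) →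
      σ.a aMk w = 1) ∧
    (¬ (Reaches lab E lb F b c w ∧ ¬ Fits lab E (chainForest lb F b c) (w + 1) (E w)) →
      σ.a aMk w = 0)

/-- For `k > 0` the forest with `k` chain nodes has one root, so that the children decide about its
inclusion (`IsTree.fits_iff_child`); for `k = 0` this is false, and the buffer decides. -/
theorem openLevel_spec (hW : 128 * n ≤ W) (hcap : cap = 6 * n) (hT : IsTree n par E) {σ : State}
    {i : ℕ} (hi : σ.v rI = i) (hin : i < n) (hend : σ.a aEndT i = E i)
    (hbuf : σ.a aBuf (i + 2) ≤ E i ↔ Fits lab E F (i + 1) (E i))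
    (hinv : PassInv n lab par E lb F b c (i + 1) σ) :
    Within W cap openLevel 10 (fun σ' => σ'.v rT ≤ c + 1 ∧ ∀ k, k ≤ c →
      (k < σ'.v rT ↔ Fits lab E (chainForest lb F b k) (i + 1) (E i))) σ := by
  obtain ⟨h₁, h₂⟩ := hinv.1 i (by omega)
  have h0 : 0 < σ.a aAcc i → Fits lab E F (i + 1) (E i) := by
    intro h
    obtain ⟨y, k₁, -, k₃, k₄, k₅⟩ := (h₂ 0 (by omega)).1 h
    exact hT.fits_of_child (k := 0) k₃ k₄ k₁ k₅
  have hs : ∀ k, k + 1 ≤ c → (k + 1 < σ.a aAcc i ↔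
      Fits lab E (chainForest lb F b (k + 1)) (i + 1) (E i)) := by
    intro k hk
    rw [h₂ (k + 1) hk, hT.fits_iff_child hin]
    exact ⟨fun ⟨y, k₁, _, k₃⟩ => ⟨y, k₁, k₃⟩, fun ⟨y, k₁, k₂, k₃⟩ => ⟨y, k₁, k₂, k₂, k₃⟩⟩
  unfold openLevel
  refine (Cmd.within_of_wp ?_).mono (T := 4) (by simp) fun σ' _ h => h
  simp [hi, hend]
  refine ⟨by omega, by omega, fun hz => ⟨⟨by omega, ⟨by omega, by omega⟩, by omega⟩, ?_, ?_⟩, ?_⟩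
  · intro hlt
    refine ⟨h₁, fun k hk => ?_⟩
    rcases k with _ | k
    · simp only [chainForest]; rw [← hbuf]; omega
    · exact hs k hk
  · intro hle
    refine ⟨by omega, fun k hk => ?_⟩
    rcases k with _ | k
    · exact ⟨fun _ => hbuf.1 hle, fun _ => rfl⟩
    · rw [← hs k hk]; omega
  · intro hz
    refine ⟨h₁, fun k hk => ?_⟩
    rcases k with _ | k
    · exact ⟨h0, fun _ => by omega⟩
    · exact hs k hk

/-- Besides what is included below it, the subtree of a node includes at most one more chain node,
which is matched with the node itself (`reaches_succ`). -/
theorem closedLevel_spec (hW : 128 * n ≤ W) (hcap : cap = 6 * n) {m : ℕ} (hm : m ≤ n) {σ : State}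
    {i : ℕ} (hi : σ.v rI = i) (hin : i < n) (hB : σ.v rB = b) (hbm : b < m) (hC : σ.v rC = c)
    (hcb : c ≤ b + 1) (hlab : σ.a aLabT i = lab i) (hlb : ∀ j, j < m → σ.a aLabP j = lb j)
    (ht : σ.v rT ≤ c + 1) (ht' : ∀ k, k ≤ c →
      (k < σ.v rT ↔ Fits lab E (chainForest lb F b k) (i + 1) (E i))) :
    Within W cap closedLevel 10 (fun σ' => σ'.v rS ≤ c + 1 ∧ ∀ k, k ≤ c →
      (k < σ'.v rS ↔ Reaches lab E lb F b k i)) σ := by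
  have h0 : 0 < σ.v rT ↔ Reaches lab E lb F b 0 i := ht' 0 (by omega)
  have hs : ∀ k, k + 1 ≤ c → (Reaches lab E lb F b (k + 1) i ↔
      k + 1 < σ.v rT ∨ lab i = lb (b - k) ∧ k < σ.v rT) := by
    intro k hk
    rw [reaches_succ, ht' (k + 1) hk, ht' k (by omega)]
  unfold closedLevel
  refine (Cmd.within_of_wp ?_).mono (T := 5) (by simp) fun σ' _ h => h
  simp [hi, hB, hC, hlab]
  generalize σ.v rT = t at *
  refine ⟨by omega, fun hz => ⟨fun hlt => ⟨ht, fun k hk => ?_⟩, fun hle => ⟨⟨by omega,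
    ⟨⟨by omega, by omega⟩, by omega⟩, by omega⟩, fun heq => ⟨⟨by omega, by omega⟩, by omega,
    fun k hk => ?_⟩, fun hne => ⟨ht, fun k hk => ?_⟩⟩⟩, fun hz => ⟨ht, fun k hk => ?_⟩⟩
  · rcases k with _ | k
    · exact h0
    · rw [hs k hk]; omega
  · rw [hlb _ (by omega)] at heq
    rcases k with _ | k
    · rw [← h0]; omega
    · rw [hs k hk]
      rcases Nat.lt_trichotomy (k + 1) t with h | h | h
      · omega
      · rw [show b - k = b + 1 - t by omega]
        exact ⟨fun _ => .inr ⟨heq, by omega⟩, fun _ => by omega⟩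
      · omega
  · rw [hlb _ (by omega)] at hne
    rcases k with _ | k
    · exact h0
    · rw [hs k hk]
      rcases Nat.lt_trichotomy (k + 1) t with h | h | h
      · omega
      · rw [show b - k = b + 1 - t by omega]
        exact ⟨fun _ => by omega, fun h => by tauto⟩
      · omega
  · rcases k with _ | k
    · exact h0
    · rw [hs k hk]; omega

theorem mark_spec (hW : 128 * n ≤ W) (hcap : cap = 6 * n) {σ : State}
    {i : ℕ} (hi : σ.v rI = i) (hin : i < n) :
    Within W cap mark 10 (fun σ' => ∀ j,
      σ'.a aInc j = (if j = i then if σ.v rC < σ.v rS then 1 else 0 else σ.a aInc j) ∧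
      σ'.a aMk j = (if j = i then if σ.v rC < σ.v rS ∧ σ.v rT ≤ σ.v rC then 1 else 0
        else σ.a aMk j)) σ := by
  unfold mark
  refine (Cmd.within_of_wp ?_).mono (T := 6) (by simp) fun σ' _ h => h
  simp [hi]
  and_intros <;> try omega
  · intro h
    and_intros <;> try omega
    · intro h' j
      by_cases hj : j = i <;> simp [hj, h]; omega
    · intro h'
      and_intros <;> try omega
      intro j
      by_cases hj : j = i <;> simp [hj, h, h']
  · intro h j
    by_cases hj : j = i <;> simp [hj]; omega

theorem toParent_spec (hcap : cap = 6 * n) (hT : IsTree n par E) {σ : State}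
    {i : ℕ} (hi : σ.v rI = i) (hin : i < n) (hpar : σ.a aParT i = par i) :
    Within W cap toParent 10 (fun σ' => ∀ j, σ'.a aAcc j =
      if j = par i then max (σ.a aAcc j) (σ.v rS) else σ.a aAcc j) σ := by
  have hp : par i < n := by
    rcases Nat.eq_zero_or_pos i with rfl | h
    · rw [hT.par_zero]; exact hin
    · exact (hT.par_lt i h hin).trans hin
  unfold toParent
  refine (Cmd.within_of_wp ?_).mono (T := 3) (by simp) fun σ' _ h => h
  simp [hi, hpar]
  and_intros <;> try omega
  intro h
  refine ⟨by omega, fun j => ?_⟩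
  split_ifs with hj
  · subst hj; omega
  · rfl

/-- The pass over the text marks the nodes whose subtrees include the tree `t`. -/
theorem levels_spec (hW : 128 * n ≤ W) (hcap : cap = 6 * n) (hT : IsTree n par E) {m : ℕ}
    (hm : m ≤ n) {σ : State} (hn : σ.v rNT = n) (hB : σ.v rB = b) (hbm : b < m)
    (hV : σ.v rV + c = b + 1) (hc : 0 < c) (hlab : ∀ i, i < n → σ.a aLabT i = lab i)
    (hpar : ∀ i, i < n → σ.a aParT i = par i) (hend : ∀ i, i < n → σ.a aEndT i = E i)
    (hlb : ∀ j, j < m → σ.a aLabP j = lb j)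
    (hbuf : ∀ i, i < n → (σ.a aBuf (i + 2) ≤ E i ↔ Fits lab E F (i + 1) (E i)))
    {t : OTree} (ht : chainForest lb F b c = [t]) :
    Within W cap levels (64 * n) (fun σ' => ∀ w, w < n →
      (Fits lab E [t] w (E w) → σ'.a aInc w = 1) ∧ (¬ Fits lab E [t] w (E w) → σ'.a aInc w = 0) ∧
      (MinAt lab E t w → σ'.a aMk w = 1) ∧ (¬ MinAt lab E t w → σ'.a aMk w = 0)) σ := by
  have hn0 := hT.pos
  unfold levels
  refine ((((Within.loop_wp (m := n) (fun k σ' => σ'.v rI + k = n ∧ ∀ i, i < σ'.v rI →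
    σ'.a aAcc i = 0) ?_ ?_ ?_).seq fun σ₁ ha₁ hq₁ => Within.loop (m := n) (K := 46)
      (fun k σ' => σ'.v rI = k ∧ k ≤ n ∧ PassInv n lab par E lb F b c k σ')
      ?_ ?_ ?_).set_seq ?_).set_seq ?_).mono ?_ ?_
  · rintro σ' ha ⟨h₁, h₂⟩
    have hN' := ha.1 rNT (by decide)
    simp [hn] at hN'
    simp [hN']; omega
  · rintro k σ' ha ⟨h₁, h₂⟩
    have hN' := ha.1 rNT (by decide)
    simp [hn] at hN'
    simp [hN']
    and_intros <;> try omega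
    intro i hi
    exact fun h => h₂ i (by omega)
  · simp
  · rintro σ' ha ⟨h₁, h₂, h₃⟩
    simp [h₁]; omega
  · rintro k σ' ha ⟨h₁, h₂, h₃⟩
    have hv : ∀ x, x ∉ [rI, rT, rS, rX, rC] → σ'.v x = σ.v x := by
      intro x hx
      simp at hx
      rw [ha.1 x (by simp [Cmd.vars, openLevel, closedLevel, mark, toParent]; tauto),
        ha₁.1 x (by simp [Cmd.vars]; tauto)]
      simp [hx]
    have hC : σ'.v rC = c := by
      rw [ha.1 rC (by decide), ha₁.1 rC (by decide)]
      simp; omega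
    have harr : ∀ x, x ∉ [aAcc, aInc, aMk] → σ'.a x = σ.a x := by
      intro x hx
      simp at hx
      rw [ha.2 x (by simp [Cmd.arrs, openLevel, closedLevel, mark, toParent]; tauto),
        ha₁.2 x (by simp [Cmd.arrs]; tauto)]
      simp
    have hkn : k < n := by omega
    refine ⟨by simp; omega, by simp [h₁], ?_⟩
    refine (Within.set_seq (T := 45) (by simp [h₁]; omega) ?_)
    refine Within.le_time (T := 10 + (10 + (10 + 10))) ?_ (by omega)
    refine (openLevel_spec hW hcap hT (i := k) (lab := lab) (lb := lb) (F := F) (b := b) (c := c)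
      (by simp [h₁]) hkn ?_ ?_ ?_).seq fun σ₂ ha₂ ⟨hq₂, hq₂'⟩ => ?_
    · simp [harr, hend k hkn]
    · simp [harr, hbuf k hkn]
    · exact h₃
    refine (closedLevel_spec hW hcap hm (i := k) (lab := lab) (lb := lb) (E := E) (F := F) (b := b)
        (c := c) ?_ hkn ?_ hbm ?_ (by omega) ?_ ?_ hq₂ hq₂').seq fun σ₃ ha₃ ⟨hq₃, hq₃'⟩ => ?_
    · rw [ha₂.1 rI (by decide)]; simp [h₁]
    · rw [ha₂.1 rB (by decide)]; simp [hv, hB]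
    · rw [ha₂.1 rC (by decide)]; simp [hC]
    · rw [ha₂.2 aLabT (by decide)]; simp [harr, hlab k hkn]
    · rw [ha₂.2 aLabP (by decide)]; simpa [harr] using hlb
    refine (mark_spec hW hcap (i := k) ?_ hkn).seq fun σ₄ ha₄ hq₄ =>
      (toParent_spec hcap hT (i := k) ?_ hkn ?_).mono le_rfl fun σ₅ ha₅ hq₅ => ?_
    · rw [ha₃.1 rI (by decide), ha₂.1 rI (by decide)]; simp [h₁]
    · rw [ha₄.1 rI (by decide), ha₃.1 rI (by decide), ha₂.1 rI (by decide)]; simp [h₁]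
    · rw [ha₄.2 aParT (by decide), ha₃.2 aParT (by decide), ha₂.2 aParT (by decide)]
      simp [harr, hpar k hkn]
    have e₁ : σ₄.v rS = σ₃.v rS := ha₄.1 rS (by decide)
    have e₂ : σ₃.v rT = σ₂.v rT := ha₃.1 rT (by decide)
    have e₃ : σ₃.v rC = c := by
      rw [ha₃.1 rC (by decide), ha₂.1 rC (by decide)]; simp [hC]
    have e₄ : σ₄.a aAcc = σ'.a aAcc := by
      rw [ha₄.2 aAcc (by decide), ha₃.2 aAcc (by decide), ha₂.2 aAcc (by decide)]; simp
    have e₅ : σ₃.a aInc = σ'.a aInc := by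
      rw [ha₃.2 aInc (by decide), ha₂.2 aInc (by decide)]; simp
    have e₆ : σ₃.a aMk = σ'.a aMk := by
      rw [ha₃.2 aMk (by decide), ha₂.2 aMk (by decide)]; simp
    have e₇ : σ₅.a aInc = σ₄.a aInc := ha₅.2 aInc (by decide)
    have e₈ : σ₅.a aMk = σ₄.a aMk := ha₅.2 aMk (by decide)
    have e₉ : σ₅.v rI = k := by
      rw [ha₅.1 rI (by decide), ha₄.1 rI (by decide), ha₃.1 rI (by decide), ha₂.1 rI (by decide)]
      simp [h₁]
    rw [e₁, e₄] at hq₅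
    rw [e₂, e₃, e₅, e₆] at hq₄
    refine ⟨e₉, by omega, fun w hw => ?_, fun w hw hwn => ?_⟩
    · obtain ⟨g₁, g₂⟩ := h₃.1 w (by omega)
      rw [hq₅]
      split_ifs with hwp
      · refine ⟨by omega, fun j hj => ?_⟩
        rw [lt_max_iff, g₂ j hj, hq₃' j hj]
        constructor
        · rintro (⟨y, y₁, y₂, y₃⟩ | h)
          · exact ⟨y, y₁, by omega, y₃⟩
          · exact ⟨k, hwp.symm, le_rfl, hw, hkn, h⟩
        · rintro ⟨y, y₁, y₂, y₃, y₄, y₅⟩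
          rcases y₂.eq_or_lt with rfl | hy
          · exact .inr y₅
          · exact .inl ⟨y, y₁, hy, y₃, y₄, y₅⟩
      · refine ⟨g₁, fun j hj => ?_⟩
        rw [g₂ j hj]
        constructor
        · rintro ⟨y, y₁, y₂, y₃⟩
          exact ⟨y, y₁, by omega, y₃⟩
        · rintro ⟨y, y₁, y₂, y₃⟩
          rcases y₂.eq_or_lt with rfl | hy
          · exact absurd y₁.symm hwp
          · exact ⟨y, y₁, hy, y₃⟩
    · rw [e₇, e₈, (hq₄ w).1, (hq₄ w).2]
      rcases hw.eq_or_lt with rfl | hw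
      · rw [if_pos rfl, if_pos rfl]
        have r₁ := hq₃' c le_rfl
        have r₂ := hq₂' c le_rfl
        rw [← r₁, ← r₂]
        refine ⟨fun h => if_pos h, fun h => if_neg h, fun h => if_pos ⟨h.1, by omega⟩,
          fun h => if_neg (by omega)⟩
      · rw [if_neg (by omega), if_neg (by omega)]
        exact h₃.2 w hw hwn
  · have hI : σ₁.v rI = n := by omega
    refine ⟨hI, le_rfl, fun w hw => ?_, fun w h₁ h₂ => by omega⟩
    rw [hq₁.2 w (by omega)]
    refine ⟨by omega, fun k hk => ⟨fun h => by omega, ?_⟩⟩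
    rintro ⟨y, y₁, y₂, y₃, y₄, y₅⟩
    omega
  · simp; omega
  · simp [hB]; omega
  · simp; omega
  · rintro σ' - ⟨-, -, -, h⟩ w hw
    have := h w (by omega) hw
    simp only [Reaches, if_neg hc.ne', ht] at this
    exact this
end
end

section
variable {W cap n : ℕ}

/-! ### Windows of sibling forests -/

section
variable {lab par E : ℕ → ℕ} {F : List OTree} {t : OTree}

/-- The windows with the numbers in `[f, g)` represent the forest `F`: it is included in the nodes
of `[a, b)` exactly if there is a window `j` with `a < L j` and `R j ≤ b`. Thus the window begins at
the node `L j - 1` and ends before the node `R j`; windows with `L j = 0` or `R j = n + 1` are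
void. -/
def Windows (n : ℕ) (lab E : ℕ → ℕ) (F : List OTree) (f g : ℕ) (L R : ℕ → ℕ) : Prop :=
  (∀ j, f ≤ j → j < g → L j ≤ n ∧ R j ≤ n + 1) ∧
  ∀ a b, b ≤ n → (Fits lab E F a b ↔ ∃ j, f ≤ j ∧ j < g ∧ a < L j ∧ R j ≤ b)

theorem Windows.congr {f g : ℕ} {L R L' R' : ℕ → ℕ} (h : Windows n lab E F f g L R)
    (he : ∀ j, f ≤ j → j < g → L' j = L j ∧ R' j = R j) : Windows n lab E F f g L' R' := by
  refine ⟨fun j h₁ h₂ => by have := h.1 j h₁ h₂; have := he j h₁ h₂; omega, fun a b hb => ?_⟩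
  rw [h.2 a b hb]
  refine exists_congr fun j => and_congr_right fun h₁ => and_congr_right fun h₂ => ?_
  rw [(he j h₁ h₂).1, (he j h₁ h₂).2]

/-- A tree is added on the right if the end `R j` of each window is replaced by the smallest end of
a place for the tree behind `R j`. -/
theorem Windows.append (hE : ∀ w, w < E w) {f g : ℕ} {L R R' : ℕ → ℕ}
    (h : Windows n lab E F f g L R)
    (hR : ∀ j, f ≤ j → j < g → R' j ≤ n + 1 ∧ ∀ b, b ≤ n → (R' j ≤ b ↔ Fits lab E [t] (R j) b)) :
    Windows n lab E (F ++ [t]) f g L R' := by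
  refine ⟨fun j h₁ h₂ => ⟨(h.1 j h₁ h₂).1, (hR j h₁ h₂).1⟩, fun a b hb => ?_⟩
  rw [fits_append hE]
  constructor
  · rintro ⟨c, hF, ht⟩
    have hcb := ht.size_le hE
    obtain ⟨j, h₁, h₂, h₃, h₄⟩ := (h.2 a c (by omega)).1 hF
    exact ⟨j, h₁, h₂, h₃, ((hR j h₁ h₂).2 b hb).2 (fits_mono ht h₄ le_rfl)⟩
  · rintro ⟨j, h₁, h₂, h₃, h₄⟩
    have ht := ((hR j h₁ h₂).2 b hb).1 h₄
    have hcb := ht.size_le hE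
    exact ⟨R j, (h.2 a _ (by omega)).2 ⟨j, h₁, h₂, h₃, le_rfl⟩, ht⟩

/-- A tree is added on the left if the begin of each window is moved to the last deepest node for
the tree that ends before the window. -/
theorem Windows.cons (hE : ∀ w, w < E w) {f g : ℕ} {L L' R : ℕ → ℕ}
    (h : Windows n lab E F f g L R)
    (hL : ∀ j, f ≤ j → j < g → L' j ≤ n ∧
      ∀ a, a < L' j ↔ ∃ y, y < n ∧ MinAt lab E t y ∧ E y + 1 ≤ L j ∧ a ≤ y) :
    Windows n lab E (t :: F) f g L' R := by
  refine ⟨fun j h₁ h₂ => ⟨(hL j h₁ h₂).1, (h.1 j h₁ h₂).2⟩, fun a b hb => ?_⟩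
  rw [← List.singleton_append, fits_append hE]
  constructor
  · rintro ⟨c, ht, hF⟩
    have hcb := hF.size_le hE
    obtain ⟨j, h₁, h₂, h₃, h₄⟩ := (h.2 c b hb).1 hF
    obtain ⟨y, k₁, k₂, k₃⟩ := (fits_iff_minAt hE).1 ht
    have := hE y
    exact ⟨j, h₁, h₂, ((hL j h₁ h₂).2 a).2 ⟨y, by omega, k₃, by omega, k₁⟩, h₄⟩
  · rintro ⟨j, h₁, h₂, h₃, h₄⟩
    obtain ⟨y, k₁, k₂, k₃, k₄⟩ := ((hL j h₁ h₂).2 a).1 h₃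
    exact ⟨E y, (fits_iff_minAt hE).2 ⟨y, k₄, le_rfl, k₂⟩,
      (h.2 _ b hb).2 ⟨j, h₁, h₂, by omega, h₄⟩⟩

open scoped Classical in
open Finset in
/-- The new frame has as many windows as there are deepest nodes for `t`, which bounds its size. -/
theorem pushFrame_spec (hW : 128 * n ≤ W) (hcap : cap = 6 * n) (hT : IsTree n par E) {σ : State}
    (hn : σ.v rNT = n) (hend : ∀ i, i < n → σ.a aEndT i = E i)
    (hmk : ∀ i, i < n → (σ.a aMk i = 1 ↔ MinAt lab E t i)) {p s : ℕ} (hp : σ.v rP = p) (hpn : p < n)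
    (hs : σ.v rSP = s) (hsn : s ≤ 2 * n) :
    Within W cap pushFrame (16 * n) (fun σ' => ∃ e, e * t.size ≤ n ∧ σ'.v rSP = s + e ∧
      (∀ j, j < s → σ'.a aSL j = σ.a aSL j ∧ σ'.a aSE j = σ.a aSE j) ∧
      (∀ q, σ'.a aFrm q = if q = p then s else σ.a aFrm q) ∧
      Windows n lab E [t] s (s + e) (σ'.a aSL) (σ'.a aSE)) σ := by
  have hn0 := hT.pos
  have hcard := hT.card_minAt_mul_size_le (lab := lab) (t := t)
  have htp := size_pos t
  have hle : ∀ i, i ≤ n → #{w ∈ range i | MinAt lab E t w} ≤ n := by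
    intro i hi
    calc #{w ∈ range i | MinAt lab E t w} ≤ #{w ∈ range n | MinAt lab E t w} :=
          card_le_card (filter_subset_filter _ (range_mono hi))
      _ ≤ #{w ∈ range n | MinAt lab E t w} * t.size := Nat.le_mul_of_pos_right _ htp
      _ ≤ n := hcard
  have hsucc : ∀ i, #{w ∈ range (i + 1) | MinAt lab E t w} =
      #{w ∈ range i | MinAt lab E t w} + if MinAt lab E t i then 1 else 0 := by
    intro i
    rw [range_add_one, filter_insert]
    split_ifs
    · rw [card_insert_of_notMem (by simp)]
    · rfl
  unfold pushFrame
  refine ((((Within.loop_wp (m := n) (fun k σ' => σ'.v rI + k = n ∧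
    σ'.v rSP = s + #{w ∈ range (σ'.v rI) | MinAt lab E t w} ∧
    (∀ j, j < s → σ'.a aSL j = σ.a aSL j ∧ σ'.a aSE j = σ.a aSE j) ∧
    (∀ j, s ≤ j → j < σ'.v rSP → ∃ w, w < n ∧ MinAt lab E t w ∧ σ'.a aSL j = w + 1 ∧
      σ'.a aSE j = E w) ∧
    ∀ w, w < σ'.v rI → MinAt lab E t w → ∃ j, s ≤ j ∧ j < σ'.v rSP ∧ σ'.a aSL j = w + 1 ∧
      σ'.a aSE j = E w) ?_ ?_ ?_).mono le_rfl ?_).set_seq ?_).put_seq ?_ ?_ ?_).le_time ?_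
  · rintro σ' ha ⟨h₁, -⟩
    have hN' := ha.1 rNT (by decide)
    simp [hn] at hN'
    simp [hN']; omega
  · rintro k σ' ha ⟨h₁, h₂, h₃, h₄, h₅⟩
    have hN' := ha.1 rNT (by decide)
    have hM' := ha.2 aMk (by decide)
    have hE' := ha.2 aEndT (by decide)
    simp [hn] at hN' hM' hE'
    have hin : σ'.v rI < n := by omega
    have hm := hmk _ hin
    have he := hend _ hin
    have hc := hle _ hin.le
    have hc' := hsucc (σ'.v rI)
    have hee := hT.end_le _ hin
    rw [← hM'] at hm
    rw [← hE'] at he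
    simp [hN', hm, he]
    generalize σ'.v rI = i at *
    generalize σ'.v rSP = r at *
    refine ⟨by omega, by omega, fun hmin => ?_, fun hmin => ?_⟩
    · rw [if_pos hmin] at hc'
      and_intros <;> try omega
      · intro j hj
        rw [if_neg (by omega), if_neg (by omega)]
        exact h₃ j hj
      · intro j hj hjr
        rcases hjr.eq_or_lt with rfl | hjr
        · exact ⟨i, hin, hmin, by simp⟩
        · rw [if_neg (by omega), if_neg (by omega)]
          exact h₄ j hj hjr
      · intro w hw hwm
        rcases hw.eq_or_lt with rfl | hw
        · exact ⟨r, by omega, le_rfl, by simp⟩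
        · obtain ⟨j, l₁, l₂, l₃⟩ := h₅ w hw hwm
          exact ⟨j, l₁, l₂.le, by rwa [if_neg (by omega), if_neg (by omega)]⟩
    · rw [if_neg hmin] at hc'
      refine ⟨by omega, by omega, by omega, h₃, h₄, fun w hw hwm => ?_⟩
      rcases hw.eq_or_lt with rfl | hw
      · exact absurd hwm hmin
      · exact h₅ w hw hwm
  · simp [hs]
    intros; omega
  · rintro σ' ha ⟨h₁, h₂, h₃, h₄, h₅⟩
    have hI : σ'.v rI = n := by omega
    rw [hI] at h₂ h₅
    refine ⟨_, hcard, h₂, h₃, ?_, ?_⟩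
    · intro q
      rw [ha.2 aFrm (by decide)]
      simp [hp, hs]
    · rw [h₂] at h₄ h₅
      refine ⟨fun j h₁ h₂ => ?_, fun a b hb => ?_⟩
      · obtain ⟨w, k₁, k₂, k₃, k₄⟩ := h₄ j h₁ h₂
        have := hT.end_le w k₁
        omega
      · rw [fits_iff_minAt hT.lt_end]
        constructor
        · rintro ⟨w, k₁, k₂, k₃⟩
          have := hT.lt_end w
          obtain ⟨j, l₁, l₂, l₃, l₄⟩ := h₅ w (by omega) k₃
          exact ⟨j, l₁, l₂, by omega, by omega⟩
        · rintro ⟨j, l₁, l₂, l₃, l₄⟩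
          obtain ⟨w, k₁, k₂, k₃, k₄⟩ := h₄ j l₁ l₂
          exact ⟨w, by omega, by omega, k₂⟩
  · simp; omega
  · simp
  · simp
  · simp; omega
  · simp; omega

theorem extendRight_spec (hW : 128 * n ≤ W) (hcap : cap = 6 * n) (hT : IsTree n par E) {σ : State}
    (hn : σ.v rNT = n) (hend : ∀ i, i < n → σ.a aEndT i = E i)
    (hmk : ∀ i, i < n → (σ.a aMk i = 1 ↔ MinAt lab E t i)) {p f g : ℕ} (hp : σ.v rP = p)
    (hpn : p < n) (hf : σ.a aFrm p = f) (hfg : f ≤ g) (hg : σ.v rSP = g) (hgn : g ≤ 3 * n)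
    (hF : Windows n lab E F f g (σ.a aSL) (σ.a aSE)) :
    Within W cap extendRight (32 * n) (fun σ' => (∀ j, j < f → σ'.a aSE j = σ.a aSE j) ∧
      Windows n lab E (F ++ [t]) f g (σ'.a aSL) (σ'.a aSE)) σ := by
  have hn0 := hT.pos
  -- a place for `t` behind `i` begins at `i` or later
  have hstep : ∀ i b, Fits lab E [t] i b ↔
      Fits lab E [t] (i + 1) b ∨ MinAt lab E t i ∧ E i ≤ b := by
    intro i b
    rw [fits_iff_minAt hT.lt_end, fits_iff_minAt hT.lt_end]
    constructor
    · rintro ⟨w, h₁, h₂⟩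
      rcases h₁.eq_or_lt with rfl | h₁
      · exact .inr ⟨h₂.2, h₂.1⟩
      · exact .inl ⟨w, h₁, h₂⟩
    · rintro (⟨w, h₁, h₂⟩ | h)
      · exact ⟨w, by omega, h₂⟩
      · exact ⟨i, le_rfl, h.2, h.1⟩
  unfold extendRight
  refine ((((Within.loop_wp (m := n) (fun k σ' => σ'.v rI = k ∧ k ≤ n ∧
    ∀ i, k ≤ i → i ≤ n + 1 → σ'.a aBuf i ≤ n + 1 ∧
      ∀ b, b ≤ n → (σ'.a aBuf i ≤ b ↔ Fits lab E [t] i b)) ?_ ?_ ?_).seq fun σ₁ ha₁ hq₁ =>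
    ((Within.loop_wp (m := g - f) (fun k σ' => σ'.v rI + k = g ∧ f ≤ σ'.v rI ∧
      ∀ j, σ'.a aSE j = if f ≤ j ∧ j < σ'.v rI then σ₁.a aBuf (σ.a aSE j) else σ.a aSE j)
      ?_ ?_ ?_).set_seq ?_).mono le_rfl ?_).set_seq ?_).put_seq ?_ ?_ ?_).put_seq ?_ ?_ ?_ |>.mono
        ?_ fun _ _ h => h
  · rintro σ' ha ⟨h₁, -⟩
    simp [h₁]; omega
  · rintro k σ' ha ⟨h₁, h₂, h₃⟩
    have hM' := ha.2 aMk (by decide)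
    have hE' := ha.2 aEndT (by decide)
    simp [hn] at hM' hE'
    have hm := hmk k (by omega)
    have he := hend k (by omega)
    have hee := hT.end_le k (by omega)
    rw [← hM'] at hm
    rw [← hE'] at he
    obtain ⟨h₄, h₅⟩ := h₃ (k + 1) (by omega) (by omega)
    have key : ∀ x, x ≤ n + 1 → (∀ b, b ≤ n → (x ≤ b ↔ Fits lab E [t] k b)) →
        ∀ i, k ≤ i → i ≤ n + 1 → (if i = k then x else σ'.a aBuf i) ≤ n + 1 ∧
          ∀ b, b ≤ n → ((if i = k then x else σ'.a aBuf i) ≤ b ↔ Fits lab E [t] i b) := by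
      intro x hx hxb i hi hin
      split_ifs with hik
      · subst hik; exact ⟨hx, hxb⟩
      · exact h₃ i (by omega) hin
    simp [h₁, hm, he]
    refine ⟨by omega, by omega, by omega, by omega, fun hmin => ⟨by omega, fun hlt =>
      ⟨by omega, by omega, key _ (by omega) fun b hb => ?_⟩,
      fun hle => ⟨by omega, by omega, key _ h₄ fun b hb => ?_⟩⟩,
      fun hmin => ⟨by omega, by omega, key _ h₄ fun b hb => ?_⟩⟩
    · rw [hstep, ← h₅ b hb]
      exact ⟨fun h => .inr ⟨hmin, h⟩, fun h => by omega⟩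
    · rw [hstep, ← h₅ b hb]
      exact ⟨fun h => .inl h, fun h => by omega⟩
    · rw [hstep, ← h₅ b hb]
      exact ⟨fun h => .inl h, fun h => by tauto⟩
  · refine ⟨by simp [hn], le_rfl, fun i hi hin => ?_⟩
    have : (if i = n + 1 then n + 1 else if i = n then n + 1 else σ.a aBuf i) = n + 1 := by
      split_ifs <;> omega
    simp [hn, this]
    refine fun b hb => ⟨fun h => by omega, fun hf => ?_⟩
    have := hf.size_le hT.lt_end
    have := size_pos t
    simp at *
    omega
  · rintro σ' ha ⟨h₁, h₂, h₃⟩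
    have hG' := (ha.1 rSP (by decide)).trans (ha₁.1 rSP (by decide))
    simp [hg] at hG'
    simp [hG']; omega
  · rintro k σ' ha ⟨h₁, h₂, h₃⟩
    have hG' := (ha.1 rSP (by decide)).trans (ha₁.1 rSP (by decide))
    have hB' := ha.2 aBuf (by decide)
    simp [hg] at hG' hB'
    have he := h₃ (σ'.v rI)
    rw [if_neg (by omega)] at he
    have hb := (hF.1 (σ'.v rI) h₂ (by omega)).2
    simp [hG', hB', he]
    generalize σ'.v rI = i at *
    and_intros <;> try omega
    intro j
    split_ifs with c₁ c₂ c₃ <;> try omega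
    · subst c₁; rfl
    · rw [h₃, if_pos (by omega)]
    · rw [h₃, if_neg (by omega)]
  · have e₁ := ha₁.2 aSE (by decide)
    have e₂ := ha₁.2 aFrm (by decide)
    have e₃ := ha₁.1 rP (by decide)
    simp [hp] at e₁ e₂ e₃
    simp [e₁, e₂, e₃, hf]
    omega
  · have e₃ := ha₁.1 rP (by decide)
    simp [hp] at e₃
    simp [e₃]; omega
  · rintro σ' ha ⟨h₁, h₂, h₃⟩
    have e₁ : σ'.a aSL = σ.a aSL := by
      rw [ha.2 aSL (by decide), ha₁.2 aSL (by decide)]; simp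
    refine ⟨fun j hj => by rw [h₃, if_neg (by omega)], ?_⟩
    rw [e₁]
    refine hF.append hT.lt_end fun j h₁ h₂ => ?_
    rw [h₃, if_pos (by omega)]
    exact hq₁.2.2 _ (Nat.zero_le _) (hF.1 j h₁ h₂).2
  · simp
  · simp; omega
  · simp [hn]; omega
  · simp [hn]; omega
  · simp
  · simp [hn]; omega
  · simp [hn]; omega
  · simp; omega

theorem extendLeft_spec (hW : 128 * n ≤ W) (hcap : cap = 6 * n) (hT : IsTree n par E) {σ : State}
    (hn : σ.v rNT = n) (hend : ∀ i, i < n → σ.a aEndT i = E i)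
    (hmk : ∀ i, i < n → (σ.a aMk i = 1 ↔ MinAt lab E t i)) {p f g : ℕ} (hp : σ.v rP = p)
    (hpn : p < n) (hf : σ.a aFrm p = f) (hfg : f ≤ g) (hg : σ.v rSP = g) (hgn : g ≤ 3 * n)
    (hF : Windows n lab E F f g (σ.a aSL) (σ.a aSE)) :
    Within W cap extendLeft (64 * n) (fun σ' => (∀ j, j < f → σ'.a aSL j = σ.a aSL j) ∧
      Windows n lab E (t :: F) f g (σ'.a aSL) (σ'.a aSE)) σ := by
  have hn0 := hT.pos
  unfold extendLeft
  refine Within.le_time (T := 16 * n + ((n * 4 + 1 + ((((n + 1) * 4 + 1) +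
    ((g - f) * 3 + 1 + 1)) + 1)) + 1)) ?_ (by omega)
  refine (fillBuf_spec hW hcap hn0 hn (e := 0) (d := 0) fun σ' _ => by simp; omega).seq
    fun σ₁ ha₁ hq₁ => ?_
  have hv₁ : ∀ x, x ≠ rI → σ₁.v x = σ.v x := fun x hx => ha₁.1 x (by simp [Cmd.vars, fillBuf, hx])
  have hr₁ : ∀ k, k ≠ aBuf → σ₁.a k = σ.a k := fun x hx => ha₁.2 x (by simp [Cmd.arrs, fillBuf, hx])
  refine Within.set_seq (by simp; omega) ?_
  refine Within.seq (Within.loop_wp (m := n) (fun k σ' => σ'.v rI + k = n ∧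
    ∀ i, i ≤ n + 1 → σ'.a aBuf i ≤ n ∧ ∀ a, a < σ'.a aBuf i ↔
      ∃ y, y < σ'.v rI ∧ MinAt lab E t y ∧ E y + 1 = i ∧ a ≤ y) ?_ ?_ ?_) fun σ₂ ha₂ hq₂ => ?_
  · rintro σ' ha ⟨h₁, -⟩
    have hN' := ha.1 rNT (by decide)
    simp [hv₁, hn] at hN'
    simp [hN']; omega
  · rintro k σ' ha ⟨h₁, h₂⟩
    have hN' := ha.1 rNT (by decide)
    have hM' := ha.2 aMk (by decide)
    have hE' := ha.2 aEndT (by decide)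
    simp [hv₁, hr₁, hn] at hN' hM' hE'
    have hin : σ'.v rI < n := by omega
    have hm := hmk _ hin
    have he := hend _ hin
    have hee := hT.end_le _ hin
    rw [← hM'] at hm
    rw [← hE'] at he
    simp [hN', hm, he]
    generalize σ'.v rI = i at *
    refine ⟨by omega, by omega, fun hmin => ?_, fun hmin => ?_⟩
    · and_intros <;> try omega
      intro j hj
      split_ifs with hjE
      · refine ⟨by omega, fun a => ⟨fun h => ⟨i, le_rfl, hmin, hjE.symm, by omega⟩, ?_⟩⟩
        rintro ⟨y, y₁, -, -, y₂⟩
        omega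
      · refine ⟨(h₂ j hj).1, fun a => ?_⟩
        rw [(h₂ j hj).2]
        constructor
        · rintro ⟨y, y₁, y₂⟩
          exact ⟨y, y₁.le, y₂⟩
        · rintro ⟨y, y₁, y₂, y₃, y₄⟩
          rcases y₁.eq_or_lt with rfl | y₁
          · exact absurd y₃.symm hjE
          · exact ⟨y, y₁, y₂, y₃, y₄⟩
    · refine ⟨by omega, by omega, fun j hj => ⟨(h₂ j hj).1, fun a => ?_⟩⟩
      rw [(h₂ j hj).2]
      constructor
      · rintro ⟨y, y₁, y₂⟩
        exact ⟨y, y₁.le, y₂⟩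
      · rintro ⟨y, y₁, y₂, y₃, y₄⟩
        rcases y₁.eq_or_lt with rfl | y₁
        · exact absurd y₂ hmin
        · exact ⟨y, y₁, y₂, y₃, y₄⟩
  · refine ⟨by simp, fun i hi => ?_⟩
    simp [hq₁ i (by omega)]
  have hv₂ : ∀ x, x ≠ rI → σ₂.v x = σ.v x := fun x hx => by
    rw [ha₂.1 x (by simp [Cmd.vars, hx])]; simp [hx, hv₁]
  have hr₂ : ∀ k, k ≠ aBuf → σ₂.a k = σ.a k := fun x hx => by
    rw [ha₂.2 x (by simp [Cmd.arrs, hx])]; simp [hx, hr₁]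
  refine Within.set_seq (by simp; omega) ?_
  refine Within.seq (Within.loop_wp (m := n + 1) (fun k σ' => σ'.v rI + k = n + 1 ∧
    ∀ i, i ≤ n + 1 → σ'.a aBuf i ≤ n ∧ ∀ a, a < σ'.a aBuf i ↔
      ∃ y, y < n ∧ MinAt lab E t y ∧ (if i ≤ σ'.v rI then E y + 1 ≤ i else E y + 1 = i) ∧ a ≤ y)
      ?_ ?_ ?_) fun σ₃ ha₃ hq₃ => ?_
  · rintro σ' ha ⟨h₁, -⟩
    have hN' := ha.1 rNT (by decide)
    simp [hv₂, hn] at hN'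
    simp [hN']; omega
  · rintro k σ' ha ⟨h₁, h₂⟩
    have hN' := ha.1 rNT (by decide)
    simp [hv₂, hn] at hN'
    simp [hN']
    generalize σ'.v rI = i at *
    obtain ⟨b₁, c₁⟩ := h₂ i (by omega)
    obtain ⟨b₂, c₂⟩ := h₂ (i + 1) (by omega)
    simp only [le_refl, if_true] at c₁
    simp only [show ¬ (i + 1 ≤ i) by omega, if_false] at c₂
    have key : ∀ x, x = max (σ'.a aBuf i) (σ'.a aBuf (i + 1)) → ∀ j, j ≤ n + 1 →
        (if j = i + 1 then x else σ'.a aBuf j) ≤ n ∧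
        ∀ a, (a < if j = i + 1 then x else σ'.a aBuf j) ↔ ∃ y, y < n ∧ MinAt lab E t y ∧
          (if j ≤ i + 1 then E y + 1 ≤ j else E y + 1 = j) ∧ a ≤ y := by
      rintro x rfl j hj
      by_cases hji : j = i + 1
      · subst hji
        simp only [if_true, le_refl]
        refine ⟨by omega, fun a => ?_⟩
        rw [lt_max_iff, c₁, c₂]
        constructor
        · rintro (⟨y, y₁, y₂, y₃, y₄⟩ | ⟨y, y₁, y₂, y₃, y₄⟩)
          · exact ⟨y, y₁, y₂, by omega, y₄⟩
          · exact ⟨y, y₁, y₂, by omega, y₄⟩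
        · rintro ⟨y, y₁, y₂, y₃, y₄⟩
          rcases y₃.eq_or_lt with y₃ | y₃
          · exact .inr ⟨y, y₁, y₂, y₃, y₄⟩
          · exact .inl ⟨y, y₁, y₂, by omega, y₄⟩
      · simp only [if_neg hji]
        refine ⟨(h₂ j hj).1, fun a => ?_⟩
        rw [(h₂ j hj).2]
        have : j ≤ i ↔ j ≤ i + 1 := by omega
        simp only [this]
    simp at key
    and_intros <;> try omega
    · exact fun h => ⟨by omega, by omega, by omega, by rwa [max_eq_left h.le] at key⟩
    · refine fun h => ⟨by omega, by omega, fun j hj => ?_⟩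
      have := key j hj
      rw [max_eq_right h] at this
      rwa [show (if j = i + 1 then σ'.a aBuf (i + 1) else σ'.a aBuf j) = σ'.a aBuf j by
        split_ifs with hji <;> simp [hji]] at this
  · refine ⟨by simp, fun i hi => ?_⟩
    simp
    refine ⟨(hq₂.2 i hi).1, fun a => ?_⟩
    rw [(hq₂.2 i hi).2, show σ₂.v rI = n by omega]
    have : ∀ y, (if i = 0 then E y < i else E y + 1 = i) ↔ E y + 1 = i := fun y => by
      split_ifs <;> omega
    simp only [this]
  have hv₃ : ∀ x, x ≠ rI → σ₃.v x = σ.v x := fun x hx => by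
    rw [ha₃.1 x (by simp [Cmd.vars, hx])]; simp [hx, hv₂]
  have hr₃ : ∀ k, k ≠ aBuf → σ₃.a k = σ.a k := fun x hx => by
    rw [ha₃.2 x (by simp [Cmd.arrs, hx])]; simp [hx, hr₂]
  refine Within.set_seq (by simp [hv₃, hp]; omega) ?_
  refine (Within.loop_wp (m := g - f) (fun k σ' => σ'.v rI + k = g ∧ f ≤ σ'.v rI ∧
      ∀ j, σ'.a aSL j = if f ≤ j ∧ j < σ'.v rI then σ₃.a aBuf (σ.a aSL j) else σ.a aSL j)
      ?_ ?_ ?_).mono le_rfl ?_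
  · rintro σ' ha ⟨h₁, h₂, h₃⟩
    have hG' := ha.1 rSP (by decide)
    simp [hv₃, hg] at hG'
    simp [hG']; omega
  · rintro k σ' ha ⟨h₁, h₂, h₃⟩
    have hG' := ha.1 rSP (by decide)
    have hB' := ha.2 aBuf (by decide)
    simp [hv₃, hg] at hG' hB'
    have he := h₃ (σ'.v rI)
    rw [if_neg (by omega)] at he
    have hb := (hF.1 (σ'.v rI) h₂ (by omega)).1
    simp [hG', hB', he]
    generalize σ'.v rI = i at *
    and_intros <;> try omega
    intro j
    split_ifs with c₁ c₂ c₃ <;> try omega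
    · subst c₁; rfl
    · rw [h₃, if_pos (by omega)]
    · rw [h₃, if_neg (by omega)]
  · simp [hv₃, hr₃, hp, hf]
    omega
  · rintro σ' ha ⟨h₁, h₂, h₃⟩
    have e₁ : σ'.a aSE = σ.a aSE := by
      rw [ha.2 aSE (by decide)]; simp [hr₃]
    refine ⟨fun j hj => by rw [h₃, if_neg (by omega)], ?_⟩
    rw [e₁]
    refine hF.cons hT.lt_end fun j h₁ h₂ => ?_
    have hj := (hF.1 j h₁ h₂).1
    rw [h₃, if_pos (by omega)]
    obtain ⟨k₁, k₂⟩ := hq₃.2 (σ.a aSL j) (by omega)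
    simp only [show σ.a aSL j ≤ σ₃.v rI by omega, if_true] at k₂
    exact ⟨k₁, k₂⟩

/-- The forest is included below node `i` if a window with `i + 1 < L j` ends within the subtree of
`i`; the smallest end of the windows with `i + 2 ≤ L j` decides. -/
theorem windowEnds_spec (hW : 128 * n ≤ W) (hcap : cap = 6 * n) (hT : IsTree n par E) {σ : State}
    (hn : σ.v rNT = n) {p f g : ℕ} (hp : σ.v rP = p)
    (hpn : p < n) (hf : σ.a aFrm p = f) (hfg : f ≤ g) (hg : σ.v rSP = g) (hgn : g ≤ 3 * n)
    (hF : Windows n lab E F f g (σ.a aSL) (σ.a aSE)) :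
    Within W cap windowEnds (64 * n) (fun σ' =>
      ∀ i, i < n → (σ'.a aBuf (i + 2) ≤ E i ↔ Fits lab E F (i + 1) (E i))) σ := by
  have hn0 := hT.pos
  unfold windowEnds
  refine Within.le_time (T := 16 * n + ((g - f) * 4 + 1 + (((n + 1) * 4 + 1) + 1) + 1)) ?_
    (by omega)
  refine (fillBuf_spec hW hcap hn0 hn (e := rNT + 1) (d := n + 1) fun σ' h => by
    simp [h]; omega).seq fun σ₁ ha₁ hq₁ => ?_
  have hv₁ : ∀ x, x ≠ rI → σ₁.v x = σ.v x := fun x hx => ha₁.1 x (by simp [Cmd.vars, fillBuf, hx])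
  have hr₁ : ∀ k, k ≠ aBuf → σ₁.a k = σ.a k := fun x hx => ha₁.2 x (by simp [Cmd.arrs, fillBuf, hx])
  refine Within.set_seq (by simp [hv₁, hp]; omega) ?_
  refine Within.seq (Within.loop_wp (m := g - f) (fun k σ' => σ'.v rI + k = g ∧ f ≤ σ'.v rI ∧
    ∀ i, i ≤ n + 1 → ∀ b, b ≤ n → (σ'.a aBuf i ≤ b ↔
      ∃ j, f ≤ j ∧ j < σ'.v rI ∧ σ.a aSL j = i ∧ σ.a aSE j ≤ b)) ?_ ?_ ?_) fun σ₂ ha₂ hq₂ => ?_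
  · rintro σ' ha ⟨h₁, h₂, h₃⟩
    have hG' := ha.1 rSP (by decide)
    simp [hv₁, hg] at hG'
    simp [hG']; omega
  · rintro k σ' ha ⟨h₁, h₂, h₃⟩
    have hG' := ha.1 rSP (by decide)
    have hL' := ha.2 aSL (by decide)
    have hR' := ha.2 aSE (by decide)
    simp [hv₁, hr₁, hg] at hG' hL' hR'
    have hb := (hF.1 (σ'.v rI) h₂ (by omega)).1
    simp [hG', hL', hR']
    generalize σ'.v rI = i at *
    have key : ∀ x, x = min (σ'.a aBuf (σ.a aSL i)) (σ.a aSE i) → ∀ l, l ≤ n + 1 → ∀ b, b ≤ n →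
        ((if l = σ.a aSL i then x else σ'.a aBuf l) ≤ b ↔
          ∃ j, f ≤ j ∧ j ≤ i ∧ σ.a aSL j = l ∧ σ.a aSE j ≤ b) := by
      rintro x rfl l hl b hb
      have h := h₃ l hl b hb
      split_ifs with hli
      · rw [min_le_iff, ← hli, h]
        constructor
        · rintro (⟨j, j₁, j₂, j₃⟩ | h)
          · exact ⟨j, j₁, j₂.le, j₃⟩
          · exact ⟨i, h₂, le_rfl, hli.symm, h⟩
        · rintro ⟨j, j₁, j₂, j₃, j₄⟩
          rcases j₂.eq_or_lt with rfl | j₂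
          · exact .inr j₄
          · exact .inl ⟨j, j₁, j₂, j₃, j₄⟩
      · rw [h]
        constructor
        · rintro ⟨j, j₁, j₂, j₃⟩
          exact ⟨j, j₁, j₂.le, j₃⟩
        · rintro ⟨j, j₁, j₂, j₃, j₄⟩
          rcases j₂.eq_or_lt with rfl | j₂
          · exact absurd j₃.symm hli
          · exact ⟨j, j₁, j₂, j₃, j₄⟩
    simp at key
    and_intros <;> try omega
    · exact fun h => ⟨by omega, by omega, by omega, by omega, by rwa [min_eq_right h.le] at key⟩
    · refine fun h => ⟨by omega, by omega, by omega, fun j hj b hb => ?_⟩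
      have := key j hj b hb
      rw [min_eq_left h] at this
      rwa [show (if j = σ.a aSL i then σ'.a aBuf (σ.a aSL i) else σ'.a aBuf j) = σ'.a aBuf j by
        split_ifs with hji <;> simp [hji]] at this
  · simp [hv₁, hr₁, hp, hf]
    refine ⟨by omega, fun i hi b hb => ?_⟩
    rw [hq₁ i (by omega)]
    constructor
    · omega
    · rintro ⟨j, _, _, _⟩
      omega
  have hv₂ : ∀ x, x ≠ rI → σ₂.v x = σ.v x := fun x hx => by
    rw [ha₂.1 x (by simp [Cmd.vars, hx])]; simp [hx, hv₁]
  refine Within.set_seq (by simp [hv₂, hn]; omega) ?_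
  refine (Within.loop_wp (m := n + 1) (fun k σ' => σ'.v rI = k ∧ k ≤ n + 1 ∧
    ∀ i, i ≤ n + 1 → ∀ b, b ≤ n → (σ'.a aBuf i ≤ b ↔
      ∃ j, f ≤ j ∧ j < g ∧ (if k ≤ i then i ≤ σ.a aSL j else σ.a aSL j = i) ∧ σ.a aSE j ≤ b))
      ?_ ?_ ?_).mono le_rfl ?_
  · rintro σ' ha ⟨h₁, -⟩
    simp [h₁]; omega
  · rintro k σ' ha ⟨h₁, h₂, h₃⟩
    simp [h₁]
    have key : ∀ x, x = min (σ'.a aBuf k) (σ'.a aBuf (k + 1)) → ∀ l, l ≤ n + 1 → ∀ b, b ≤ n →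
        ((if l = k then x else σ'.a aBuf l) ≤ b ↔
          ∃ j, f ≤ j ∧ j < g ∧ (if k ≤ l then l ≤ σ.a aSL j else σ.a aSL j = l) ∧
            σ.a aSE j ≤ b) := by
      rintro x rfl l hl b hb
      by_cases hlk : l = k
      · subst hlk
        have e₁ := h₃ l hl b hb
        have e₂ := h₃ (l + 1) (by omega) b hb
        simp only [show ¬ (l + 1 ≤ l) by omega, if_false] at e₁
        simp only [le_refl, if_true] at e₂
        simp only [le_refl, if_true]
        rw [min_le_iff, e₁, e₂]
        constructor
        · rintro (⟨j, j₁, j₂, j₃, j₄⟩ | ⟨j, j₁, j₂, j₃, j₄⟩)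
          · exact ⟨j, j₁, j₂, by omega, j₄⟩
          · exact ⟨j, j₁, j₂, by omega, j₄⟩
        · rintro ⟨j, j₁, j₂, j₃, j₄⟩
          rcases j₃.eq_or_lt with j₃ | j₃
          · exact .inl ⟨j, j₁, j₂, j₃.symm, j₄⟩
          · exact .inr ⟨j, j₁, j₂, j₃, j₄⟩
      · rw [if_neg hlk, h₃ l hl b hb]
        have : k + 1 ≤ l ↔ k ≤ l := by omega
        simp only [this]
    simp at key
    and_intros <;> try omega
    · exact fun h => ⟨by omega, by omega, by rwa [min_eq_right h.le] at key⟩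
    · refine fun h => ⟨by omega, fun j hj b hb => ?_⟩
      have := key j hj b hb
      rw [min_eq_left h] at this
      rwa [show (if j = k then σ'.a aBuf k else σ'.a aBuf j) = σ'.a aBuf j by
        split_ifs with hji <;> simp [hji]] at this
  · refine ⟨by simp [hv₂, hn], le_rfl, fun i hi b hb => ?_⟩
    simp
    rw [hq₂.2.2 i hi b hb, show σ₂.v rI = g by omega]
    refine exists_congr fun j => and_congr_right fun h₁ => and_congr_right fun h₂ =>
      and_congr_left fun _ => ?_
    have := (hF.1 j h₁ h₂).1
    split_ifs <;> omega
  · rintro σ' ha ⟨h₁, h₂, h₃⟩ i hi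
    have := hT.end_le i hi
    rw [h₃ (i + 2) (by omega) _ this, hF.2 _ _ this]
    simp only [show 0 ≤ i + 2 by omega, if_true]
    rfl
end
end

/-! ### The work on a subtree of the pattern -/

/-- The tables of the pattern and the text, as they are after the preparation. -/
structure Tables (P T : OTree) (σ : State) : Prop where
  sizeP : σ.v rNP = P.size
  sizeT : σ.v rNT = T.size
  labP : ∀ i, i < P.size → σ.a aLabP i = labOf P i
  parP : ∀ i, i < P.size → σ.a aParP i = parOf P i
  endP : ∀ i, i < P.size → σ.a aEndP i = endOf P i
  endP_size : σ.a aEndP P.size = 0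
  heavy : ∀ x, 0 < x → x < P.size → parOf P (σ.a aHvy (parOf P x)) = parOf P x ∧
    0 < σ.a aHvy (parOf P x) ∧ σ.a aHvy (parOf P x) < P.size ∧
    endOf P x + σ.a aHvy (parOf P x) ≤ endOf P (σ.a aHvy (parOf P x)) + x
  prev : ∀ x, 0 < x → x < P.size → endOf P x < endOf P (parOf P x) → σ.a aPrv (endOf P x) = x
  labT : ∀ i, i < T.size → σ.a aLabT i = labOf T i
  parT : ∀ i, i < T.size → σ.a aParT i = parOf T i
  endT : ∀ i, i < T.size → σ.a aEndT i = endOf T i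

theorem Tables.congr {P T : OTree} {σ σ' : State} (h : Tables P T σ)
    (hv : ∀ x ∈ [rNP, rNT], σ'.v x = σ.v x)
    (ha : ∀ k ∈ [aLabP, aParP, aEndP, aHvy, aPrv, aLabT, aParT, aEndT], σ'.a k = σ.a k) :
    Tables P T σ' := by
  simp only [List.mem_cons, List.not_mem_nil, or_false, forall_eq_or_imp, forall_eq] at hv ha
  obtain ⟨v₁, v₂⟩ := hv
  obtain ⟨a₁, a₂, a₃, a₄, a₅, a₆, a₇, a₈⟩ := ha
  constructor
  · rw [v₁]; exact h.sizeP
  · rw [v₂]; exact h.sizeT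
  · rw [a₁]; exact h.labP
  · rw [a₂]; exact h.parP
  · rw [a₃]; exact h.endP
  · rw [a₃]; exact h.endP_size
  · rw [a₄]; exact h.heavy
  · rw [a₅]; exact h.prev
  · rw [a₆]; exact h.labT
  · rw [a₇]; exact h.parT
  · rw [a₈]; exact h.endT

theorem Tables.agree {P T : OTree} {c : Cmd} {σ σ' : State} (h : Tables P T σ) (ha : Agree c σ σ')
    (hv : ∀ x ∈ [rNP, rNT], x ∉ c.vars)
    (hk : ∀ k ∈ [aLabP, aParP, aEndP, aHvy, aPrv, aLabT, aParT, aEndT], k ∉ c.arrs) :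
    Tables P T σ' :=
  h.congr (fun x hx => ha.1 x (hv x hx)) fun k hx => ha.2 k (hk k hx)

theorem Tables.round {P T : OTree} {σ σ' : State} (h : Tables P T σ) (ha : Agree round σ σ') :
    Tables P T σ' := h.agree ha (by decide) (by decide)

/-- The marks tell which subtrees of the text include `t`, and which of them are minimal. -/
def Marked (T t : OTree) (σ : State) : Prop :=
  ∀ w, w < T.size →
    (Fits (labOf T) (endOf T) [t] w (endOf T w) → σ.a aInc w = 1) ∧
    (¬ Fits (labOf T) (endOf T) [t] w (endOf T w) → σ.a aInc w = 0) ∧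
    (MinAt (labOf T) (endOf T) t w → σ.a aMk w = 1) ∧
    (¬ MinAt (labOf T) (endOf T) t w → σ.a aMk w = 0)

theorem Marked.iff {T t : OTree} {σ : State} (h : Marked T t σ) (i : ℕ) (hi : i < T.size) :
    σ.a aMk i = 1 ↔ MinAt (labOf T) (endOf T) t i := by
  obtain ⟨-, -, h₁, h₂⟩ := h i hi
  by_cases hm : MinAt (labOf T) (endOf T) t i
  · simp [hm, h₁ hm]
  · simp [hm, h₂ hm]

/-- From `σ` to `σ'` nothing has changed that belongs to pattern nodes outside the subtree `t` at
node `v`: neither the windows on the stack below height `s` nor the entries for these nodes. -/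
structure Kept (t : OTree) (v s : ℕ) (σ σ' : State) : Prop where
  windows : ∀ j, j < s → σ'.a aSL j = σ.a aSL j ∧ σ'.a aSE j = σ.a aSE j
  frames : ∀ q, ¬ (v ≤ q ∧ q < v + t.size) → σ'.a aFrm q = σ.a aFrm q ∧ σ'.a aTop q = σ.a aTop q

/-- In `σ'` the work on the pattern subtree `t` at node `v`, begun in `σ`, is done. -/
structure Done (T t : OTree) (v : ℕ) (σ σ' : State) : Prop where
  mode : σ'.v rMode = 1
  node : σ'.v rV = v
  height : σ'.v rSP = σ.v rSP
  kept : Kept t v (σ.v rSP) σ σ'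
  marked : Marked T t σ'

section
variable {W cap : ℕ} {P T : OTree} {t : OTree} {v c p : ℕ} {F : List OTree}

theorem Stands.add_le (h : Stands P F v) (hF : 0 < fsize F) : v + fsize F ≤ P.size := by
  have := h (fsize F - 1) (by omega)
  rw [List.getElem?_eq_getElem (l := preorderForest F)
    (by unfold fsize; unfold fsize at hF; omega)] at this
  have := (List.getElem?_eq_some_iff.1 this).1
  unfold OTree.size
  omega

theorem descend_chain (hW : 128 * T.size ≤ W) (hcap : cap = 6 * T.size) (hPT : P.size ≤ T.size)
    (hc : IsChain t c F) (hs : Stands P [t] v) {σ : State} (hσ : Tables P T σ) (hv : σ.v rV = v) :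
    Within W cap descend (4 * T.size) (fun σ' => σ'.v rB + 1 = v + c) σ := by
  have hcp := hc.pos
  have hsize := hc.size_eq
  have hend := hc.endOf_eq hs
  have hend₀ := hend 0 hcp
  rw [Nat.add_zero] at hend₀
  have hle := hs.add_le (by simp; omega)
  simp only [fsize_cons, fsize_nil] at hle
  refine descend_spec hW hcap hPT hσ.endP hσ.endP_size hv hcp (by omega)
    (fun i hi => by rw [hend i hi, hend₀]) (fun hlt heq => ?_) (lt_endOf P)
  have hF := hc.stands hs
  have hl := hc.length_ne
  rcases F with _ | ⟨u, _ | ⟨u', G⟩⟩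
  · have := lt_endOf P (v + c)
    simp at hsize; omega
  · simp at hl
  · rw [hF.endOf_eq, hend₀, hsize] at heq
    have := size_pos u'
    simp at heq; omega

theorem start_leaf (hW : 128 * T.size ≤ W) (hcap : cap = 6 * T.size) (hPT : P.size ≤ T.size)
    (hc : IsChain t c []) (hs : Stands P [t] v) {σ : State} (hσ : Tables P T σ) (hv : σ.v rV = v)
    (hmode : σ.v rMode = 0) :
    Within W cap round (100 * T.size) (Done T t v σ) σ := by
  have hT := isTree T
  have hn0 := hT.pos
  have hcp := hc.pos
  have hsize := hc.size_eq
  simp only [fsize_nil, Nat.add_zero] at hsize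
  have hend := hc.endOf_eq hs
  have hle := hs.add_le (by simp; omega)
  simp only [fsize_cons, fsize_nil, hsize] at hle
  unfold round start
  refine Within.le_time (T := 4 * T.size + (16 * T.size + (64 * T.size + 1) + 1) + 1)
    (.iteTrue (by simp; omega) (by simpa using hmode) ?_) (by omega)
  refine (descend_chain hW hcap hPT hc hs hσ hv).seq fun σ₁ ha₁ hb₁ => ?_
  have g₁ := hσ.agree ha₁ (by decide) (by decide)
  have hb : σ₁.v rB = v + (c - 1) := by omega
  have he := g₁.endP (σ₁.v rB) (by omega)
  refine .iteTrue (by simp; omega) ?_ ?_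
  · simp only [Cond.Holds, Expr.eval_get, Expr.eval_var, Expr.eval_add, Expr.eval_ofNat]
    rw [he, hb, hend _ (by omega)]
    omega
  refine (fillBuf_spec hW hcap hn0 g₁.sizeT (e := 0) (d := 0) fun σ' _ => by simp; omega).seq
    fun σ₂ ha₂ hb₂ => ?_
  have g₂ := g₁.agree ha₂ (by decide) (by decide)
  have hV : σ₂.v rV = v := by rw [ha₂.1 rV (by decide), ha₁.1 rV (by decide), hv]
  have hB : σ₂.v rB = v + c - 1 := by rw [ha₂.1 rB (by decide)]; omega
  refine (levels_spec hW hcap hT hPT g₂.sizeT hB (by omega) (by omega) hcp g₂.labT g₂.parT g₂.endT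
    g₂.labP (F := []) (fun i hi => ?_) (hc.chainForest_eq hs)).seq fun σ₃ ha₃ hb₃ => ?_
  · rw [hb₂ _ (by omega)]
    have := hT.lt_end i
    simp [Fits]; omega
  · refine (Cmd.within_of_wp (c := .set rMode 1) ?_).le_time (by simp)
    have k₁ : ∀ k, k ∉ [aBuf, aAcc, aInc, aMk] → σ₃.a k = σ.a k := fun k hk => by
      rw [ha₃.2 k (by revert hk; cases k <;> decide), ha₂.2 k (by revert hk; cases k <;> decide),
        ha₁.2 k (by revert hk; cases k <;> decide)]
    have hv₃ : ∀ x, x ∈ [rSP, rV] → σ₃.v x = σ.v x := fun k hk => by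
      rw [ha₃.1 k (by revert hk; cases k <;> decide), ha₂.1 k (by revert hk; cases k <;> decide),
        ha₁.1 k (by revert hk; cases k <;> decide)]
    refine ⟨by simp; omega, by simp, ?_, ?_, ⟨?_, ?_⟩, ?_⟩
    · simpa [hv] using hv₃ rV (by simp)
    · simpa using hv₃ rSP (by simp)
    · simp [k₁]
    · simp [k₁]
    · exact hb₃


/-- At node `v` of the pattern stands the subtree `t`, which begins with a chain of `c` nodes that
ends at node `b`; `h` is a largest one of the subtrees below, with `L` on its left and `R` on its
right. -/
structure Branching (P t : OTree) (v c b : ℕ) (L : List OTree) (h : OTree) (R : List OTree) :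
    Prop where
  chain : IsChain t c (L ++ h :: R)
  stands : Stands P [t] v
  encoded : ∃ p, Encoded P [t] v p
  bottom : b + 1 = v + c
  heavy : ∀ u ∈ L ++ h :: R, u.size ≤ h.size

/-- The branching node `b` is open in `σ'`: the work on the subtree `t` at node `v`, whose chain
ends at `b`, was begun in `σ`, and the heavy child of `b` is `x`. -/
structure Opened (P T t : OTree) (v b x : ℕ) (σ σ' : State) : Prop where
  tables : Tables P T σ'
  kept : Kept t v (σ.v rSP) σ σ'
  top : σ'.a aTop b = v
  heavy : σ'.a aHvy b = x

/-- The frame of the branching node `b` holds `e` windows that represent the forest `F`. -/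
structure Framed (P T t : OTree) (v b x e : ℕ) (F : List OTree) (σ σ' : State) : Prop
    extends Opened P T t v b x σ σ' where
  height : σ'.v rSP = σ.v rSP + e
  frame : σ'.a aFrm b = σ.v rSP
  windows : Windows T.size (labOf T) (endOf T) F (σ.v rSP) (σ.v rSP + e) (σ'.a aSL) (σ'.a aSE)

variable {b e x : ℕ} {L R : List OTree} {h : OTree} {σ σ' σ'' : State}

theorem Framed.congr (hF : Framed P T t v b x e F σ σ')
    (hv : ∀ y ∈ [rNP, rNT, rSP], σ''.v y = σ'.v y)
    (ha : ∀ k ∈ [aLabP, aParP, aEndP, aHvy, aPrv, aFrm, aTop, aLabT, aParT, aEndT, aSL, aSE],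
      σ''.a k = σ'.a k) : Framed P T t v b x e F σ σ'' where
  tables := hF.tables.congr (fun y hy => hv y (by revert hy; cases y <;> decide))
    fun k hk => ha k (by revert hk; cases k <;> decide)
  kept := by
    refine ⟨?_, ?_⟩
    · rw [ha aSL (by decide), ha aSE (by decide)]; exact hF.kept.windows
    · rw [ha aFrm (by decide), ha aTop (by decide)]; exact hF.kept.frames
  top := by rw [ha aTop (by decide)]; exact hF.top
  heavy := by rw [ha aHvy (by decide)]; exact hF.heavy
  height := by rw [hv rSP (by decide)]; exact hF.height
  frame := by rw [ha aFrm (by decide)]; exact hF.frame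
  windows := by rw [ha aSL (by decide), ha aSE (by decide)]; exact hF.windows

/-- The position of a child in the preorder of the pattern, and what the tables hold for it. -/
theorem Branching.child (hB : Branching P t v c b L h R) {G G' : List OTree} {u : OTree}
    (hG : L ++ h :: R = G ++ u :: G') {x : ℕ} (hx : x = b + 1 + fsize G) :
    Stands P [u] x ∧ Encoded P [u] x b ∧ parOf P x = b ∧ endOf P x = x + u.size ∧
      x + u.size + fsize G' ≤ P.size ∧ endOf P b = x + u.size + fsize G' ∧
      t.size = c + fsize G + u.size + fsize G' ∧ v + t.size ≤ P.size := by
  obtain ⟨p, hE⟩ := hB.encoded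
  have hs := hB.chain.stands hB.stands
  have he := hB.chain.encoded hE
  have hb := hB.bottom
  have hend := hB.chain.endOf_eq hB.stands (b - v)
    (by have := hB.chain.pos; omega)
  have hcp := hB.chain.pos
  rw [hG] at hs he
  have hsize := hB.chain.size_eq
  rw [hG, fsize_append, fsize_cons] at hsize
  have hle := hB.stands.add_le (by have := size_pos t; simp; omega)
  simp only [fsize_cons, fsize_nil] at hle
  have he' := he.right
  have hs' := hs.right
  rw [show v + c - 1 = b by omega, show v + c + fsize G = x by omega] at he'
  rw [show v + c + fsize G = x by omega] at hs'
  rw [show v + (b - v) = b by omega] at hend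
  exact ⟨Stands.left (G := G') hs', he'.single, he'.par, hs'.endOf_eq, by omega, by omega,
    by omega, by omega⟩

theorem start_branch (hW : 128 * T.size ≤ W) (hcap : cap = 6 * T.size) (hPT : P.size ≤ T.size)
    (hB : Branching P t v c b L h R) (hσ : Tables P T σ) (hv : σ.v rV = v)
    (hmode : σ.v rMode = 0) (hx : σ.a aHvy b = x) :
    Within W cap round (100 * T.size) (fun σ' => Opened P T t v b x σ σ' ∧
      σ'.v rSP = σ.v rSP ∧ σ'.v rMode = 0 ∧ σ'.v rV = x) σ := by
  have hT := isTree T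
  have hn0 := hT.pos
  have hcp := hB.chain.pos
  have hb := hB.bottom
  obtain ⟨-, -, -, -, h₁, h₂, h₃, h₄⟩ := hB.child rfl rfl
  have hs₁ := size_pos h
  unfold round start
  refine Within.le_time (T := 4 * T.size + (2 + 1) + 1)
    (.iteTrue (by simp; omega) (by simpa using hmode) ?_) (by omega)
  refine (descend_chain hW hcap hPT hB.chain hB.stands hσ hv).seq fun σ₁ ha₁ hb₁ => ?_
  have g₁ := hσ.agree ha₁ (by decide) (by decide)
  have hbb : σ₁.v rB = b := by omega
  have he := g₁.endP b (by omega)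
  have hlen := hB.chain.length_ne
  refine .iteFalse (by simp; omega) ?_ ?_
  · simp only [Cond.Holds, Expr.eval_get, Expr.eval_var, Expr.eval_add, Expr.eval_ofNat]
    rw [hbb, he]
    omega
  refine (Cmd.within_of_wp (c := .put aTop rB rV ;; .set rV (aHvy rB)) ?_).le_time (by simp)
  have k₁ : ∀ k, σ₁.a k = σ.a k := fun k => ha₁.2 k (by cases k <;> decide)
  have hV : σ₁.v rV = v := by rw [ha₁.1 rV (by decide), hv]
  have hM : σ₁.v rMode = 0 := by rw [ha₁.1 rMode (by decide), hmode]
  have hS : σ₁.v rSP = σ.v rSP := ha₁.1 rSP (by decide)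
  simp [k₁, hV, hM, hS, hbb, hx]
  refine ⟨by omega, g₁.congr (by simp) (by simp), ⟨by simp [k₁], fun q hq => ?_⟩, ?_, ?_⟩
  · have : q ≠ b := by rintro rfl; omega
    simp [k₁, this]
  · simp
  · simp [k₁, hx]

theorem absorb_heavy (hW : 128 * T.size ≤ W) (hcap : cap = 6 * T.size) (hPT : P.size ≤ T.size)
    (hB : Branching P t v c b L h R) (ho : Opened P T t v b x σ σ') (hsp : σ'.v rSP = σ.v rSP)
    (hmk : Marked T h σ') (hP : σ'.v rP = b) (hH : σ'.v rH = x) (hV : σ'.v rV = x)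
    (hs : σ.v rSP ≤ 2 * T.size) :
    Within W cap absorb (70 * T.size) (fun σ'' => ∃ e, e * h.size ≤ T.size ∧
      Framed P T t v b x e [h] σ σ'') σ' := by
  have hT := isTree T
  have hn0 := hT.pos
  have hcp := hB.chain.pos
  have hb := hB.bottom
  obtain ⟨-, -, -, -, h₁, h₂, h₃, h₄⟩ := hB.child rfl rfl
  have hs₁ := size_pos h
  unfold absorb
  refine .mono (T := 16 * T.size + 1) (.iteTrue (by simp) (by simp [hV, hH])
    (pushFrame_spec hW hcap hT ho.tables.sizeT ho.tables.endT hmk.iff hP (by omega) hsp hs).frame)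
      (by omega) ?_
  rintro σ'' - ⟨⟨e, e₁, e₂, e₃, e₄, e₅⟩, ha⟩
  refine ⟨e, e₁, ⟨ho.tables.agree ha (by decide) (by decide), ⟨fun j hj => ?_, fun q hq => ?_⟩, ?_,
    ?_⟩, e₂, ?_, e₅⟩
  · have := ho.kept.windows j hj
    have := e₃ j hj
    omega
  · rw [e₄, ha.2 aTop (by decide), if_neg (by omega)]
    exact ho.kept.frames q hq
  · rw [ha.2 aTop (by decide)]; exact ho.top
  · rw [ha.2 aHvy (by decide)]; exact ho.heavy
  · rw [e₄, if_pos rfl]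

theorem absorb_right (hW : 128 * T.size ≤ W) (hcap : cap = 6 * T.size) (hPT : P.size ≤ T.size)
    (hB : Branching P t v c b L h R) (hF : Framed P T t v b x e F σ σ') {u : OTree}
    (hmk : Marked T u σ') (hP : σ'.v rP = b) (hH : σ'.v rH = x) (hV : x < σ'.v rV)
    (hs : σ.v rSP + e ≤ 3 * T.size) :
    Within W cap absorb (70 * T.size) (Framed P T t v b x e (F ++ [u]) σ) σ' := by
  have hT := isTree T
  have hn0 := hT.pos
  have hcp := hB.chain.pos
  have hb := hB.bottom
  obtain ⟨-, -, -, -, h₁, h₂, h₃, h₄⟩ := hB.child rfl rfl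
  have hs₁ := size_pos h
  unfold absorb
  refine .mono (T := 32 * T.size + 1 + 1) (.iteFalse (by simp) (by simp [hH]; omega)
    (.iteTrue (by simp) (by simpa [hH] using hV)
    (extendRight_spec hW hcap hT hF.tables.sizeT hF.tables.endT hmk.iff hP (by omega) hF.frame
      (Nat.le_add_right _ _) hF.height hs hF.windows).frame)) (by omega) ?_
  rintro σ'' - ⟨⟨e₁, e₂⟩, ha⟩
  refine ⟨⟨hF.tables.agree ha (by decide) (by decide), ⟨fun j hj => ?_, fun q hq => ?_⟩, ?_,
    ?_⟩, ?_, ?_, e₂⟩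
  · rw [e₁ j hj, ha.2 aSL (by decide)]; exact hF.kept.windows j hj
  · rw [ha.2 aFrm (by decide), ha.2 aTop (by decide)]; exact hF.kept.frames q hq
  · rw [ha.2 aTop (by decide)]; exact hF.top
  · rw [ha.2 aHvy (by decide)]; exact hF.heavy
  · rw [ha.1 rSP (by decide)]; exact hF.height
  · rw [ha.2 aFrm (by decide)]; exact hF.frame

theorem absorb_left (hW : 128 * T.size ≤ W) (hcap : cap = 6 * T.size) (hPT : P.size ≤ T.size)
    (hB : Branching P t v c b L h R) (hF : Framed P T t v b x e F σ σ') {u : OTree}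
    (hmk : Marked T u σ') (hP : σ'.v rP = b) (hH : σ'.v rH = x) (hV : σ'.v rV < x)
    (hs : σ.v rSP + e ≤ 3 * T.size) :
    Within W cap absorb (70 * T.size) (Framed P T t v b x e (u :: F) σ) σ' := by
  have hT := isTree T
  have hn0 := hT.pos
  have hcp := hB.chain.pos
  have hb := hB.bottom
  obtain ⟨-, -, -, -, h₁, h₂, h₃, h₄⟩ := hB.child rfl rfl
  have hs₁ := size_pos h
  unfold absorb
  refine .mono (T := 64 * T.size + 1 + 1) (.iteFalse (by simp) (by simp [hH]; omega)
    (.iteFalse (by simp) (by simp [hH]; omega)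
    (extendLeft_spec hW hcap hT hF.tables.sizeT hF.tables.endT hmk.iff hP (by omega) hF.frame
      (Nat.le_add_right _ _) hF.height hs hF.windows).frame)) (by omega) ?_
  rintro σ'' - ⟨⟨e₁, e₂⟩, ha⟩
  refine ⟨⟨hF.tables.agree ha (by decide) (by decide), ⟨fun j hj => ?_, fun q hq => ?_⟩, ?_,
    ?_⟩, ?_, ?_, e₂⟩
  · rw [e₁ j hj, ha.2 aSE (by decide)]; exact hF.kept.windows j hj
  · rw [ha.2 aFrm (by decide), ha.2 aTop (by decide)]; exact hF.kept.frames q hq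
  · rw [ha.2 aTop (by decide)]; exact hF.top
  · rw [ha.2 aHvy (by decide)]; exact hF.heavy
  · rw [ha.1 rSP (by decide)]; exact hF.height
  · rw [ha.2 aFrm (by decide)]; exact hF.frame

theorem finish_spec (hW : 128 * T.size ≤ W) (hcap : cap = 6 * T.size) (hPT : P.size ≤ T.size)
    (hB : Branching P t v c b L h R) (hF : Framed P T t v b x e (L ++ h :: R) σ σ')
    (hP : σ'.v rP = b) (hs : σ.v rSP + e ≤ 3 * T.size) :
    Within W cap finish (135 * T.size) (Done T t v σ) σ' := by
  have hT := isTree T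
  have hn0 := hT.pos
  have hcp := hB.chain.pos
  have hb := hB.bottom
  obtain ⟨-, -, -, -, h₁, h₂, h₃, h₄⟩ := hB.child rfl rfl
  have hs₁ := size_pos h
  unfold finish
  refine Within.le_time (T := 64 * T.size + (64 * T.size + 1 + 1 + 1 + 1)) ?_ (by omega)
  refine (windowEnds_spec hW hcap hT hF.tables.sizeT hP (by omega) hF.frame
    (Nat.le_add_right _ _) hF.height hs hF.windows).seq fun σ₁ ha₁ hb₁ => ?_
  have g₁ := hF.congr (σ'' := σ₁) (fun y hy => ha₁.1 y (by revert hy; cases y <;> decide))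
    fun k hk => ha₁.2 k (by revert hk; cases k <;> decide)
  have hP₁ : σ₁.v rP = b := by rw [ha₁.1 rP (by decide), hP]
  refine .set_seq (by simp [hP₁]; omega) (.set_seq (by simp) (.set_seq (by simp [hP₁]; omega) ?_))
  have ht := hB.chain.chainForest_eq hB.stands
  rw [show v + c - 1 = b by omega] at ht
  refine Within.seq (levels_spec hW hcap hT hPT (b := b) (c := c) (by simpa using g₁.tables.sizeT)
    (by simp [hP₁]) (by omega)
    (by simp [hP₁, g₁.top]; omega) hcp (by exact g₁.tables.labT) (by exact g₁.tables.parT)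
    (by exact g₁.tables.endT) (by exact g₁.tables.labP) (F := L ++ h :: R) (by exact hb₁) ht)
    fun σ₂ ha₂ hb₂ => ?_
  refine (Cmd.within_of_wp (c := .set rMode 1) ?_).le_time (by simp)
  have k₁ : ∀ k, k ∉ [aAcc, aInc, aMk] → σ₂.a k = σ₁.a k := fun k hk => by
    rw [ha₂.2 k (by revert hk; cases k <;> decide)]; rfl
  refine ⟨by simp; omega, by simp, ?_, ?_, ⟨?_, ?_⟩, hb₂⟩
  · have := ha₂.1 rV (by decide)
    simpa [hP₁, g₁.top] using this
  · have := ha₂.1 rSP (by decide)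
    simpa [hP₁, g₁.frame] using this
  · simp only [State.setV_a, k₁ aSL (by decide), k₁ aSE (by decide)]; exact g₁.kept.windows
  · simp only [State.setV_a, k₁ aFrm (by decide), k₁ aTop (by decide)]; exact g₁.kept.frames

end

theorem numLeaves_pos (t : OTree) : 0 < t.numLeaves := by
  induction hm : t.size using Nat.strong_induction_on generalizing t with
  | _ m ih =>
    obtain ⟨a, _ | ⟨u, ts⟩⟩ := t
    · simp [numLeaves_node]
    · have := ih u.size (by rw [← hm]; simp) u rfl
      rw [numLeaves_node]; simp; omega

theorem length_le_fleaves (F : List OTree) : F.length ≤ fleaves F := by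
  induction F with
  | nil => simp
  | cons t F ih => have := numLeaves_pos t; simp; omega

section
variable {W cap : ℕ} {P T : OTree} {t : OTree} {v c p : ℕ} {F : List OTree}
variable {b e x : ℕ} {L R : List OTree} {h : OTree} {σ σ' σ'' : State}

/-- The children of a node are the roots of the forest below it. -/
theorem Stands.exists_eq_append {a : ℕ} (hs : Stands P F a) (he : Encoded P F a b) (hba : b < a)
    {y : ℕ} (hy : parOf P y = b) (h₁ : a ≤ y) (h₂ : y < a + fsize F) :
    ∃ L h R, F = L ++ h :: R ∧ y = a + fsize L := by
  induction F generalizing a with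
  | nil => simp at h₂; omega
  | cons u G ih =>
    rcases h₁.eq_or_lt with rfl | h₁
    · exact ⟨[], u, G, rfl, by simp⟩
    · have hle := hs.add_le (by have := size_pos u; simp; omega)
      have : a + u.size ≤ y := by
        by_contra hlt
        have := (isTree P).le_par a y (by omega) h₁ (by rw [hs.endOf_eq]; omega)
        omega
      have hs' := Stands.right (F := [u]) hs
      simp only [fsize_cons, fsize_nil, Nat.add_zero] at hs' h₂
      obtain ⟨L, h, R, rfl, e⟩ := ih hs' he.tail (by omega) this (by omega)
      exact ⟨u :: L, h, R, rfl, by simp; omega⟩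

/-- The work on a child leaves the windows of its parent alone. -/
theorem Framed.done (hF : Framed P T t v b x e F σ σ') {u : OTree} {y : ℕ}
    (hd : Done T u y σ' σ'') (ha : Agree round σ' σ'') (h₁ : v ≤ y) (h₂ : y + u.size ≤ v + t.size)
    (hb : b < y) : Framed P T t v b x e F σ σ'' := by
  have hh := hF.height
  have hk := hd.kept.windows
  have hfr := hd.kept.frames b (by omega)
  refine ⟨⟨hF.tables.round ha, ⟨fun j hj => ?_, fun q hq => ?_⟩, ?_, ?_⟩, ?_, ?_, ?_⟩
  · have := hF.kept.windows j hj
    have := hk j (by omega)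
    omega
  · have := hF.kept.frames q hq
    have := hd.kept.frames q (by omega)
    omega
  · rw [hfr.2]; exact hF.top
  · rw [ha.2 aHvy (by decide)]; exact hF.heavy
  · rw [hd.height]; exact hF.height
  · rw [hfr.1]; exact hF.frame
  · refine hF.windows.congr fun j _ hj => hk j (by omega)

/-- A state before a round in which the work on a child `y` of `b`, with the heavy child `x`, is
used to extend the windows, which then represent `F`. -/
structure Absorbing (W cap : ℕ) (P T t : OTree) (v b x e : ℕ) (F : List OTree) (y : ℕ)
    (σ σ' : State) : Prop where
  tables : Tables P T σ'
  mode : σ'.v rMode = 1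
  node : σ'.v rV = y
  pos : 0 < y
  lt : y < P.size
  par : parOf P y = b
  heavy : σ'.a aHvy b = x
  absorb : Within W cap absorb (70 * T.size) (Framed P T t v b x e F σ)
    ((σ'.setV rP b).setV rH x)

theorem Absorbing.round (hW : 128 * T.size ≤ W) (hcap : cap = 6 * T.size) (hPT : P.size ≤ T.size)
    {y : ℕ} (h : Absorbing W cap P T t v b x e F y σ σ') {Q : State → Prop}
    (hQ : ∀ σ₁, Framed P T t v b x e F σ σ₁ → σ₁.v rV = y → σ₁.v rP = b → σ₁.v rH = x →
      Within W cap next (145 * T.size) Q σ₁) : Within W cap round (250 * T.size) Q σ' := by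
  have hn0 := (isTree T).pos
  have hy := h.pos
  have hyP := h.lt
  have hb := (isTree P).par_lt y hy hyP
  rw [h.par] at hb
  unfold TreeInclusion.round TreeInclusion.done
  refine Within.le_time (T := 70 * T.size + 145 * T.size + 1 + 1 + 1 + 1) ?_ (by omega)
  refine .iteFalse (by simp; omega) (by simp [h.mode]) (.iteFalse (by simp; omega)
    (by simp [h.node]; omega) (.set_seq (by simp [h.node]; omega) (.set_seq ?_ ?_)))
  · simp [h.node, h.tables.parP y hyP, h.par]; omega
  · simp only [Expr.eval_get, Expr.eval_var, h.node, h.tables.parP y hyP, h.par, State.setV_v,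
      if_true, State.setV_a, h.heavy]
    refine h.absorb.seq fun σ₁ ha hF => hQ σ₁ hF ?_ ?_ ?_
    · rw [ha.1 rV (by decide)]; simp [h.node]
    · rw [ha.1 rP (by decide)]; simp
    · rw [ha.1 rH (by decide)]; simp

theorem next_right (hW : 128 * T.size ≤ W) (hcap : cap = 6 * T.size) (hPT : P.size ≤ T.size)
    (hF : Framed P T t v b x e F σ σ') {y : ℕ} (hy : y < P.size) (hb : b < P.size)
    (hV : σ'.v rV = y) (hP : σ'.v rP = b) (hH : σ'.v rH = x) (hxy : x ≤ y)
    (hlt : endOf P y < endOf P b) :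
    Within W cap next (145 * T.size) (fun σ'' => Framed P T t v b x e F σ σ'' ∧
      σ''.v rMode = 0 ∧ σ''.v rV = endOf P y) σ' := by
  have hn0 := (isTree T).pos
  unfold next
  refine Within.le_time (T := 2 + 1 + 1 + 1) ?_ (by omega)
  have h₁ := hF.tables.endP y hy
  have h₂ := hF.tables.endP b hb
  refine .iteFalse (by simp) (by simp [hV, hH]; omega) (.set_seq (by simp [hV]; omega)
    (.iteTrue (by simp [hP]; omega) (by simpa [hV, hP, h₁, h₂] using hlt) ?_))
  refine (Cmd.within_of_wp ?_).le_time (by simp)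
  simp [hV, h₁]
  exact ⟨by omega, hF.congr (by simp) (by simp)⟩

theorem next_goLeft (hcap : cap = 6 * T.size) (hPT : P.size ≤ T.size)
    (hF : Framed P T t v b x e F σ σ') {y z : ℕ} (hy : y < P.size) (hb : b < P.size)
    (hV : σ'.v rV = y) (hP : σ'.v rP = b) (hH : σ'.v rH = x)
    (hz : y < x ∧ z = y ∨ x ≤ y ∧ endOf P y = endOf P b ∧ z = x) {Q : State → Prop}
    (hQ : ∀ σ₁, Framed P T t v b x e F σ σ₁ → σ₁.v rP = b → σ₁.v rY = z →
      Within W cap goLeft (140 * T.size) Q σ₁) :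
    Within W cap next (145 * T.size) Q σ' := by
  have hn0 := (isTree T).pos
  unfold next
  refine Within.le_time (T := 140 * T.size + 1 + 1 + 1 + 1) ?_ (by omega)
  have h₁ := hF.tables.endP y hy
  have h₂ := hF.tables.endP b hb
  rcases hz with ⟨hz, rfl⟩ | ⟨hz, he, rfl⟩
  · refine .le_time (.iteTrue (by simp) (by simp [hV, hH]; omega) (.set_seq (by simp)
      (hQ _ (hF.congr (by simp) (by simp)) (by simp [hP]) (by simp [hV])))) (by omega)
  · refine .iteFalse (by simp) (by simp [hV, hH]; omega) (.set_seq (by simp [hV]; omega)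
      (.iteFalse (by simp [hP]; omega) (by simp [hV, hP, h₁, h₂]; omega) (.set_seq (by simp)
      (hQ _ (hF.congr (by simp) (by simp)) (by simp [hP]) (by simp [hH])))))

theorem goLeft_finish (hW : 128 * T.size ≤ W) (hcap : cap = 6 * T.size) (hPT : P.size ≤ T.size)
    (hB : Branching P t v c b L h R) (hF : Framed P T t v b x e (L ++ h :: R) σ σ')
    (hP : σ'.v rP = b) (hY : σ'.v rY = b + 1) (hs : σ.v rSP + e ≤ 3 * T.size) :
    Within W cap goLeft (140 * T.size) (Done T t v σ) σ' := by
  have hn0 := (isTree T).pos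
  obtain ⟨-, -, -, -, h₁, h₂, h₃, h₄⟩ := hB.child rfl rfl
  unfold goLeft
  refine .le_time (.iteTrue (by simp [hP]; omega) (by simp [hP, hY])
    (finish_spec hW hcap hPT hB hF hP hs)) (by omega)

theorem goLeft_left (hW : 128 * T.size ≤ W) (hcap : cap = 6 * T.size) (hPT : P.size ≤ T.size)
    (hF : Framed P T t v b x e F σ σ') {z q : ℕ} (hz : z < P.size) (hb : b < P.size)
    (hP : σ'.v rP = b) (hY : σ'.v rY = z) (hbz : z ≠ b + 1) (hq : σ'.a aPrv z = q) :
    Within W cap goLeft (140 * T.size) (fun σ'' => Framed P T t v b x e F σ σ'' ∧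
      σ''.v rMode = 0 ∧ σ''.v rV = q) σ' := by
  have hn0 := (isTree T).pos
  unfold goLeft
  refine .le_time (T := 2 + 1) (.iteFalse (by simp [hP]; omega) (by simp [hP, hY, hbz]) ?_)
    (by omega)
  refine (Cmd.within_of_wp ?_).le_time (by simp)
  simp [hY, hq]
  exact ⟨by omega, by omega, hF.congr (by simp) (by simp)⟩

/-- The work on the subtree `u` of the pattern is done within time linear in the product of the
number of leaves of `u` and the size of the text, if the stack is low enough at its beginning. -/
def Works (W cap : ℕ) (P T u : OTree) : Prop :=
  ∀ (y p : ℕ) (σ : State), Stands P [u] y → Encoded P [u] y p → Tables P T σ → σ.v rMode = 0 →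
    σ.v rV = y → σ.v rSP * u.size ≤ 2 * T.size →
    Reach W cap (.lt rMode 2) round (256 * T.size * (4 * u.numLeaves - 3)) (Done T u y σ) σ

theorem add_rounds_le {N k l r : ℕ} (h : 1 + (k + l) ≤ r) : N + (N * k + N * l) ≤ N * r := by
  calc _ = N * (1 + (k + l)) := by ring
    _ ≤ _ := Nat.mul_le_mul_left _ h

/-- The stack leaves room for the frames of a light child of size `u`: its size is at most that of
the heavy child, `k`, and at most half of that of the parent, `m`. -/
theorem height_mul_le {s e m k u n : ℕ} (hs : s * m ≤ 2 * n) (he : e * k ≤ n) (hu : u ≤ k)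
    (h : 2 * u ≤ m) : (s + e) * u ≤ 2 * n := by
  have h₁ : e * u ≤ e * k := Nat.mul_le_mul_left _ hu
  have h₂ : s * (2 * u) ≤ s * m := Nat.mul_le_mul_left _ h
  rw [Nat.add_mul]
  rw [Nat.mul_left_comm] at h₂
  omega

/-- The work on the left siblings `L'` that remain when the windows represent all other children. In
units of `256 * T.size`, a child with `l` leaves takes `4 * l - 3`, and each of the rounds between
two children as well as the last one takes `1`; this explains the bound for `r`. The node `z` is the
child on whose left the work goes on: the child `y` just done, or the heavy child `x` if `y` is the
last one. -/
theorem left_phase (hW : 128 * T.size ≤ W) (hcap : cap = 6 * T.size) (hPT : P.size ≤ T.size)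
    (hB : Branching P t v c b L h R) (hx : x = b + 1 + fsize L)
    (hworks : ∀ u ∈ L ++ h :: R, Works W cap P T u) (hst : σ.v rSP * t.size ≤ 2 * T.size)
    (heh : e * h.size ≤ T.size) {L' M : List OTree} (hL : L = L' ++ M) {y z r : ℕ} {σ' : State}
    (hA : Absorbing W cap P T t v b x e (M ++ h :: R) y σ σ')
    (hyz : y < x ∧ z = y ∨ x ≤ y ∧ endOf P y = endOf P b ∧ z = x) (hz : z = b + 1 + fsize L')
    (hr : 4 * fleaves L' + 1 ≤ r + 2 * L'.length) :
    Reach W cap (.lt rMode 2) round (256 * T.size * r) (Done T t v σ) σ' := by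
  have hn0 := (isTree T).pos
  obtain ⟨-, -, -, -, h₁, h₂, h₃, h₄⟩ := hB.child rfl rfl
  have hcp := hB.chain.pos
  have hbot := hB.bottom
  have hs₁ := size_pos h
  have hsn := (Nat.le_mul_of_pos_right (σ.v rSP) (size_pos t)).trans hst
  have hen := (Nat.le_mul_of_pos_right e hs₁).trans heh
  have hone : ∀ {Q : State → Prop} {σ' : State}, σ'.v rMode = 1 →
      Within W cap round (250 * T.size) Q σ' →
      Reach W cap (.lt rMode 2) round (256 * T.size) Q σ' := fun hm hQ =>
    (Reach.one (by simp; omega) (by simp [hm]) hQ).mono (by omega) fun _ _ h => h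
  induction L' using List.reverseRecOn generalizing M y z r σ' with
  | nil =>
    obtain rfl : M = L := by simpa using hL.symm
    refine (hone hA.mode (hA.round hW hcap hPT fun σ₁ hF hV hP hH =>
      next_goLeft hcap hPT hF hA.lt (by omega) hV hP hH hyz fun σ₂ hF hP hY =>
      goLeft_finish hW hcap hPT hB hF hP (by simpa [hz] using hY) (by omega))).mono
        (Nat.le_mul_of_pos_right _ (by simp at hr; omega)) fun _ _ h => h
  | append_singleton L'' u ih =>
    have hF' : L ++ h :: R = L'' ++ u :: (M ++ h :: R) := by simp [hL]
    obtain ⟨k₁, k₂, k₃, k₄, k₅, k₆, k₇, k₈⟩ := hB.child hF' rfl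
    have hmem : u ∈ L ++ h :: R := by rw [hF']; simp
    have hu := numLeaves_pos u
    have hl := length_le_fleaves L''
    have hsu := size_pos u
    have huh := hB.heavy u hmem
    simp only [fsize_append, fsize_cons, fsize_nil, List.length_append, List.length_singleton,
      fleaves_append, fleaves_cons, fleaves_nil] at *
    subst hL
    simp only [fsize_append, fsize_cons, fsize_nil] at *
    generalize hq : b + 1 + fsize L'' = q at *
    have hr' : 1 + ((4 * u.numLeaves - 3) + (4 * fleaves L'' + 1 - 2 * L''.length)) ≤ r := by omega
    refine Reach.mono (T := 256 * T.size + (256 * T.size * (4 * u.numLeaves - 3) +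
      256 * T.size * (4 * fleaves L'' + 1 - 2 * L''.length))) ?_ (add_rounds_le hr') fun _ _ h => h
    refine Reach.trans (hone hA.mode (hA.round hW hcap hPT fun σ₁ hF hV hP hH =>
      next_goLeft hcap hPT hF hA.lt (by omega) hV hP hH hyz fun σ₂ hF hP hY =>
      goLeft_left hW hcap hPT hF (q := q) (by omega) (by omega) hP hY (by omega) ?_)) ?_
    · have := hF.tables.prev q (by omega) (by omega) (by rw [k₃]; omega)
      rwa [show endOf P q = z by omega] at this
    · rintro σ₁ - ⟨hF, hm, hV⟩
      have hsp : σ₁.v rSP * u.size ≤ 2 * T.size := by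
        rw [hF.height]; exact height_mul_le hst heh huh (by omega)
      refine (hworks u hmem q b σ₁ k₁ k₂ hF.tables hm hV hsp).trans fun σ₂ ha hd => ?_
      have hF₂ := hF.done hd ha (by omega) (by omega) (by omega)
      refine ih (M := u :: M) (y := q) (z := q) (by simp) ⟨hF₂.tables, hd.mode, hd.node, by omega,
        by omega, k₃, hF₂.heavy, ?_⟩ (.inl ⟨by omega, rfl⟩) rfl (by omega)
      refine absorb_left hW hcap hPT hB (hF₂.congr (by simp) (by simp)) hd.marked (by simp)
        (by simp) (by simp [hd.node]; omega) (by omega)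

/-- The work on the right siblings `R'` that remain when the windows represent the heavy child and
the siblings `M` next to it, and then on the left siblings. -/
theorem right_phase (hW : 128 * T.size ≤ W) (hcap : cap = 6 * T.size) (hPT : P.size ≤ T.size)
    (hB : Branching P t v c b L h R) (hx : x = b + 1 + fsize L)
    (hworks : ∀ u ∈ L ++ h :: R, Works W cap P T u) (hst : σ.v rSP * t.size ≤ 2 * T.size)
    (heh : e * h.size ≤ T.size) {R' M : List OTree} (hR : R = M ++ R') {y r : ℕ} {σ' : State}
    (hA : Absorbing W cap P T t v b x e (h :: M) y σ σ')
    (hxy : x ≤ y) (hy : endOf P y = x + h.size + fsize M)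
    (hr : 4 * (fleaves L + fleaves R') + 1 ≤ r + 2 * (L.length + R'.length)) :
    Reach W cap (.lt rMode 2) round (256 * T.size * r) (Done T t v σ) σ' := by
  have hn0 := (isTree T).pos
  obtain ⟨-, -, -, -, h₁, h₂, h₃, h₄⟩ := hB.child rfl rfl
  have hcp := hB.chain.pos
  have hbot := hB.bottom
  have hs₁ := size_pos h
  have hsn := (Nat.le_mul_of_pos_right (σ.v rSP) (size_pos t)).trans hst
  have hen := (Nat.le_mul_of_pos_right e hs₁).trans heh
  have hone : ∀ {Q : State → Prop} {σ' : State}, σ'.v rMode = 1 →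
      Within W cap round (250 * T.size) Q σ' →
      Reach W cap (.lt rMode 2) round (256 * T.size) Q σ' := fun hm hQ =>
    (Reach.one (by simp; omega) (by simp [hm]) hQ).mono (by omega) fun _ _ h => h
  induction R' generalizing M y r σ' with
  | nil =>
    obtain rfl : R = M := by simpa using hR
    refine left_phase hW hcap hPT hB hx hworks hst heh (L' := L) (M := []) (by simp) hA
      (.inr ⟨hxy, ?_, rfl⟩) hx (by simpa using hr)
    omega
  | cons u R'' ih =>
    have hF' : L ++ h :: R = (L ++ h :: M) ++ u :: R'' := by simp [hR]
    obtain ⟨k₁, k₂, k₃, k₄, k₅, k₆, k₇, k₈⟩ := hB.child hF' rfl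
    have hmem : u ∈ L ++ h :: R := by rw [hF']; simp
    have hu := numLeaves_pos u
    have hl := length_le_fleaves L
    have hl' := length_le_fleaves R''
    have hsu := size_pos u
    have huh := hB.heavy u hmem
    simp only [fsize_append, fsize_cons, List.length_cons, fleaves_cons] at *
    subst hR
    simp only [fsize_append, fsize_cons] at *
    generalize hq : b + 1 + (fsize L + (h.size + fsize M)) = q at *
    have hr' : 1 + ((4 * u.numLeaves - 3) +
      (4 * (fleaves L + fleaves R'') + 1 - 2 * (L.length + R''.length))) ≤ r := by omega
    refine Reach.mono (T := 256 * T.size + (256 * T.size * (4 * u.numLeaves - 3) +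
      256 * T.size * (4 * (fleaves L + fleaves R'') + 1 - 2 * (L.length + R''.length)))) ?_
      (add_rounds_le hr') fun _ _ h => h
    refine Reach.trans (hone hA.mode (hA.round hW hcap hPT fun σ₁ hF hV hP hH =>
      next_right hW hcap hPT hF hA.lt (by omega) hV hP hH hxy (by omega))) ?_
    rintro σ₁ - ⟨hF, hm, hV⟩
    have hsp : σ₁.v rSP * u.size ≤ 2 * T.size := by
        rw [hF.height]; exact height_mul_le hst heh huh (by omega)
    refine (hworks u hmem q b σ₁ k₁ k₂ hF.tables hm (by omega) hsp).trans fun σ₂ ha hd => ?_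
    have hF₂ := hF.done hd ha (by omega) (by omega) (by omega)
    refine ih (M := M ++ [u]) (y := q) (by simp) ⟨hF₂.tables, hd.mode, hd.node, by omega,
      by omega, k₃, hF₂.heavy, ?_⟩ (by omega) (by simp; omega) (by omega)
    have := absorb_right hW hcap hPT hB (σ' := (σ₂.setV rP b).setV rH x)
      (hF₂.congr (by simp) (by simp)) hd.marked (by simp)
      (by simp) (by simp [hd.node]; omega) (by omega)
    simpa using this

end

section
variable {W cap : ℕ} {P T : OTree}

/-- By induction on the size of `t`. If `t` is a chain, one round suffices. Otherwise `t` has `k ≥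
2` subtrees below its chain, and the time is `1` for the start, `4 * l - 3` for each subtree with
`l` leaves and `1` after each subtree, in all `4 * l - 2 * k + 1` for the number `l` of the leaves
of `t`. -/
theorem works (hW : 128 * T.size ≤ W) (hcap : cap = 6 * T.size) (hPT : P.size ≤ T.size)
    (t : OTree) : Works W cap P T t := by
  induction hm : t.size using Nat.strong_induction_on generalizing t with
  | _ m ih =>
  intro v p σ hs hE hσ hmode hV hsp
  have hn0 := (isTree T).pos
  obtain ⟨c, F, hc⟩ := exists_isChain t
  have hone : ∀ {Q : State → Prop} {σ' : State} {k : ℕ}, k ≤ 250 → σ'.v rMode < 2 →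
      Within W cap round (k * T.size) Q σ' →
      Reach W cap (.lt rMode 2) round (256 * T.size) Q σ' := fun hk hm hQ =>
    (Reach.one (by simp; omega) (by simpa using hm) hQ).mono
      (by have := Nat.mul_le_mul_right T.size hk; omega) fun _ _ h => h
  have hlv := hc.numLeaves_eq
  have hlen := hc.length_ne
  by_cases hF : F = []
  · subst hF
    rw [if_pos rfl] at hlv
    rw [hlv]
    exact (hone (by norm_num) (by omega) (start_leaf hW hcap hPT hc hs hσ hV hmode)).mono
      (by omega) fun _ _ h => h
  rw [if_neg hF] at hlv
  have hF1 : 0 < F.length := List.length_pos_iff.2 hF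
  have hcp := hc.pos
  obtain ⟨b, hb⟩ : ∃ b, b + 1 = v + c := ⟨v + c - 1, by omega⟩
  have hsF := hc.stands hs
  have hEF := hc.encoded hE
  rw [← hb] at hsF hEF
  rw [Nat.add_sub_cancel] at hEF
  have hFp : 0 < fsize F := by
    obtain ⟨u, G, rfl⟩ := List.exists_cons_of_ne_nil hF
    have := size_pos u
    simp; omega
  have hle := hsF.add_le hFp
  have hend := hc.endOf_eq hs (b - v) (by omega)
  rw [show v + (b - v) = b by omega, hc.size_eq] at hend
  -- the first child shows that the heavy child entered for the node `b` is a child of `b`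
  have hpar : parOf P (b + 1) = b := by
    obtain ⟨u, G, rfl⟩ := List.exists_cons_of_ne_nil hF
    exact hEF.par
  obtain ⟨x, hx⟩ : ∃ x, σ.a aHvy b = x := ⟨_, rfl⟩
  obtain ⟨x₁, x₂, x₃, -⟩ := hσ.heavy (b + 1) (by omega) (by omega)
  rw [hpar, hx] at x₁
  rw [hpar, hx] at x₂ x₃
  have y₁ := (isTree P).par_lt x x₂ x₃
  have y₂ := (isTree P).end_par x x₂ x₃
  have y₃ := lt_endOf P x
  rw [x₁] at y₁ y₂
  obtain ⟨L, h, R, rfl, hxL⟩ := hsF.exists_eq_append hEF (by omega) x₁ (by omega) (by omega)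
  have hB : Branching P t v c b L h R := by
    refine ⟨hc, hs, ⟨p, hE⟩, hb, fun u hu => ?_⟩
    obtain ⟨G, G', hG⟩ := List.append_of_mem hu
    have hsu := hsF
    have heu := hEF
    rw [hG] at hsu heu
    have e₁ := hsu.right.endOf_eq
    have e₂ := hsF.right.endOf_eq
    have hp := heu.right.par
    have := hsu.right.add_le (by have := size_pos u; simp; omega)
    have := size_pos u
    simp only [fsize_cons] at *
    obtain ⟨-, -, -, k⟩ := hσ.heavy (b + 1 + fsize G) (by omega) (by omega)
    rw [hp, hx, e₁, hxL, e₂] at k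
    omega
  obtain ⟨k₁, k₂, k₃, k₄, k₅, k₆, k₇, k₈⟩ := hB.child rfl hxL
  have hworks : ∀ u ∈ L ++ h :: R, Works W cap P T u := by
    intro u hu
    obtain ⟨G, G', hG⟩ := List.append_of_mem hu
    obtain ⟨-, -, -, -, -, -, hsz, -⟩ := hB.child hG rfl
    exact ih u.size (by omega) u rfl
  have hh := numLeaves_pos h
  have hlL := length_le_fleaves L
  have hlR := length_le_fleaves R
  have hsh := size_pos h
  simp only [fleaves_append, fleaves_cons, List.length_append, List.length_cons] at hlv hlen
  have hr : 1 + ((4 * h.numLeaves - 3) +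
      (4 * (fleaves L + fleaves R) + 1 - 2 * (L.length + R.length))) ≤ 4 * t.numLeaves - 3 := by
    omega
  refine Reach.mono (T := 256 * T.size + (256 * T.size * (4 * h.numLeaves - 3) +
    256 * T.size * (4 * (fleaves L + fleaves R) + 1 - 2 * (L.length + R.length)))) ?_
    (add_rounds_le hr) fun _ _ h => h
  refine Reach.trans (hone (by norm_num) (by omega)
    (start_branch hW hcap hPT hB hσ hV hmode hx)) ?_
  rintro σ₁ - ⟨ho, hsp₁, hm₁, hV₁⟩
  have hsph : σ₁.v rSP * h.size ≤ 2 * T.size := by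
    rw [hsp₁]; exact (Nat.mul_le_mul_left _ (by omega)).trans hsp
  refine (hworks h (by simp) x b σ₁ k₁ k₂ ho.tables hm₁ hV₁ hsph).trans fun σ₂ ha hd => ?_
  have hfr := hd.kept.frames b (by omega)
  have htab := ho.tables.round ha
  have ho₂ : Opened P T t v b x σ σ₂ := by
    refine ⟨htab, ⟨fun j hj => ?_, fun q hq => ?_⟩, ?_, ?_⟩
    · have := ho.kept.windows j hj
      have := hd.kept.windows j (by omega)
      omega
    · have := ho.kept.frames q hq
      have := hd.kept.frames q (by omega)
      omega
    · rw [hfr.2]; exact ho.top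
    · rw [ha.2 aHvy (by decide)]; exact ho.heavy
  have hsn := (Nat.le_mul_of_pos_right (σ.v rSP) (size_pos t)).trans hsp
  have habs := absorb_heavy hW hcap hPT hB (σ' := (σ₂.setV rP b).setV rH x)
    ⟨htab.congr (by simp) (by simp), ⟨ho₂.kept.windows, ho₂.kept.frames⟩, ho₂.top, ho₂.heavy⟩
    (by simp [hd.height, hsp₁]) hd.marked (by simp) (by simp) (by simp [hd.node]) hsn
  obtain ⟨τ, σ₃, hτ, hex, e, heh, hFr⟩ := habs
  exact right_phase hW hcap hPT hB hxL hworks hsp heh (R' := R) (M := []) (y := x) (by simp)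
    ⟨htab, hd.mode, hd.node, x₂, x₃, x₁, ho₂.heavy, τ, σ₃, hτ, hex, hFr⟩ le_rfl
    (by simpa using k₄) (by omega)

/-- The main loop marks the text nodes whose subtrees include the pattern. -/
theorem search_spec (hW : 128 * T.size ≤ W) (hcap : cap = 6 * T.size) (hPT : P.size ≤ T.size)
    {σ : State} (hσ : Tables P T σ) (hmode : σ.v rMode = 0) (hV : σ.v rV = 0)
    (hsp : σ.v rSP = 0) :
    Within W cap (.loop (.lt rMode 2) round) (1024 * (P.numLeaves * T.size)) (Marked T P) σ := by
  have hn0 := (isTree T).pos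
  have hl := numLeaves_pos P
  have h : Reach W cap (.lt rMode 2) round (256 * T.size * (4 * P.numLeaves - 3) + (3 + 1))
      (fun σ' => σ'.v rMode = 2 ∧ Marked T P σ') σ := by
    refine (works hW hcap hPT P 0 0 σ (stands_self P) (encoded_self P) hσ hmode hV
      (by simp [hsp])).trans fun σ₁ ha hd => .one (by simp; omega) (by simp [hd.mode]) ?_
    unfold TreeInclusion.round TreeInclusion.done
    refine .iteFalse (T := 2) (by simp; omega) (by simp [hd.mode]) (.iteTrue (by simp; omega)
      (by simp [hd.node]) ((Cmd.within_of_wp ?_).le_time (by simp)))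
    exact ⟨by simp; omega, by simp, hd.marked⟩
  refine (h.within fun σ' _ h => ⟨by simp; omega, by simp [h.1]⟩).mono ?_ fun _ _ h => h.2
  obtain ⟨l, hl⟩ : ∃ l, P.numLeaves = l + 1 := ⟨P.numLeaves - 1, by omega⟩
  rw [hl, show 4 * (l + 1) - 3 = 4 * l + 1 by omega]
  have : 256 * T.size * (4 * l + 1) = 1024 * (l * T.size) + 256 * T.size := by ring
  rw [this, Nat.add_mul]
  omega

/-! ### The answer -/

theorem output_spec {n : ℕ} (hW : 128 * n ≤ W) (hcap : cap = 6 * n) (hn0 : 0 < n) {σ : State}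
    (hn : σ.v rNT = n) {p : ℕ → Bool} (hp : ∀ w, w < n → (σ.a aInc w = if p w then 1 else 0)) :
    Within W cap output (16 * n) (fun σ' => σ'.v rAns = (if p 0 then 1 else 0) ∧
      σ'.v rCnt = ((List.range n).filter p).length ∧
      ∀ j (hj : j < ((List.range n).filter p).length),
        j < n ∧ σ'.a aInp j = ((List.range n).filter p)[j]) σ := by
  obtain ⟨q, hq⟩ : ∃ q : ℕ → List ℕ, ∀ i, q i = (List.range i).filter p := ⟨_, fun _ => rfl⟩
  have hlen : ∀ i, (q i).length ≤ i := fun i => by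
    rw [hq]; exact (List.length_filter_le _ _).trans (by simp)
  have hsucc : ∀ i, q (i + 1) = q i ++ if p i then [i] else [] := fun i => by
    rw [hq, hq, List.range_succ, List.filter_append]; cases hpi : p i <;> simp [hpi]
  simp only [← hq n]
  unfold output
  refine Within.le_time (T := n * 5 + 1 + 1 + 1 + 1) ?_ (by omega)
  refine .set_seq (by simp; omega) (.set_seq (by simp; omega) (Within.seq (T := n * 5 + 1) (T' := 1)
    (Within.loop_wp (m := n) (fun k σ' => σ'.v rI + k = n ∧ σ'.v rCnt = (q (σ'.v rI)).length ∧
      ∀ j, j < σ'.v rCnt → some (σ'.a aInp j) = (q (σ'.v rI))[j]?)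
    ?_ ?_ ?_) fun σ₁ ha₁ hq₁ => ?_))
  · rintro σ' ha ⟨h₁, -⟩
    have hN' := ha.1 rNT (by decide)
    simp [hn] at hN'
    simp [hN']; omega
  · rintro k σ' ha ⟨h₁, h₂, h₃⟩
    have hN' := ha.1 rNT (by decide)
    have hI' := ha.2 aInc (by decide)
    simp [hn] at hN' hI'
    have hi := hp (σ'.v rI) (by omega)
    have hl := hlen (σ'.v rI)
    rw [← hI'] at hi
    simp [hN', hi, hsucc]
    generalize σ'.v rI = i at *
    cases hpi : p i
    · simp
      exact ⟨by omega, by omega, by omega, by omega, h₂, h₃⟩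
    · simp
      and_intros <;> try omega
      intro j hj
      rcases hj.eq_or_lt with rfl | hj
      · simp [h₂]
      · rw [if_neg (by omega), h₃ j hj, List.getElem?_append_left (by omega)]
  · simp [hq]
  · obtain ⟨h₁, h₂, h₃⟩ := hq₁
    rw [show σ₁.v rI = n by omega] at h₂ h₃
    have hI' := ha₁.2 aInc (by decide)
    have hl := hlen n
    refine (Cmd.within_of_wp (c := .set rAns (aInc 0)) ?_).le_time (by simp)
    refine ⟨by simp; omega, by simpa [hI'] using hp 0 hn0, by simpa using h₂, fun j hj => ?_⟩
    have := h₃ j (by omega)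
    rw [List.getElem?_eq_getElem hj] at this
    exact ⟨by omega, by simpa using this⟩

theorem prepare_spec (hW : 128 * T.size ≤ W) (hcap : cap = 6 * T.size) (hPT : P.size ≤ T.size)
    {σ : State} (hσ : ∀ i, σ.a aInp i = (P.size :: T.size :: (P.encode ++ T.encode)).getD i 0) :
    Within W cap prepare (80 * T.size) (fun σ' => Tables P T σ' ∧ σ'.v rMode = 0 ∧ σ'.v rV = 0 ∧
      σ'.v rSP = 0) σ := by
  have hn0 := (isTree T).pos
  have hinP : ∀ i, i < 2 * P.size → σ.a aInp (2 + i) = P.encode.getD i 0 := fun i hi => by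
    rw [hσ, show 2 + i = i + 1 + 1 by omega, List.getD_cons_succ, List.getD_cons_succ,
      List.getD_append _ _ _ _ (by rw [length_encode]; exact hi)]
  have hinT : ∀ i, σ.a aInp (P.size + P.size + 2 + i) = T.encode.getD i 0 := fun i => by
    rw [hσ, show P.size + P.size + 2 + i = 2 * P.size + i + 1 + 1 by omega, List.getD_cons_succ,
      List.getD_cons_succ, List.getD_append_right _ _ _ _ (by rw [length_encode]; omega),
      length_encode]
    congr 1; omega
  have h0 : σ.a aInp 0 = P.size := by simp [hσ]
  have h1 : σ.a aInp 1 = T.size := by simp [hσ]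
  unfold prepare
  refine Within.le_time (T := (8 * T.size + ((8 * T.size + (16 * T.size + (16 * T.size +
    (24 * T.size + 3)))) + 1)) + 1 + 1 + 1) ?_ (by omega)
  refine .set_seq (by simp; omega) (.set_seq (by simp; omega) (.set_seq (by simp; omega) ?_))
  refine Within.seq (readNodes_spec hW hcap hPT hn0 (by decide) (by decide) (by decide)
    (by simp [h0]) (by simp; omega)) fun σ₁ ha₁ hq₁ => .set_seq ?_ ?_
  · have := ha₁.1 rNP (by decide)
    simp [h0] at this
    simp [this]; omega
  have n₁ := ha₁.1 rNP (by decide)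
  have n₁' := ha₁.1 rNT (by decide)
  simp [h0, h1] at n₁ n₁'
  have i₁ : σ₁.a aInp = σ.a aInp := ha₁.2 aInp (by decide)
  refine Within.seq (readNodes_spec hW hcap le_rfl hn0 (by decide) (by decide) (by decide)
    (by simp [n₁']) (by simp [n₁]; omega)) fun σ₂ ha₂ hq₂ => ?_
  have n₂ := ha₂.1 rNP (by decide)
  have n₂' := ha₂.1 rNT (by decide)
  simp [n₁, n₁'] at n₂ n₂'
  simp [n₁, i₁] at hq₂
  simp at hq₁
  have a₂ : ∀ k ∈ [aLabP, aParP], σ₂.a k = σ₁.a k := fun k hk =>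
    ha₂.2 k (by revert hk; cases k <;> decide)
  have lP : ∀ i, i < P.size → σ₂.a aLabP i = labOf P i := fun i hi => by
    rw [a₂ _ (by simp), (hq₁ i hi).1, hinP _ (by omega), encode_label hi]
  have pP : ∀ i, i < P.size → σ₂.a aParP i = parOf P i := fun i hi => by
    rw [a₂ _ (by simp), (hq₁ i hi).2, Nat.add_assoc, hinP _ (by omega)]; rfl
  have lT : ∀ i, i < T.size → σ₂.a aLabT i = labOf T i := fun i hi => by
    rw [(hq₂ i hi).1, hinT, encode_label hi]
  have pT : ∀ i, i < T.size → σ₂.a aParT i = parOf T i := fun i hi => by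
    rw [(hq₂ i hi).2, Nat.add_assoc, hinT]; rfl
  refine Within.seq (computeEnds_spec (isTree P) hW hcap hPT (by decide) (by decide) n₂ pP)
    fun σ₃ ha₃ hq₃ => ?_
  refine Within.seq (computeEnds_spec (isTree T) hW hcap le_rfl (by decide) (by decide)
    (by rw [ha₃.1 rNT (by decide), n₂']) (by rw [ha₃.2 aParT (by decide)]; exact pT))
    fun σ₄ ha₄ hq₄ => ?_
  refine Within.seq (computeLinks_spec (isTree P) hW hcap hPT
    (by rw [ha₄.1 rNP (by decide), ha₃.1 rNP (by decide), n₂])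
    (by rw [ha₄.2 aParP (by decide), ha₃.2 aParP (by decide)]; exact pP)
    (by rw [ha₄.2 aEndP (by decide)]; exact hq₃)) fun σ₅ ha₅ hq₅ => ?_
  have hv : ∀ x ∈ [rNP, rNT], σ₅.v x = σ₂.v x := fun x hx => by
    rw [ha₅.1 x (by revert hx; cases x <;> decide), ha₄.1 x (by revert hx; cases x <;> decide),
      ha₃.1 x (by revert hx; cases x <;> decide)]
  have hk : ∀ k ∈ [aLabP, aParP, aLabT, aParT], σ₅.a k = σ₂.a k := fun x hx => by
    rw [ha₅.2 x (by revert hx; cases x <;> decide), ha₄.2 x (by revert hx; cases x <;> decide),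
      ha₃.2 x (by revert hx; cases x <;> decide)]
  refine (Cmd.within_of_wp (c := .set rV 0 ;; .set rMode 0 ;; .set rSP 0) ?_).le_time (by simp)
  have tab : Tables P T σ₅ := by
    obtain ⟨e₁, e₂, e₃, e₄⟩ := hq₅
    constructor
    · rw [hv _ (by simp), n₂]
    · rw [hv _ (by simp), n₂']
    · rw [hk _ (by simp)]; exact lP
    · rw [hk _ (by simp)]; exact pP
    · exact e₂
    · exact e₁
    · exact e₃
    · exact e₄
    · rw [hk _ (by simp)]; exact lT
    · rw [hk _ (by simp)]; exact pT
    · rw [ha₅.2 aEndT (by decide)]; exact hq₄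
  refine ⟨by simp; omega, by simp; omega, by simp; omega, tab.congr (by simp) (by simp), by simp,
    by simp, by simp⟩

theorem main_spec (hW : 128 * T.size ≤ W) (hcap : cap = 6 * T.size) (hPT : P.size ≤ T.size)
    {σ : State} (hσ : ∀ i, σ.a aInp i = (P.size :: T.size :: (P.encode ++ T.encode)).getD i 0)
    {p : ℕ → Bool}
    (hp : ∀ w, w < T.size → (p w ↔ Fits (labOf T) (endOf T) [P] w (endOf T w))) :
    Within W cap main (1120 * (P.numLeaves * T.size)) (fun σ' =>
      σ'.v rAns = (if p 0 then 1 else 0) ∧ σ'.v rCnt = ((List.range T.size).filter p).length ∧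
      ∀ j (hj : j < ((List.range T.size).filter p).length),
        j < T.size ∧ σ'.a aInp j = ((List.range T.size).filter p)[j]) σ := by
  have hn0 := (isTree T).pos
  have hl := Nat.le_mul_of_pos_left T.size (numLeaves_pos P)
  unfold main
  refine Within.le_time ((prepare_spec hW hcap hPT hσ).seq fun σ₁ _ h₁ =>
    ((search_spec hW hcap hPT h₁.1 h₁.2.1 h₁.2.2.1 h₁.2.2.2).seq fun σ₂ ha₂ h₂ =>
      output_spec hW hcap hn0 ((ha₂.1 rNT (by decide)).trans h₁.1.sizeT) (p := p) fun w hw => ?_))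
    (by omega)
  obtain ⟨k₁, k₂, -⟩ := h₂ w hw
  split_ifs with h
  · exact k₁ ((hp w hw).1 h)
  · exact k₂ fun h' => h ((hp w hw).2 h')

end

/-- The program for the word RAM. It starts with the computation of the common capacity of the
arrays, which is six times the size of the text. -/
def inclusionProgram : Program :=
  [.const 5 1, .load 5 5, .const 6 6, .binop .mul capReg 5 6] ++ (main.code 4 ++ [.halt])

theorem getD_encode_lt {T : OTree} {N : ℕ} (h : ∀ S ∈ T.preorder, S.label < N) (hN : T.size ≤ N)
    (i : ℕ) : T.encode.getD i 0 < N := by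
  have hT := isTree T
  have hpos := hT.pos
  rcases Nat.lt_or_ge i (2 * T.size) with hi | hi
  · obtain ⟨w, rfl | rfl⟩ := Nat.even_or_odd' i
    · rw [encode_label (by omega)]
      exact labOf_lt h (by omega)
    · change parOf T w < N
      rcases Nat.eq_zero_or_pos w with rfl | hw
      · rw [hT.par_zero]; omega
      · have := hT.par_lt w hw (by omega)
        omega
  · rw [List.getD_eq_default _ _ (by rw [length_encode]; exact hi)]
    omega

theorem initialConfig_mem_lt {P T : OTree} {N : ℕ} (hP : ∀ S ∈ P.preorder, S.label < N)
    (hT : ∀ S ∈ T.preorder, S.label < N) (hPT : P.size ≤ T.size) (hN : T.size < N) (i : ℕ) :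
    (initialConfig P T).mem i < N := by
  change (P.size :: T.size :: (P.encode ++ T.encode)).getD i 0 < N
  rcases i with _ | _ | i
  · simp; omega
  · simpa using hN
  · rw [List.getD_cons_succ, List.getD_cons_succ]
    rcases Nat.lt_or_ge i P.encode.length with hi | hi
    · rw [List.getD_append _ _ _ _ hi]
      exact getD_encode_lt hP (by omega) i
    · rw [List.getD_append_right _ _ _ _ hi]
      exact getD_encode_lt hT hN.le _

end TreeInclusion

open TreeInclusion Var Arr in
theorem mainTheorem2 :
    ∃ (prog : TreeInclusion.Program) (timeConst spaceConst : ℕ),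
      ∀ (w : ℕ) (P T : TreeInclusion.OTree),
        P.size ≤ T.size →
        spaceConst * T.size ≤ 2 ^ w →
        (∀ S ∈ P.preorder, S.label < 2 ^ w) →
        (∀ S ∈ T.preorder, S.label < 2 ^ w) →
        ∃ (t : ℕ) (c : TreeInclusion.Config),
          t ≤ timeConst * (P.numLeaves * T.size) ∧
          TreeInclusion.HaltsIn prog w (spaceConst * T.size)
            (TreeInclusion.initialConfig P T) t c ∧
          TreeInclusion.SolvesInclusion P T c := by
  classical
  refine ⟨inclusionProgram, 4 + main.len * 1120, 128, fun w P T hPT hw hP hT => ?_⟩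
  have hn0 := (isTree T).pos
  have hl := numLeaves_pos P
  have hln : 1 ≤ P.numLeaves * T.size := Nat.mul_pos hl hn0
  have hmem := initialConfig_mem_lt hP hT hPT (by omega)
  -- the first four instructions
  set reg : ℕ → ℕ := Function.update (Function.update (Function.update (fun _ => 0) 5 T.size) 6 6)
    capReg (6 * T.size) with hreg
  have hstart : run inclusionProgram w (128 * T.size) 4 (initialConfig P T) =
      some ⟨4, reg, (initialConfig P T).mem⟩ := by
    have e₁ : 1 % 2 ^ w = 1 := Nat.mod_eq_of_lt (by omega)
    have e₂ : 6 % 2 ^ w = 6 := Nat.mod_eq_of_lt (by omega)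
    have e₃ : T.size * 6 % 2 ^ w = 6 * T.size := by rw [Nat.mod_eq_of_lt (by omega)]; omega
    have e₄ : 1 < 128 * T.size := by omega
    simp [run, step, inclusionProgram, e₁, e₂, e₃, e₄, initialConfig, BinOp.eval, hreg]
  have hrep : Represents (2 ^ w) (6 * T.size)
      ⟨fun x => reg x.idx, fun k i => (initialConfig P T).mem (k.idx * (6 * T.size) + i)⟩ reg
      (initialConfig P T).mem := by
    refine ⟨fun _ => rfl, fun _ _ _ => rfl, by simp [hreg], fun x => ?_, fun k i _ => hmem _⟩
    have : reg x.idx = 0 ∨ reg x.idx = T.size ∨ reg x.idx = 6 := by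
      cases x <;> simp [hreg, Var.idx, capReg]
    change reg x.idx < 2 ^ w
    omega
  have hcode : CodeAt inclusionProgram 4 (main.code 4 ++ [.halt]) := fun i hi => by
    unfold inclusionProgram
    rw [List.getElem?_append_right (by simp)]
    simp
  obtain ⟨t, σ, ht, hex, hAns, hCnt, hInp⟩ := main_spec (P := P) (W := 2 ^ w)
    (σ := ⟨fun x => reg x.idx, fun k i => (initialConfig P T).mem (k.idx * (6 * T.size) + i)⟩)
    hw rfl hPT (fun i => by simp [Arr.idx, initialConfig])
    (p := fun v => decide (Fits (labOf T) (endOf T) [P] v (endOf T v))) (fun v _ => by simp)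
  obtain ⟨t', c', ht', hrun, hpc, hR⟩ := hex.run_code (s := 128 * T.size) (by omega) hw
    ⟨4, reg, (initialConfig P T).mem⟩ hrep hcode.left
  refine ⟨4 + t', c', ?_, ⟨run_trans hstart hrun, ?_⟩, ?_⟩
  · have h₁ := Nat.mul_le_mul_left main.len ht
    rw [Nat.add_mul, Nat.mul_assoc]
    omega
  · have := hcode.right.head
    rwa [Cmd.length_code, ← hpc] at this
  · have hroot := included_iff_fits (P := P) (stands_self T)
    have h0 : c'.reg 0 = σ.v rAns := hR.var rAns
    refine ⟨fun h => ?_, fun h => ?_, _, List.pairwise_lt_range.filter _, fun i => ?_,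
      (hR.var rCnt).trans hCnt, fun j hj => ?_⟩
    · rw [h0, hAns, if_pos (by simpa using hroot.1 h)]
    · rw [h0, hAns, if_neg (by simpa using fun h' => h (hroot.2 h'))]
    · simp only [List.mem_filter, List.mem_range, decide_eq_true_eq]
      constructor
      · rintro ⟨hi, hf⟩
        have hS : T.preorder[i]? = some T.preorder[i] := List.getElem?_eq_getElem hi
        exact ⟨_, hS, (included_iff_fits (stands_of_getElem? hS)).2 hf⟩
      · rintro ⟨S, hS, hPS⟩
        exact ⟨(List.getElem?_eq_some_iff.1 hS).1,
          (included_iff_fits (stands_of_getElem? hS)).1 hPS⟩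
    · obtain ⟨h₁, h₂⟩ := hInp j hj
      rw [← h₂, ← hR.arr aInp j (by omega)]
      simp [Arr.idx]
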